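/- Setting. Let $\widehat{\mathfrak g}$ be an affine Kac--Moody algebra over $\mathbb C$ (untwisted or twisted), realized as follows. Let $\mathfrak s$ be a finite-dimensional simple complex Lie algebra with Chevalley generators, Cartan subalgebra $\mathfrak h'$ and Killing form $\kappa$, let $\sigma$ be a diagram automorphism of $\mathfrak s$ of order $r$ (possibly $r=1$), and let $\mathfrak s_n=\{u\in\mathfrak s:\sigma(u)=e^{2\pi i n/r}u\}$. Then $\widehat{\mathfrak g}=\bigoplus_{n\in\mathbb Z}\mathfrak s_n\otimes t^n\oplus\mathbb Cc\oplus\mathbb Cd$ with $c$ central, $[d,u\otimes t^n]=n\,u\otimes t^n$ and $[u\otimes t^m,v\otimes t^n]=[u,v]\otimes t^{m+n}+m\,\delta_{m+n,0}\,\kappa(u,v)\,c$. Its Cartan subalgebra is $H=\mathfrak h\oplus\mathbb Cc\oplus\mathbb Cd$, where $\mathfrak h$ is the space of $\sigma$-fixed elements of $\mathfrak h'$; $\Delta$ is the set of roots and $\widehat{\mathfrak g}_\alpha$ are the root spaces with respect to $H$; $\delta\in H^*$ is given by $\delta(\mathfrak h)=\delta(c)=0$, $\delta(d)=1$; the imaginary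 roots are the $k\delta$ with $k\in\mathbb Z\setminus\{0\}$, and the other roots are called real. Let $G=\bigoplus_{k\ne0}\widehat{\mathfrak g}_{k\delta}\oplus\mathbb Cc$ be the Heisenberg subalgebra and $G_+=\bigoplus_{k>0}\widehat{\mathfrak g}_{k\delta}$. Orthogonality refers to the standard invariant symmetric form on $\widehat{\mathfrak g}$, given by $(u\otimes t^m,v\otimes t^n)=\delta_{m+n,0}\,\kappa(u,v)$, $(c,d)=1$, $(c,c)=(d,d)=0$, and $c,d$ orthogonal to all $u\otimes t^n$. Let $P\subset\Delta$ be a parabolic subset ($P$ is closed under addition of roots and $P\cup -P=\Delta$), and let $\widehat{\mathfrak l}=H\oplus\bigoplus_{\alpha\in P\cap -P}\widehat{\mathfrak g}_\alpha$ be the Levi factor of the corresponding parabolic subalgebra. Assume $G\subset\widehat{\mathfrak l}$. Let $\widehat{\mathfrak l}_0$ be the Lie subalgebra of $\widehat{\mathfrak l}$ generated by its real root subspaces, $G(\widehat{\mathfrak l})$ the Lie subalgebra of $\widehat{\mathfrak l}_0$ generated by its imaginary root subspaces $\widehat{\mathfrak l}_0\cap\widehat{\mathfrak g}_{k\delta}$,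 $G(\widehat{\mathfrak l})^\perp$ the orthogonal complement of $G(\widehat{\mathfrak l})$ in $G$, and $G(\widehat{\mathfrak l})^\perp_+=G(\widehat{\mathfrak l})^\perp\cap G_+$. Put $\widetilde{\mathfrak l}_0=\widehat{\mathfrak l}_0+\mathbb Cd$ and $\widetilde G(\widehat{\mathfrak l})^\perp=G(\widehat{\mathfrak l})^\perp+\mathbb Cd$. Let $\widehat{\mathfrak l}_1$ be the Lie subalgebra generated by $d$ and all $\widehat{\mathfrak g}_\alpha\cap\widehat{\mathfrak l}$, $\alpha\in\Delta$; let $\mathfrak h_{\mathfrak l}=\mathfrak h\cap\widehat{\mathfrak l}_1$, let $\mathfrak h_{\mathfrak l}^\perp$ be its orthogonal complement in $\mathfrak h$, and let $\lambda\in(\mathfrak h_{\mathfrak l}^\perp)^*$. Write $L=\widehat{\mathfrak l}_0+G(\widehat{\mathfrak l})^\perp+\mathfrak h_{\mathfrak l}^\perp$. A module over a subalgebra of $\widehat{\mathfrak g}$ has central charge $a\in\mathbb C$ if $c$, where it lies in the subalgebra, acts by the scalar $a$. A weight $\widetilde{\mathfrak l}_0$-module is one that is the direct sum of its weight spaces with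 respect to $\widetilde{\mathfrak l}_0\cap H$. Proposition. (1) Let $M$ and $S$ be irreducible modules over $\widehat{\mathfrak l}_0$ and $G(\widehat{\mathfrak l})^\perp$ respectively, with the same central charge $a\in\mathbb C$. Then $M\otimes S$ is an irreducible $L$-module with central charge $a$, where $x(v\otimes w)=xv\otimes w$ for $x\in\widehat{\mathfrak l}_0$, $y(v\otimes w)=v\otimes yw$ for $y\in G(\widehat{\mathfrak l})^\perp$, and $h(v\otimes w)=\lambda(h)\,v\otimes w$ for $h\in\mathfrak h_{\mathfrak l}^\perp$. (2) Let $V$ be an irreducible $L$-module with central charge $a\in\mathbb C$ on which $\mathfrak h_{\mathfrak l}^\perp$ acts via $\lambda$, and let $S\subset V$ be an irreducible $G(\widehat{\mathfrak l})^\perp$-submodule. Then there is an irreducible $\widehat{\mathfrak l}_0$-module $M$ with central charge $a$ such that $V\simeq M\otimes S$ as $L$-modules, with the action on $M\otimes S$ as in (1). (3) Let $a\in\mathbb C\setminus\{0\}$, let $M$ be a weight $\widetilde{\mathfrak l}_0$-module with central charge $a$ that is irreducible as an $\widehat{\mathfrak l}_0$-module, and let $S$ be an irreducible Whittaker $\widetilde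 G(\widehat{\mathfrak l})^\perp$-module of type $\eta$ with central charge $a$, where $\eta:U(G(\widehat{\mathfrak l})^\perp_+)\to\mathbb C$ is an algebra homomorphism; that is, $S$ is generated by a vector $v$ with $xv=\eta(x)v$ for all $x\in U(G(\widehat{\mathfrak l})^\perp_+)$. Assume that $\eta|_{G(\widehat{\mathfrak l})^\perp\cap\widehat{\mathfrak g}_{n\delta}}\ne0$ for infinitely many integers $n>0$. Then $M\otimes S$ is an irreducible $\widehat{\mathfrak l}$-module with central charge $a$, where $\widehat{\mathfrak l}_0$, $G(\widehat{\mathfrak l})^\perp$ and $\mathfrak h_{\mathfrak l}^\perp$ act as in (1) and $d(v\otimes w)=dv\otimes w+v\otimes dw$. -/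

import Mathlib

open scoped TensorProduct

-- The commutator bracket on an associative ring, used for `Module.End ℂ V`.
attribute [local instance 100] LieRing.ofAssociativeRing

noncomputable section

namespace AffineKM

section Construction

variable {g : Type*} [LieRing g] [LieAlgebra ℂ g]

/-- The bilinear extension to loops `∑ uₙ tⁿ` (finitely supported `ℤ → g`) of a family of bilinear
maps `β m n`, the value of `β m n` being used on `(u tᵐ, v tⁿ)`. -/
def loopBilin {W : Type*} [AddCommGroup W] [Module ℂ W] (β : ℤ → ℤ → g →ₗ[ℂ] g →ₗ[ℂ] W) :
    (ℤ →₀ g) →ₗ[ℂ] (ℤ →₀ g) →ₗ[ℂ] W :=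
  Finsupp.lsum ℂ fun m => (Finsupp.lsum ℂ fun n => (β m n).flip).flip

@[simp] theorem loopBilin_single {W : Type*} [AddCommGroup W] [Module ℂ W]
    (β : ℤ → ℤ → g →ₗ[ℂ] g →ₗ[ℂ] W) (m n : ℤ) (u v : g) :
    loopBilin β (Finsupp.single m u) (Finsupp.single n v) = β m n u v := by
  simp [loopBilin]

/-- The loop bracket `[u tᵐ, v tⁿ] = [u, v] tᵐ⁺ⁿ`. -/
def loopLie : (ℤ →₀ g) →ₗ[ℂ] (ℤ →₀ g) →ₗ[ℂ] (ℤ →₀ g) :=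
  loopBilin fun m n =>
    (LieModule.toEnd ℂ g g : g →ₗ[ℂ] Module.End ℂ g).compr₂ (Finsupp.lsingle (m + n))

/-- The loop cocycle `ω(u tᵐ, v tⁿ) = m δ_{m+n,0} κ(u, v)`, with `κ` the Killing form of `g`. -/
def loopCocycle : (ℤ →₀ g) →ₗ[ℂ] (ℤ →₀ g) →ₗ[ℂ] ℂ :=
  loopBilin fun m n => if m + n = 0 then (m : ℂ) • killingForm ℂ g else 0

/-- The loop form `(u tᵐ, v tⁿ) = δ_{m+n,0} κ(u, v)`. -/
def loopForm : (ℤ →₀ g) →ₗ[ℂ] (ℤ →₀ g) →ₗ[ℂ] ℂ :=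
  loopBilin fun m n => if m + n = 0 then killingForm ℂ g else 0

/-- The derivation `t d/dt`, i.e. `u tⁿ ↦ n u tⁿ`. -/
def loopDeg : (ℤ →₀ g) →ₗ[ℂ] (ℤ →₀ g) :=
  Finsupp.lsum ℂ fun n => (n : ℂ) • Finsupp.lsingle n

theorem loopLie_single (m n : ℤ) (u v : g) :
    loopLie (Finsupp.single m u) (Finsupp.single n v) = Finsupp.single (m + n) ⁅u, v⁆ := by
  simp [loopLie]

theorem loopCocycle_single (m n : ℤ) (u v : g) :
    loopCocycle (Finsupp.single m u) (Finsupp.single n v)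
      = if m + n = 0 then (m : ℂ) * killingForm ℂ g u v else 0 := by
  rw [loopCocycle, loopBilin_single]; split_ifs <;> simp

theorem loopForm_single (m n : ℤ) (u v : g) :
    loopForm (Finsupp.single m u) (Finsupp.single n v)
      = if m + n = 0 then killingForm ℂ g u v else 0 := by
  rw [loopForm, loopBilin_single]; split_ifs <;> simp

theorem loopDeg_single (n : ℤ) (u : g) :
    loopDeg (Finsupp.single n u) = Finsupp.single n ((n : ℂ) • u) := by
  simp [loopDeg]

theorem loopLie_skew (x y : ℤ →₀ g) : loopLie x y = -loopLie y x := by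
  induction x using Finsupp.induction_linear with
  | zero => simp
  | add a b ha hb => simp only [map_add, LinearMap.add_apply, ha, hb]; abel
  | single m u =>
    induction y using Finsupp.induction_linear with
    | zero => simp
    | add a b ha hb => simp only [map_add, LinearMap.add_apply, ha, hb]; abel
    | single n v =>
      rw [loopLie_single, loopLie_single, add_comm n m, ← Finsupp.single_neg, lie_skew]

theorem loopLie_jacobi (x y z : ℤ →₀ g) :
    loopLie x (loopLie y z) = loopLie (loopLie x y) z + loopLie y (loopLie x z) := by
  induction x using Finsupp.induction_linear with
  | zero => simp
  | add a b ha hb => simp only [map_add, LinearMap.add_apply, ha, hb]; abel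
  | single m u =>
    induction y using Finsupp.induction_linear with
    | zero => simp
    | add a b ha hb => simp only [map_add, LinearMap.add_apply, ha, hb]; abel
    | single n v =>
      induction z using Finsupp.induction_linear with
      | zero => simp
      | add a b ha hb => simp only [map_add, ha, hb]; abel
      | single k w =>
        simp only [loopLie_single, show n + (m + k) = m + (n + k) by ring,
          show m + n + k = m + (n + k) by ring, ← Finsupp.single_add]
        rw [leibniz_lie]

theorem loopDeg_lie (x y : ℤ →₀ g) :
    loopDeg (loopLie x y) = loopLie (loopDeg x) y + loopLie x (loopDeg y) := by
  induction x using Finsupp.induction_linear with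
  | zero => simp
  | add a b ha hb => simp only [map_add, LinearMap.add_apply, ha, hb]; abel
  | single m u =>
    induction y using Finsupp.induction_linear with
    | zero => simp
    | add a b ha hb => simp only [map_add, ha, hb]; abel
    | single n v =>
      simp only [loopLie_single, loopDeg_single, ← Finsupp.single_add, smul_lie, lie_smul,
        ← add_smul]
      push_cast; rfl

theorem loopCocycle_skew (x y : ℤ →₀ g) : loopCocycle x y = -loopCocycle y x := by
  induction x using Finsupp.induction_linear with
  | zero => simp
  | add a b ha hb => simp only [map_add, LinearMap.add_apply, ha, hb]; ring
  | single m u =>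
    induction y using Finsupp.induction_linear with
    | zero => simp
    | add a b ha hb => simp only [map_add, LinearMap.add_apply, ha, hb]; ring
    | single n v =>
      simp only [loopCocycle_single, add_comm n m]
      split_ifs with h
      · obtain rfl : n = -m := by omega
        rw [LieModule.traceForm_comm]; push_cast; ring
      · simp

theorem loopCocycle_deg (x y : ℤ →₀ g) :
    loopCocycle (loopDeg x) y + loopCocycle x (loopDeg y) = 0 := by
  induction x using Finsupp.induction_linear with
  | zero => simp
  | add a b ha hb =>
    simp only [map_add, LinearMap.add_apply]; linear_combination ha + hb
  | single m u =>
    induction y using Finsupp.induction_linear with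
    | zero => simp
    | add a b ha hb => simp only [map_add]; linear_combination ha + hb
    | single n v =>
      simp only [loopDeg_single, loopCocycle_single, map_smul, LinearMap.smul_apply, smul_eq_mul]
      split_ifs with h
      · obtain rfl : n = -m := by omega
        push_cast; ring
      · simp

theorem loopCocycle_jacobi (x y z : ℤ →₀ g) :
    loopCocycle x (loopLie y z) = loopCocycle (loopLie x y) z + loopCocycle y (loopLie x z) := by
  induction x using Finsupp.induction_linear with
  | zero => simp
  | add a b ha hb => simp only [map_add, LinearMap.add_apply, ha, hb]; ring
  | single m u =>
    induction y using Finsupp.induction_linear with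
    | zero => simp
    | add a b ha hb => simp only [map_add, LinearMap.add_apply, ha, hb]; ring
    | single n v =>
      induction z using Finsupp.induction_linear with
      | zero => simp
      | add a b ha hb => simp only [map_add, ha, hb]; ring
      | single k w =>
        simp only [loopLie_single, loopCocycle_single, show n + (m + k) = m + (n + k) by ring,
          show m + n + k = m + (n + k) by ring]
        split_ifs with h
        · have e1 : killingForm ℂ g ⁅u, v⁆ w = killingForm ℂ g u ⁅v, w⁆ :=
            LieModule.traceForm_apply_lie_apply ℂ g g u v w
          have e2 : killingForm ℂ g ⁅v, u⁆ w = killingForm ℂ g v ⁅u, w⁆ :=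
            LieModule.traceForm_apply_lie_apply ℂ g g v u w
          have e3 : killingForm ℂ g ⁅v, u⁆ w = -killingForm ℂ g ⁅u, v⁆ w := by
            rw [← lie_skew, map_neg, LinearMap.neg_apply]
          rw [← e2, e3, ← e1]; push_cast; ring
        · simp

end Construction

/-- The vector space `g ⊗ ℂ[t, t⁻¹] ⊕ ℂ c ⊕ ℂ d`; the loop `∑ uₙ tⁿ` is stored as the finitely
supported function `n ↦ uₙ`. -/
@[ext] structure Aff (g : Type*) [LieRing g] where
  loop : ℤ →₀ g
  central : ℂ
  der : ℂ

namespace Aff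

section Additive

variable {g : Type*} [LieRing g]

/-- The underlying product. -/
def equivProd : Aff g ≃ (ℤ →₀ g) × ℂ × ℂ where
  toFun x := (x.loop, x.central, x.der)
  invFun p := ⟨p.1, p.2.1, p.2.2⟩
  left_inv _ := rfl
  right_inv _ := rfl

instance : AddCommGroup (Aff g) := equivProd.addCommGroup

@[simp] theorem zero_loop : (0 : Aff g).loop = 0 := rfl
@[simp] theorem zero_central : (0 : Aff g).central = 0 := rfl
@[simp] theorem zero_der : (0 : Aff g).der = 0 := rfl
@[simp] theorem add_loop (x y : Aff g) : (x + y).loop = x.loop + y.loop := rfl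
@[simp] theorem add_central (x y : Aff g) : (x + y).central = x.central + y.central := rfl
@[simp] theorem add_der (x y : Aff g) : (x + y).der = x.der + y.der := rfl

end Additive

variable {g : Type*} [LieRing g] [LieAlgebra ℂ g]

instance : Module ℂ (Aff g) := equivProd.module ℂ

/-- The bracket `[u tᵐ, v tⁿ] = [u, v] tᵐ⁺ⁿ + m δ_{m+n,0} κ(u, v) c`, `[d, u tⁿ] = n u tⁿ`,
`c` central. -/
instance : Bracket (Aff g) (Aff g) where
  bracket x y :=
    ⟨loopLie x.loop y.loop + x.der • loopDeg y.loop - y.der • loopDeg x.loop,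
      loopCocycle x.loop y.loop, 0⟩

@[simp] theorem smul_loop (r : ℂ) (x : Aff g) : (r • x).loop = r • x.loop := rfl
@[simp] theorem smul_central (r : ℂ) (x : Aff g) : (r • x).central = r * x.central := rfl
@[simp] theorem smul_der (r : ℂ) (x : Aff g) : (r • x).der = r * x.der := rfl
@[simp] theorem lie_loop (x y : Aff g) : ⁅x, y⁆.loop =
    loopLie x.loop y.loop + x.der • loopDeg y.loop - y.der • loopDeg x.loop := rfl
@[simp] theorem lie_central (x y : Aff g) : ⁅x, y⁆.central = loopCocycle x.loop y.loop := rfl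
@[simp] theorem lie_der (x y : Aff g) : ⁅x, y⁆.der = 0 := rfl

instance : LieRing (Aff g) where
  add_lie x y z := by
    ext1
    · simp only [lie_loop, add_loop, add_der, map_add, LinearMap.add_apply]; module
    · simp
    · simp
  lie_add x y z := by
    ext1
    · simp only [lie_loop, add_loop, add_der, map_add]; module
    · simp
    · simp
  lie_self x := by
    ext1
    · have h : loopLie x.loop x.loop = 0 := by
        have h := loopLie_skew x.loop x.loop
        have h2 : (2 : ℂ) • loopLie x.loop x.loop = 0 := by
          rw [two_smul]; nth_rewrite 1 [h]; simp
        exact (smul_eq_zero.mp h2).resolve_left two_ne_zero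
      simp [h]
    · have := loopCocycle_skew x.loop x.loop
      simp only [lie_central, zero_central]; linear_combination this / 2
    · simp
  leibniz_lie x y z := by
    ext1
    · simp only [lie_loop, add_loop, lie_der, map_add, map_sub, map_smul, loopDeg_lie,
        LinearMap.add_apply, LinearMap.sub_apply, LinearMap.smul_apply,
        loopLie_jacobi x.loop y.loop z.loop]
      rw [loopLie_skew (loopDeg x.loop) y.loop]
      module
    · simp only [lie_loop, add_central, lie_central, map_add, map_sub, map_smul,
        LinearMap.add_apply, LinearMap.sub_apply, LinearMap.smul_apply, smul_eq_mul]
      have h1 := loopCocycle_jacobi x.loop y.loop z.loop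
      have h2 := loopCocycle_deg x.loop y.loop
      have h3 := loopCocycle_deg x.loop z.loop
      have h4 := loopCocycle_deg y.loop z.loop
      have h5 := loopCocycle_skew y.loop (loopDeg x.loop)
      linear_combination h1 + y.der * h3 - x.der * h4 - z.der * h2 + z.der * h5
    · simp

instance : LieAlgebra ℂ (Aff g) where
  lie_smul r x y := by
    ext1
    · simp only [lie_loop, smul_loop, smul_der, map_smul]; module
    · simp
    · simp

/-- The element `u tⁿ`. -/
def mono (n : ℤ) : g →ₗ[ℂ] Aff g where
  toFun u := ⟨Finsupp.single n u, 0, 0⟩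
  map_add' u v := by ext1 <;> simp
  map_smul' r u := by ext1 <;> simp

/-- The central element. -/
def c : Aff g := ⟨0, 1, 0⟩

/-- The degree derivation. -/
def d : Aff g := ⟨0, 0, 1⟩

/-- The standard invariant symmetric bilinear form:
`(u tᵐ, v tⁿ) = δ_{m+n,0} κ(u, v)`, `(c, d) = 1`, `(c, c) = (d, d) = 0`, and `c`, `d` are
orthogonal to all loops. -/
def form (x y : Aff g) : ℂ :=
  loopForm x.loop y.loop + x.central * y.der + x.der * y.central

theorem mono_lie_mono (m n : ℤ) (u v : g) : ⁅mono m u, mono n v⁆ =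
    mono (m + n) ⁅u, v⁆ + (if m + n = 0 then (m : ℂ) * killingForm ℂ g u v else 0) • c := by
  split_ifs with h
  · ext1 <;> simp [mono, c, loopLie_single, loopCocycle_single, h]
  · ext1 <;> simp [mono, c, loopLie_single, loopCocycle_single, h]

theorem d_lie_mono (n : ℤ) (u : g) : ⁅(d : Aff g), mono n u⁆ = mono n ((n : ℂ) • u) := by
  ext1
  · simp [mono, d, loopDeg_single]
  · simp [mono, d]
  · simp [mono, d]

theorem c_lie (x : Aff g) : ⁅(c : Aff g), x⁆ = 0 := by
  ext1 <;> simp [c]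

theorem form_add_left (x y z : Aff g) : form (x + y) z = form x z + form y z := by
  simp only [form, add_loop, add_central, add_der, map_add, LinearMap.add_apply]; ring

theorem form_smul_left (r : ℂ) (x y : Aff g) : form (r • x) y = r * form x y := by
  simp only [form, smul_loop, smul_central, smul_der, map_smul, LinearMap.smul_apply, smul_eq_mul]
  ring

end Aff

open Aff

/-! ### Affine Kac-Moody algebras, twisted and untwisted -/

/-- The data from which an affine Kac-Moody algebra is made: a Lie algebra `g` (finite-dimensional
and simple below) with Chevalley generators `eᵢ, fᵢ, hᵢ`, and a diagram automorphism, that is an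
automorphism permuting the `eᵢ` and the `fᵢ` by one and the same permutation of the index set.
The trivial permutation gives the untwisted algebras. -/
structure AffineDatum (ι g : Type*) [Finite ι] [LieRing g] [LieAlgebra ℂ g] where
  cartan : LieSubalgebra ℂ g
  basis : LieAlgebra.Basis ι cartan
  perm : Equiv.Perm ι
  aut : g ≃ₗ⁅ℂ⁆ g
  aut_e : ∀ i, aut (basis.e i) = basis.e (perm i)
  aut_f : ∀ i, aut (basis.f i) = basis.f (perm i)

namespace AffineDatum

variable {ι g : Type*} [Finite ι] [LieRing g] [LieAlgebra ℂ g] (D : AffineDatum ι g)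

/-- The primitive root of unity `exp(2πi/r)`, `r` the order of the diagram automorphism. -/
def zeta : ℂ := Complex.exp (2 * Real.pi * Complex.I / (orderOf D.perm : ℂ))

/-- The eigenspace `g_n` of the diagram automorphism, for the eigenvalue `exp(2πi n/r)`. -/
def grade (n : ℤ) : Submodule ℂ g :=
  Module.End.eigenspace (D.aut : g →ₗ[ℂ] g) (D.zeta ^ n)

theorem zeta_ne_zero : D.zeta ≠ 0 := Complex.exp_ne_zero _

theorem lie_mem_grade {m n : ℤ} {u v : g} (hu : u ∈ D.grade m) (hv : v ∈ D.grade n) :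
    ⁅u, v⁆ ∈ D.grade (m + n) := by
  rw [grade, Module.End.mem_eigenspace_iff] at *
  have hu' : D.aut u = D.zeta ^ m • u := hu
  have hv' : D.aut v = D.zeta ^ n • v := hv
  change D.aut ⁅u, v⁆ = _
  rw [LieEquiv.map_lie, hu', hv', smul_lie, lie_smul, smul_smul, zpow_add₀ D.zeta_ne_zero]

/-- The spanning set `{u tⁿ | u ∈ g_n} ∪ {c, d}` of the affine algebra. -/
def spanningSet : Set (Aff g) := {x | ∃ n : ℤ, ∃ u ∈ D.grade n, x = mono n u} ∪ {c, d}

/-- The affine Kac-Moody algebra `ĝ = ⨁ₙ g_n tⁿ ⊕ ℂ c ⊕ ℂ d`. -/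
def ghat : LieSubalgebra ℂ (Aff g) where
  toSubmodule := Submodule.span ℂ D.spanningSet
  lie_mem' := by
    intro x y hx hy
    change x ∈ Submodule.span ℂ D.spanningSet at hx
    change y ∈ Submodule.span ℂ D.spanningSet at hy
    change ⁅x, y⁆ ∈ Submodule.span ℂ D.spanningSet
    have hc : (c : Aff g) ∈ Submodule.span ℂ D.spanningSet :=
      Submodule.subset_span (Or.inr (Or.inl rfl))
    have hm : ∀ (n : ℤ) (u : g), u ∈ D.grade n → mono n u ∈ Submodule.span ℂ D.spanningSet :=
      fun n u hu => Submodule.subset_span (Or.inl ⟨n, u, hu, rfl⟩)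
    induction hx using Submodule.span_induction with
    | zero => simp
    | add a b _ _ ha hb => rw [add_lie]; exact add_mem ha hb
    | smul r a _ ha => rw [smul_lie]; exact Submodule.smul_mem _ r ha
    | mem a ha =>
      induction hy using Submodule.span_induction with
      | zero => simp
      | add a b _ _ ha hb => rw [lie_add]; exact add_mem ha hb
      | smul r a _ ha => rw [lie_smul]; exact Submodule.smul_mem _ r ha
      | mem b hb =>
        rcases ha with ⟨m, u, hu, rfl⟩ | rfl | rfl
        · rcases hb with ⟨n, v, hv, rfl⟩ | rfl | rfl
          · rw [mono_lie_mono]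
            exact add_mem (hm _ _ (D.lie_mem_grade hu hv)) (Submodule.smul_mem _ _ hc)
          · rw [← lie_skew, c_lie]; simp
          · rw [← lie_skew, d_lie_mono]
            exact neg_mem (hm _ _ (Submodule.smul_mem _ _ hu))
        · rw [c_lie]; simp
        · rcases hb with ⟨n, v, hv, rfl⟩ | rfl | rfl
          · rw [d_lie_mono]
            exact hm _ _ (Submodule.smul_mem _ _ hv)
          · rw [← lie_skew, c_lie]; simp
          · simp

/-- The finite-dimensional part `𝔥` of the Cartan subalgebra: the elements of the Cartan
subalgebra of `g` fixed by the diagram automorphism, in degree `0`. -/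
def finCartan : Submodule ℂ (Aff g) :=
  (D.cartan.toSubmodule ⊓ D.grade 0).map (mono 0)

/-- The Cartan subalgebra `H = 𝔥 ⊕ ℂ c ⊕ ℂ d` of `ĝ`. -/
def H : Submodule ℂ (Aff g) := D.finCartan ⊔ Submodule.span ℂ {c, d}

/-- The root space `ĝ_α = {x ∈ ĝ | [h, x] = α(h) x for all h ∈ H}`. -/
def rootSpace (α : Module.Dual ℂ D.H) : Submodule ℂ (Aff g) where
  carrier := {x | x ∈ D.ghat ∧ ∀ h : D.H, ⁅(h : Aff g), x⁆ = α h • x}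
  zero_mem' := ⟨zero_mem _, fun h => by simp⟩
  add_mem' := fun {x y} hx hy =>
    ⟨add_mem hx.1 hy.1, fun h => by rw [lie_add, hx.2 h, hy.2 h, smul_add]⟩
  smul_mem' := fun r x hx =>
    ⟨D.ghat.smul_mem r hx.1, fun h => by rw [lie_smul, hx.2 h, smul_comm]⟩

/-- The root system `Δ` of `ĝ`. -/
def roots : Set (Module.Dual ℂ D.H) := {α | α ≠ 0 ∧ D.rootSpace α ≠ ⊥}

/-- The functional `δ` on `H`, with `δ(𝔥) = δ(c) = 0` and `δ(d) = 1`. -/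
def delta : Module.Dual ℂ D.H where
  toFun h := (h : Aff g).der
  map_add' _ _ := rfl
  map_smul' _ _ := rfl

/-- The real roots: the roots that are not of the form `k δ`, `k ∈ ℤ \ {0}`. -/
def realRoots : Set (Module.Dual ℂ D.H) :=
  {α | α ∈ D.roots ∧ ∀ k : ℤ, k ≠ 0 → α ≠ k • D.delta}

/-- The Heisenberg subalgebra `G = ⨁_{k ≠ 0} ĝ_{kδ} ⊕ ℂ c` (a sum which is closed under the
bracket, hence equal to the subalgebra it generates). -/
def heisenberg : LieSubalgebra ℂ (Aff g) :=
  LieSubalgebra.lieSpan ℂ (Aff g)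
    ({x | ∃ k : ℤ, k ≠ 0 ∧ x ∈ D.rootSpace (k • D.delta)} ∪ {c})

/-- `G₊ = ⨁_{k > 0} ĝ_{kδ}`. -/
def heisenbergPos : LieSubalgebra ℂ (Aff g) :=
  LieSubalgebra.lieSpan ℂ (Aff g) {x | ∃ k : ℤ, 0 < k ∧ x ∈ D.rootSpace (k • D.delta)}

/-! ### Parabolic subalgebras and their Levi factors -/

/-- A parabolic subset `P` of the root system: closed under addition, and `P ∪ -P = Δ`. The
parabolic subalgebra is `H ⊕ ⨁_{α ∈ P} ĝ_α`. -/
structure IsParabolicSubset (P : Set (Module.Dual ℂ D.H)) : Prop where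
  subset_roots : P ⊆ D.roots
  mem_or_neg_mem : ∀ α ∈ D.roots, α ∈ P ∨ -α ∈ P
  add_mem : ∀ α ∈ P, ∀ β ∈ P, α + β ∈ D.roots → α + β ∈ P

variable (P : Set (Module.Dual ℂ D.H))

/-- The Levi factor `l̂ = H ⊕ ⨁_{α ∈ P ∩ -P} ĝ_α` of the parabolic subalgebra of `P` (for a
parabolic subset this sum is closed under the bracket, hence equal to the subalgebra it
generates). -/
def levi : LieSubalgebra ℂ (Aff g) :=
  LieSubalgebra.lieSpan ℂ (Aff g)
    ((D.H : Set (Aff g)) ∪ {x | ∃ α ∈ P, -α ∈ P ∧ x ∈ D.rootSpace α})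

/-- `l̂₁`: the subalgebra of `l̂` generated by the `ĝ_α ∩ l̂`, `α ∈ Δ`, and `d`. -/
def leviOne : LieSubalgebra ℂ (Aff g) :=
  LieSubalgebra.lieSpan ℂ (Aff g)
    ({x | x ∈ D.levi P ∧ ∃ α ∈ D.roots, x ∈ D.rootSpace α} ∪ {d})

/-- `𝔥_l = H_l ∩ 𝔥`, where `H_l = H ∩ l̂₁` is the Cartan subalgebra of `l̂₁`. -/
def hLevi : Submodule ℂ (Aff g) := (D.H ⊓ (D.leviOne P).toSubmodule) ⊓ D.finCartan

/-- `𝔥_l^⊥`: the orthogonal complement of `𝔥_l` in `𝔥`. -/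
def hPerp : Submodule ℂ (Aff g) where
  carrier := {x | x ∈ D.finCartan ∧ ∀ y ∈ D.hLevi P, form x y = 0}
  zero_mem' := ⟨zero_mem _, fun y _ => by simp [form]⟩
  add_mem' := fun {x x'} hx hx' =>
    ⟨add_mem hx.1 hx'.1, fun y hy => by rw [form_add_left, hx.2 y hy, hx'.2 y hy, add_zero]⟩
  smul_mem' := fun r x hx =>
    ⟨Submodule.smul_mem _ r hx.1, fun y hy => by rw [form_smul_left, hx.2 y hy, mul_zero]⟩

/-- `l̂₀`: the subalgebra of `l̂` generated by all its real root subspaces. -/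
def leviReal : LieSubalgebra ℂ (Aff g) :=
  LieSubalgebra.lieSpan ℂ (Aff g) {x | x ∈ D.levi P ∧ ∃ α ∈ D.realRoots, x ∈ D.rootSpace α}

/-- `G(l̂)`: the subalgebra of `l̂₀` spanned by its imaginary root subspaces. -/
def heisenbergLevi : LieSubalgebra ℂ (Aff g) :=
  LieSubalgebra.lieSpan ℂ (Aff g)
    {x | x ∈ D.leviReal P ∧ ∃ k : ℤ, k ≠ 0 ∧ x ∈ D.rootSpace (k • D.delta)}

/-- `G(l̂)^⊥`: the orthogonal complement of `G(l̂)` in `G` (which is closed under the bracket, hence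
equal to the subalgebra it generates). -/
def heisenbergPerp : LieSubalgebra ℂ (Aff g) :=
  LieSubalgebra.lieSpan ℂ (Aff g)
    {x | x ∈ D.heisenberg ∧ ∀ y ∈ D.heisenbergLevi P, form x y = 0}

/-- `G(l̂)^⊥₊ = G(l̂)^⊥ ∩ G₊`. -/
def heisenbergPerpPos : LieSubalgebra ℂ (Aff g) := D.heisenbergPerp P ⊓ D.heisenbergPos

/-- `l̃₀ = l̂₀ ⊕ ℂ d`. -/
def leviRealD : LieSubalgebra ℂ (Aff g) :=
  D.leviReal P ⊔ LieSubalgebra.lieSpan ℂ (Aff g) {d}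

/-- `G̃(l̂)^⊥ = G(l̂)^⊥ ⊕ ℂ d`. -/
def heisenbergPerpD : LieSubalgebra ℂ (Aff g) :=
  D.heisenbergPerp P ⊔ LieSubalgebra.lieSpan ℂ (Aff g) {d}

/-- `l̂₀ + G(l̂)^⊥ + 𝔥_l^⊥`. -/
def leviNoD : LieSubalgebra ℂ (Aff g) :=
  D.leviReal P ⊔ D.heisenbergPerp P ⊔
    LieSubalgebra.lieSpan ℂ (Aff g) (D.hPerp P : Set (Aff g))

theorem leviReal_le_leviNoD : D.leviReal P ≤ D.leviNoD P := le_sup_left.trans le_sup_left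

theorem heisenbergPerp_le_leviNoD : D.heisenbergPerp P ≤ D.leviNoD P :=
  le_sup_right.trans le_sup_left

theorem leviReal_le_leviRealD : D.leviReal P ≤ D.leviRealD P := le_sup_left

theorem heisenbergPerp_le_heisenbergPerpD : D.heisenbergPerp P ≤ D.heisenbergPerpD P := le_sup_left

theorem heisenbergPerpPos_le_heisenbergPerpD : D.heisenbergPerpPos P ≤ D.heisenbergPerpD P :=
  inf_le_left.trans le_sup_left

end AffineDatum

/-! ### Modules, given by representations `ρ : K → End V` -/

section Representations

/-- The restriction of a representation to a smaller subalgebra. -/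
def resRep {A V : Type*} [LieRing A] [LieAlgebra ℂ A] [AddCommGroup V] [Module ℂ V]
    {K' K : LieSubalgebra ℂ A} (h : K' ≤ K) (ρ : K →ₗ⁅ℂ⁆ Module.End ℂ V) :
    K' →ₗ⁅ℂ⁆ Module.End ℂ V :=
  ρ.comp (LieSubalgebra.inclusion h)

/-- The representation on an invariant subspace. -/
def subRep {K V : Type*} [LieRing K] [LieAlgebra ℂ K] [AddCommGroup V] [Module ℂ V]
    (ρ : K →ₗ⁅ℂ⁆ Module.End ℂ V) (S : Submodule ℂ V) (hS : ∀ x, ∀ v ∈ S, ρ x v ∈ S) :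
    K →ₗ⁅ℂ⁆ Module.End ℂ S where
  toFun x := (ρ x).restrict (hS x)
  map_add' x y := by ext v; simp
  map_smul' r x := by ext v; simp
  map_lie' := by intro x y; ext v; simp [LieRing.of_associative_ring_bracket]

/-- Irreducibility of a representation, that is of the corresponding Lie module. -/
def IsIrreducibleRep {K V : Type*} [LieRing K] [LieAlgebra ℂ K] [AddCommGroup V] [Module ℂ V]
    (ρ : K →ₗ⁅ℂ⁆ Module.End ℂ V) : Prop :=
  letI := LieRingModule.compLieHom V ρ
  LieModule.IsIrreducible ℂ K V

variable {ι g : Type*} [Finite ι] [LieRing g] [LieAlgebra ℂ g]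

/-- The module has central charge `a`: the central element `c`, where it belongs to `K`, acts by
the scalar `a`. -/
def HasCentralCharge {V : Type*} [AddCommGroup V] [Module ℂ V] {K : LieSubalgebra ℂ (Aff g)}
    (ρ : K →ₗ⁅ℂ⁆ Module.End ℂ V) (a : ℂ) : Prop :=
  ∀ hc : c ∈ K, ∀ v : V, ρ ⟨c, hc⟩ v = a • v

/-- A weight module: the sum of its weight spaces
`V_μ = {v | h v = μ(h) v for all h ∈ K ∩ H}`, `μ ∈ (K ∩ H)^*` (a sum of weight spaces for distinct
weights is always direct). -/
def IsWeightRep (D : AffineDatum ι g) {V : Type*} [AddCommGroup V] [Module ℂ V]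
    {K : LieSubalgebra ℂ (Aff g)} (ρ : K →ₗ⁅ℂ⁆ Module.End ℂ V) : Prop :=
  ⨆ μ : Module.Dual ℂ ↥(K.toSubmodule ⊓ D.H),
    ⨅ h : ↥(K.toSubmodule ⊓ D.H), Module.End.eigenspace (ρ ⟨h, h.2.1⟩) (μ h) = ⊤

/-- A Whittaker `G̃(l̂)^⊥`-module of type `η : U(G(l̂)^⊥₊) → ℂ`: it is generated by a vector `v` with
`x v = η(x) v` for all `x ∈ U(G(l̂)^⊥₊)`. -/
def IsWhittakerRep (D : AffineDatum ι g) (P : Set (Module.Dual ℂ D.H))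
    (η : UniversalEnvelopingAlgebra ℂ (D.heisenbergPerpPos P) →ₐ[ℂ] ℂ)
    {S : Type*} [AddCommGroup S] [Module ℂ S]
    (ρ : D.heisenbergPerpD P →ₗ⁅ℂ⁆ Module.End ℂ S) : Prop :=
  ∃ v : S,
    (∀ x, UniversalEnvelopingAlgebra.lift ℂ
      (resRep (D.heisenbergPerpPos_le_heisenbergPerpD P) ρ) x v = η x • v) ∧
    ∀ W : Submodule ℂ S, (∀ y, ∀ w ∈ W, ρ y w ∈ W) → v ∈ W → W = ⊤

/-- The representation `τ` of `K` on `M ⊗ S` extends the tensor product action: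
`x (m ⊗ s) = x m ⊗ s` for `x ∈ l̂₀`, `y (m ⊗ s) = m ⊗ y s` for `y ∈ G(l̂)^⊥`, and
`h (m ⊗ s) = λ(h) (m ⊗ s)` for `h ∈ 𝔥_l^⊥`. -/
structure IsTensorRep (D : AffineDatum ι g) (P : Set (Module.Dual ℂ D.H))
    (lam : Module.Dual ℂ (D.hPerp P)) {M S : Type*} [AddCommGroup M] [Module ℂ M]
    [AddCommGroup S] [Module ℂ S] (ρM : D.leviReal P →ₗ⁅ℂ⁆ Module.End ℂ M)
    (ρS : D.heisenbergPerp P →ₗ⁅ℂ⁆ Module.End ℂ S) {K : LieSubalgebra ℂ (Aff g)}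
    (τ : K →ₗ⁅ℂ⁆ Module.End ℂ (M ⊗[ℂ] S)) : Prop where
  real : ∀ (x : Aff g) (hK : x ∈ K) (hx : x ∈ D.leviReal P) (m : M) (s : S),
    τ ⟨x, hK⟩ (m ⊗ₜ[ℂ] s) = (ρM ⟨x, hx⟩ m) ⊗ₜ[ℂ] s
  heis : ∀ (y : Aff g) (hK : y ∈ K) (hy : y ∈ D.heisenbergPerp P) (m : M) (s : S),
    τ ⟨y, hK⟩ (m ⊗ₜ[ℂ] s) = m ⊗ₜ[ℂ] (ρS ⟨y, hy⟩ s)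
  perp : ∀ (h : Aff g) (hK : h ∈ K) (hh : h ∈ D.hPerp P) (m : M) (s : S),
    τ ⟨h, hK⟩ (m ⊗ₜ[ℂ] s) = lam ⟨h, hh⟩ • (m ⊗ₜ[ℂ] s)

end Representations

end AffineKM

end

open AffineKM

universe u₁ u₂ v w

/-!
# Tensor product modules over Levi factors which contain the Heisenberg subalgebra

Write `l̂₀` for the subalgebra generated by the real root spaces of the Levi factor, `G(l̂)^⊥` for the
orthogonal complement of its imaginary part in the Heisenberg algebra, and `𝔥_l^⊥` for the
complement in degree zero. Everything rests on the structure of the Levi factor: it is the sum of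
`l̂₀`, `G(l̂)^⊥`, `𝔥_l^⊥` and `ℂ d`, the first three commute with each other, `d` normalizes each of
them, and the sum is direct up to the central element `c`.

* *Commutation* (`mono_lie_eq_zero_of_mem_outerPart`). Let `y = u tⁿ` be orthogonal to the imaginary
  part of `l̂₀` and let `x` be a real root vector of the Levi factor. If `[y, x] ≠ 0`, this is again a
  real root vector of the Levi factor, so it pairs nontrivially with a vector `w ∈ l̂₀` of the opposite
  root; but `([y, x], w) = (y, [x, w]) = 0`, because `[x, w]` lies in the imaginary part of `l̂₀`.
* *Directness* (`loop_eq_zero_of_mem_outerPart`). If a coefficient `u` of an element of `l̂₀` lies in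
  the orthogonal complement, then `u` commutes with the coefficients of all real root vectors of `l̂₀`
  and with the Cartan subalgebra, hence is a sum of commutators in its own centralizer in the finite
  dimensional algebra. On each eigenspace of `ad u` the trace of `ad u` is then zero, so `ad u = 0`
  and `u = 0` (`eq_zero_of_mem_span_lie_centralizer`).
* *Sum* (`exists_innerPart_add_outerPart`). Directness makes the form nondegenerate on the imaginary
  part of `l̂₀`, and each graded piece is finite dimensional, so each graded piece of the Cartan
  subalgebra splits as an orthogonal sum.

The tensor product action is defined on a sum `x + y + h + r d`. It is well defined because the only
ambiguity is the multiple of `c` in `x` and `y`, and the two factors have the same central charge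
(`exists_tensorRep`).

The representation theory uses that all Lie algebras here have countable dimension, so that Schur's
lemma holds for irreducible modules over the uncountable field `ℂ`
(`IsIrreducibleRep.exists_eq_smul_of_commute`). A nonzero subspace of `M ⊗ S` stable under the action
on one irreducible factor then contains all `m ⊗ s` for a fixed nonzero vector of the other factor
(`IsIrreducibleRep.exists_forall_tmul_mem`), which gives irreducibility of `M ⊗ S`. For the
action of the whole Levi factor one takes a nonzero submodule `W` and considers
`{s | m ⊗ s ∈ W for all m}`: it is nonzero, and stable under `d` because
`m ⊗ d s = d (m ⊗ s) - d m ⊗ s`, so it is `S`. Conversely, an irreducible module `V` with an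
irreducible `G(l̂)^⊥`-submodule `S` is `Hom(S, V) ⊗ S`, with `Hom` over `G(l̂)^⊥`, by evaluation
(`exists_tensor_equiv_of_commute`).
-/

/-! ### Irreducible representations in countable dimension -/

namespace AffineKM

section Irreducible

variable {K V : Type*} [LieRing K] [LieAlgebra ℂ K] [AddCommGroup V] [Module ℂ V]

theorem isIrreducibleRep_iff (ρ : K →ₗ⁅ℂ⁆ Module.End ℂ V) :
    IsIrreducibleRep ρ ↔ Nontrivial V ∧
      ∀ W : Submodule ℂ V, (∀ x, ∀ v ∈ W, ρ x v ∈ W) → W = ⊥ ∨ W = ⊤ := by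
  let := LieRingModule.compLieHom V ρ
  constructor
  · intro h
    have h : LieModule.IsIrreducible ℂ K V := h
    refine ⟨LieModule.nontrivial_of_isIrreducible ℂ K V, fun W hW => ?_⟩
    let N : LieSubmodule ℂ K V := { W with lie_mem := fun {x v} hv => hW x v hv }
    have e : N.toSubmodule = W := rfl
    rcases eq_bot_or_eq_top N with hN | hN
    · left; rw [← e, hN, LieSubmodule.bot_toSubmodule]
    · right; rw [← e, hN, LieSubmodule.top_toSubmodule]
  · rintro ⟨hV, h⟩
    refine LieModule.IsIrreducible.mk (R := ℂ) (L := K) fun N hN => ?_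
    rcases h N.toSubmodule (fun x v hv => N.lie_mem (x := x) hv) with h0 | h1
    · exact absurd (LieSubmodule.toSubmodule_eq_bot N |>.mp h0) hN
    · exact (LieSubmodule.toSubmodule_eq_top N).mp h1

/-- A cyclic module over a Lie algebra of countable dimension has countable dimension: it is spanned
by the words in a countable spanning set of the algebra, applied to a generator. -/
theorem IsIrreducibleRep.exists_countable_span {ρ : K →ₗ⁅ℂ⁆ Module.End ℂ V}
    (hρ : IsIrreducibleRep ρ) (hK : ∃ s : Set K, s.Countable ∧ Submodule.span ℂ s = ⊤) :
    ∃ t : Set V, t.Countable ∧ Submodule.span ℂ t = ⊤ := by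
  obtain ⟨s, hs, hspan⟩ := hK
  obtain ⟨hV, h⟩ := (isIrreducibleRep_iff ρ).mp hρ
  obtain ⟨v, hv⟩ := exists_ne (0 : V)
  have := hs.to_subtype
  let f : List s → V := fun l => (l.map fun x => ρ x).prod v
  refine ⟨Set.range f, Set.countable_range f, ?_⟩
  have hinv : ∀ x, ∀ w ∈ Submodule.span ℂ (Set.range f), ρ x w ∈ Submodule.span ℂ (Set.range f) := by
    intro x w hw
    have hx : x ∈ Submodule.span ℂ s := hspan ▸ Submodule.mem_top
    induction hx using Submodule.span_induction with
    | zero => simp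
    | add a b _ _ ha hb => rw [map_add]; exact add_mem ha hb
    | smul r a _ ha => rw [map_smul]; exact Submodule.smul_mem _ r ha
    | mem a ha =>
      induction hw using Submodule.span_induction with
      | zero => simp
      | add a b _ _ ha hb => rw [map_add]; exact add_mem ha hb
      | smul r a _ ha => rw [map_smul]; exact Submodule.smul_mem _ r ha
      | mem b hb =>
        obtain ⟨l, rfl⟩ := hb
        exact Submodule.subset_span ⟨⟨a, ha⟩ :: l, by simp [f]⟩
  refine (h _ hinv).resolve_left fun h0 => hv ?_
  have : v ∈ Submodule.span ℂ (Set.range f) := Submodule.subset_span ⟨[], by simp [f]⟩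
  simpa [h0] using this

/-- An endomorphism with empty spectrum has linearly independent resolvent vectors, which is
impossible in countable dimension. -/
theorem exists_not_isUnit_sub_of_countable_span [Nontrivial V] (φ : Module.End ℂ V)
    (hV : ∃ t : Set V, t.Countable ∧ Submodule.span ℂ t = ⊤) :
    ∃ z : ℂ, ¬ IsUnit (φ - algebraMap ℂ (Module.End ℂ V) z) := by
  by_contra! hu
  obtain ⟨v, hv⟩ := exists_ne (0 : V)
  have hpoly : ∀ p : Polynomial ℂ, p ≠ 0 → Polynomial.aeval φ p v = 0 → False := by
    intro p hp h0
    have hunit : IsUnit (Polynomial.aeval φ (p.roots.map fun x => Polynomial.X - Polynomial.C x).prod) := by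
      by_contra hn
      obtain ⟨k, hk, -⟩ := spectrum.exists_mem_of_not_isUnit_aeval_prod hn
      rw [spectrum.mem_iff, ← IsUnit.neg_iff, neg_sub] at hk
      exact hk (hu k)
    rw [(IsAlgClosed.splits p).eq_prod_roots, map_mul, Polynomial.aeval_C,
      Module.algebraMap_end_eq_smul_id] at h0
    have h1 : Polynomial.aeval φ (p.roots.map fun x => Polynomial.X - Polynomial.C x).prod v = 0 := by
      simpa [hp] using h0
    exact hv (((Module.End.isUnit_iff _).mp hunit).1 (by rw [h1, map_zero]))
  choose f hf using fun z => ((Module.End.isUnit_iff _).mp (hu z)).2 v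
  have hli : LinearIndependent ℂ f := by
    classical
    rw [linearIndependent_iff']
    intro s a ha i hi
    -- a relation between the vectors `(φ - z)⁻¹ v`, with denominators cleared
    let p : Polynomial ℂ :=
      ∑ i ∈ s, Polynomial.C (a i) * ∏ j ∈ s.erase i, (Polynomial.X - Polynomial.C j)
    have hp0 : p = 0 := by
      by_contra hp
      refine hpoly p hp ?_
      have key : ∀ i ∈ s, Polynomial.aeval φ
          (Polynomial.C (a i) * ∏ j ∈ s.erase i, (Polynomial.X - Polynomial.C j)) v =
          Polynomial.aeval φ (∏ j ∈ s, (Polynomial.X - Polynomial.C j)) (a i • f i) := by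
        intro i hi
        rw [← Finset.prod_erase_mul _ _ hi, ← hf i, map_mul, map_mul, map_smul]
        simp [Module.End.mul_apply, Module.algebraMap_end_apply]
      rw [map_sum, LinearMap.sum_apply, Finset.sum_congr rfl key, ← map_sum, ha, map_zero]
    have he : Polynomial.eval i p = a i * ∏ j ∈ s.erase i, (i - j) := by
      simp only [p, Polynomial.eval_finsetSum, Polynomial.eval_mul, Polynomial.eval_C,
        Polynomial.eval_prod, Polynomial.eval_sub, Polynomial.eval_X]
      refine Finset.sum_eq_single i (fun k hk hki => ?_) (fun h => absurd hi h)
      rw [Finset.prod_eq_zero (Finset.mem_erase.mpr ⟨hki.symm, hi⟩) (sub_self i), mul_zero]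
    rw [hp0, Polynomial.eval_zero] at he
    refine (mul_eq_zero.mp he.symm).resolve_right (Finset.prod_ne_zero_iff.mpr fun j hj => ?_)
    exact sub_ne_zero.mpr (Finset.ne_of_mem_erase hj).symm
  obtain ⟨t, ht, hspan⟩ := hV
  have h1 := hli.cardinal_lift_le_rank
  have h2 : Module.rank ℂ V ≤ Cardinal.aleph0 := by
    rw [← rank_top, ← hspan]
    exact (rank_span_le t).trans (Cardinal.le_aleph0_iff_set_countable.mpr ht)
  have h3 : Cardinal.lift Cardinal.continuum ≤ Cardinal.aleph0 := by
    rw [← Cardinal.mk_complex]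
    exact h1.trans (by simpa using h2)
  exact absurd (Cardinal.lift_le_aleph0.mp h3) (not_le.mpr Cardinal.aleph0_lt_continuum)

/-- Schur's lemma in countable dimension (Dixmier). -/
theorem IsIrreducibleRep.exists_eq_smul_of_commute {ρ : K →ₗ⁅ℂ⁆ Module.End ℂ V}
    (hρ : IsIrreducibleRep ρ) (hK : ∃ s : Set K, s.Countable ∧ Submodule.span ℂ s = ⊤)
    (φ : Module.End ℂ V) (hφ : ∀ x v, φ (ρ x v) = ρ x (φ v)) : ∃ z : ℂ, ∀ v, φ v = z • v := by
  obtain ⟨hV, h⟩ := (isIrreducibleRep_iff ρ).mp hρ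
  obtain ⟨z, hz⟩ := exists_not_isUnit_sub_of_countable_span φ (hρ.exists_countable_span hK)
  refine ⟨z, ?_⟩
  set ψ := φ - algebraMap ℂ (Module.End ℂ V) z with hψ
  have hc : ∀ x v, ψ (ρ x v) = ρ x (ψ v) := fun x v => by
    simp [hψ, hφ, Module.algebraMap_end_apply]
  have hker := h (LinearMap.ker ψ) fun x v hv => by
    rw [LinearMap.mem_ker] at hv ⊢; rw [hc, hv, map_zero]
  have hran := h (LinearMap.range ψ) fun x v hv => by
    obtain ⟨w, rfl⟩ := hv; exact ⟨ρ x w, hc x w⟩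
  have h0 : ψ = 0 := by
    rcases hker with hk | hk
    · rcases hran with hr | hr
      · exact LinearMap.range_eq_bot.mp hr
      · exact absurd ((Module.End.isUnit_iff _).mpr
          ⟨LinearMap.ker_eq_bot.mp hk, LinearMap.range_eq_top.mp hr⟩) hz
    · exact LinearMap.ker_eq_top.mp hk
  intro v
  have := LinearMap.congr_fun h0 v
  simpa [hψ, sub_eq_zero, Module.algebraMap_end_apply] using this

end Irreducible

end AffineKM

/-! ### Irreducibility of tensor products -/

namespace AffineKM

section TensorIrreducible

variable {K K' M S : Type*} [LieRing K] [LieAlgebra ℂ K] [LieRing K'] [LieAlgebra ℂ K']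
  [AddCommGroup M] [Module ℂ M] [AddCommGroup S] [Module ℂ S]

/-- An element of minimal length of a subspace `W` stable under `1 ⊗ ρ` generates a copy of `S`: its
coordinates in a basis of `M` are related by endomorphisms of `S`, that is by scalars, so that it is
a pure tensor. -/
theorem IsIrreducibleRep.exists_forall_tmul_mem {ρ : K →ₗ⁅ℂ⁆ Module.End ℂ S}
    (hρ : IsIrreducibleRep ρ)
    (hschur : ∀ φ : Module.End ℂ S, (∀ x v, φ (ρ x v) = ρ x (φ v)) → ∃ z : ℂ, ∀ v, φ v = z • v)
    {W : Submodule ℂ (M ⊗[ℂ] S)} (hW : ∀ x, ∀ w ∈ W, (ρ x).lTensor M w ∈ W) (hne : W ≠ ⊥) :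
    ∃ m : M, m ≠ 0 ∧ ∀ s : S, m ⊗ₜ[ℂ] s ∈ W := by
  classical
  obtain ⟨hS, hirr⟩ := (isIrreducibleRep_iff ρ).mp hρ
  let b := Module.Basis.ofVectorSpace ℂ M
  let e : (M ⊗[ℂ] S) ≃ₗ[ℂ] _ := TensorProduct.equivFinsuppOfBasisLeft b
  have he : ∀ x w i, e ((ρ x).lTensor M w) i = ρ x (e w i) := by
    intro x w i
    induction w with
    | zero => simp
    | add a b ha hb => simp only [map_add, Finsupp.add_apply, ha, hb]
    | tmul m s =>
      simp [e]
  obtain ⟨w, ⟨hwW, hw0⟩, hmin⟩ := WellFounded.has_min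
    (measure fun w : M ⊗[ℂ] S => (e w).support.card).wf {w | w ∈ W ∧ w ≠ 0}
    ((Submodule.ne_bot_iff W).mp hne)
  have hew : e w ≠ 0 := by simpa using hw0
  obtain ⟨i₀, hi₀⟩ := Finsupp.support_nonempty_iff.mpr hew
  -- by minimality, an element of `N` is determined by its coordinate at `i₀`, so that `N ≃ S`
  let N : Submodule ℂ (M ⊗[ℂ] S) :=
    { carrier := {w' | w' ∈ W ∧ ∀ i ∉ (e w).support, e w' i = 0}
      zero_mem' := ⟨zero_mem _, by simp⟩
      add_mem' := fun {x y} hx hy => ⟨add_mem hx.1 hy.1, fun i hi => by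
        rw [map_add, Finsupp.add_apply, hx.2 i hi, hy.2 i hi, add_zero]⟩
      smul_mem' := fun r x hx => ⟨Submodule.smul_mem _ r hx.1, fun i hi => by
        rw [map_smul, Finsupp.smul_apply, hx.2 i hi, smul_zero]⟩ }
  let coord (i) : (M ⊗[ℂ] S) →ₗ[ℂ] S := Finsupp.lapply i ∘ₗ e.toLinearMap
  have hcoord : ∀ i w', coord i w' = e w' i := fun i w' => rfl
  have hinj : Function.Injective ((coord i₀).domRestrict N) := by
    rw [← LinearMap.ker_eq_bot, LinearMap.ker_eq_bot']
    rintro ⟨w', hw', hsupp⟩ h0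
    rw [LinearMap.domRestrict_apply, hcoord] at h0
    by_contra hne'
    refine hmin w' ⟨hw', fun h => hne' (Subtype.ext h)⟩ (Finset.card_lt_card ?_)
    refine Finset.ssubset_iff_of_subset (fun i hi => ?_) |>.mpr ⟨i₀, hi₀, by simpa using h0⟩
    by_contra hi'
    exact (Finsupp.mem_support_iff.mp hi) (hsupp i hi')
  have hNstab : ∀ x, ∀ w' ∈ N, (ρ x).lTensor M w' ∈ N := fun x w' hw' =>
    ⟨hW x w' hw'.1, fun i hi => by rw [he, hw'.2 i hi, map_zero]⟩
  have hsurj : Function.Surjective ((coord i₀).domRestrict N) := by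
    rw [← LinearMap.range_eq_top]
    refine (hirr _ ?_).resolve_left fun h => ?_
    · rintro x _ ⟨⟨w', hw'⟩, rfl⟩
      exact ⟨⟨_, hNstab x w' hw'⟩, he x w' i₀⟩
    · rw [LinearMap.range_eq_bot] at h
      have := LinearMap.congr_fun h ⟨w, hwW, fun i hi => by simpa using hi⟩
      exact (Finsupp.mem_support_iff.mp hi₀) this
  let G : N ≃ₗ[ℂ] S := LinearEquiv.ofBijective _ ⟨hinj, hsurj⟩
  have hG : ∀ x s, (G.symm (ρ x s) : M ⊗[ℂ] S) = (ρ x).lTensor M (G.symm s) := by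
    intro x s
    have : G.symm (ρ x s) = ⟨_, hNstab x _ (G.symm s).2⟩ := by
      rw [LinearEquiv.symm_apply_eq]
      have h1 : G (G.symm s) = s := G.apply_symm_apply s
      nth_rewrite 1 [← h1]
      exact (he x _ i₀).symm
    rw [this]
  choose z hz using fun j => hschur (coord j ∘ₗ N.subtype ∘ₗ G.symm.toLinearMap) fun x v => by
    change e (G.symm (ρ x v) : M ⊗[ℂ] S) j = ρ x (e (G.symm v : M ⊗[ℂ] S) j)
    rw [hG, he]
  have hm : ∀ s, (∑ j ∈ (e w).support, z j • b j) ⊗ₜ[ℂ] s = (G.symm s : M ⊗[ℂ] S) := by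
    intro s
    apply e.injective
    ext i
    have h1 : e (G.symm s : M ⊗[ℂ] S) i = z i • s := hz i s
    rw [TensorProduct.equivFinsuppOfBasisLeft_apply_tmul_apply]
    by_cases hi : i ∈ (e w).support
    · rw [h1, map_sum, Finsupp.finsetSum_apply, Finset.sum_eq_single_of_mem i hi]
      · simp
      · intro j _ hj; simp [hj]
    · rw [(G.symm s).2.2 i hi, map_sum, Finsupp.finsetSum_apply, Finset.sum_eq_zero, zero_smul]
      intro j hj
      have : j ≠ i := fun h => hi (h ▸ hj)
      simp [this]
  refine ⟨_, fun h0 => ?_, fun s => (hm s).symm ▸ (G.symm s).2.1⟩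
  obtain ⟨s, hs⟩ := exists_ne (0 : S)
  have := hm s
  rw [h0, TensorProduct.zero_tmul] at this
  exact hs (by simpa using this.symm)

/-- The mirror image of `IsIrreducibleRep.exists_forall_tmul_mem`. -/
theorem IsIrreducibleRep.exists_forall_tmul_mem' {ρ : K →ₗ⁅ℂ⁆ Module.End ℂ M}
    (hρ : IsIrreducibleRep ρ)
    (hschur : ∀ φ : Module.End ℂ M, (∀ x v, φ (ρ x v) = ρ x (φ v)) → ∃ z : ℂ, ∀ v, φ v = z • v)
    {W : Submodule ℂ (M ⊗[ℂ] S)} (hW : ∀ x, ∀ w ∈ W, (ρ x).rTensor S w ∈ W) (hne : W ≠ ⊥) :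
    ∃ s : S, s ≠ 0 ∧ ∀ m : M, m ⊗ₜ[ℂ] s ∈ W := by
  let e := TensorProduct.comm ℂ S M
  obtain ⟨s, hs, h⟩ := hρ.exists_forall_tmul_mem hschur (W := W.comap e.toLinearMap)
    (fun x w hw => by
      have : e ((ρ x).lTensor S w) = (ρ x).rTensor S (e w) := by
        simp [e, LinearMap.lTensor, LinearMap.rTensor, TensorProduct.map_comm]
      rw [Submodule.mem_comap, LinearEquiv.coe_coe, this]
      exact hW x _ hw)
    (fun h => hne (by
      rw [Submodule.eq_bot_iff]
      intro w hw
      have : e.symm w ∈ W.comap e.toLinearMap := by simpa using hw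
      rw [h, Submodule.mem_bot] at this
      simpa using this))
  exact ⟨s, hs, fun m => h m⟩

/-- Irreducibility of a tensor product: the operators `1 ⊗ ρS y` need to preserve `W` only up to
operators which act on the first factor. -/
theorem IsIrreducibleRep.tensor_eq_bot_or_eq_top {ρM : K →ₗ⁅ℂ⁆ Module.End ℂ M}
    {ρS : K' →ₗ⁅ℂ⁆ Module.End ℂ S} (hM : IsIrreducibleRep ρM) (hS : IsIrreducibleRep ρS)
    (hK : ∃ s : Set K, s.Countable ∧ Submodule.span ℂ s = ⊤) (W : Submodule ℂ (M ⊗[ℂ] S))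
    (h₁ : ∀ x, ∀ w ∈ W, (ρM x).rTensor S w ∈ W)
    (h₂ : ∀ y, ∃ A : Module.End ℂ M, ∀ w ∈ W, A.rTensor S w + (ρS y).lTensor M w ∈ W) :
    W = ⊥ ∨ W = ⊤ := by
  rw [or_iff_not_imp_left]
  intro hne
  obtain ⟨s, hs, hsW⟩ := hM.exists_forall_tmul_mem' (hM.exists_eq_smul_of_commute hK) h₁ hne
  let T : Submodule ℂ S := ⨅ m : M, W.comap (TensorProduct.mk ℂ M S m)
  have hT : ∀ t, t ∈ T ↔ ∀ m : M, m ⊗ₜ[ℂ] t ∈ W := fun t => by simp [T]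
  have hTtop : T = ⊤ := by
    refine (((isIrreducibleRep_iff ρS).mp hS).2 T fun y t ht => ?_).resolve_left fun h => ?_
    · obtain ⟨A, hA⟩ := h₂ y
      rw [hT] at ht ⊢
      intro m
      have h := sub_mem (hA _ (ht m)) (ht (A m))
      simpa using h
    · exact hs ((Submodule.mem_bot ℂ).mp (h ▸ (hT s).mpr hsW))
  rw [eq_top_iff, ← TensorProduct.span_tmul_eq_top, Submodule.span_le]
  rintro _ ⟨m, t, rfl⟩
  exact (hT t).mp (hTtop ▸ Submodule.mem_top) m

theorem IsIrreducibleRep.nontrivial {ρ : K →ₗ⁅ℂ⁆ Module.End ℂ M} (h : IsIrreducibleRep ρ) :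
    Nontrivial M := ((isIrreducibleRep_iff ρ).mp h).1

end TensorIrreducible

section Graph

variable {A : Type*} [LieRing A] [LieAlgebra ℂ A] {V : Type*} [AddCommGroup V] [Module ℂ V]

/-- A relation between elements of a Lie algebra and operators which is compatible with the Lie
algebra operations, total on `K` and single-valued is the graph of a representation of `K`. -/
theorem exists_rep_of_graph (K : LieSubalgebra ℂ A) (Γ : LieSubalgebra ℂ (A × Module.End ℂ V))
    (htot : ∀ x ∈ K, ∃ T, (x, T) ∈ Γ) (hzero : ∀ T, (0, T) ∈ Γ → T = 0) :
    ∃ τ : K →ₗ⁅ℂ⁆ Module.End ℂ V, ∀ (x : K) (T), ((x : A), T) ∈ Γ → τ x = T := by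
  have huniq : ∀ x T T', (x, T) ∈ Γ → (x, T') ∈ Γ → T = T' := fun x T T' h h' => by
    have := sub_mem h h'
    rw [Prod.mk_sub_mk, sub_self] at this
    exact sub_eq_zero.mp (hzero _ this)
  choose τ hτ using fun x : K => htot x x.2
  refine ⟨{ toFun := τ, map_add' := fun x y => ?_, map_smul' := fun r x => ?_,
            map_lie' := fun {x y} => ?_ }, fun x T h => huniq _ _ _ (hτ x) h⟩
  · exact huniq _ _ _ (hτ (x + y)) (add_mem (hτ x) (hτ y))
  · exact huniq _ _ _ (hτ (r • x)) (Γ.smul_mem r (hτ x))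
  · exact huniq _ _ _ (hτ ⁅x, y⁆) (Γ.lie_mem (hτ x) (hτ y))

end Graph

end AffineKM

/-! ### Finite dimensional preliminaries -/

namespace AffineKM

section TraceArgument

variable {g : Type*} [LieRing g] [LieAlgebra ℂ g]

theorem killingForm_lie_left (x y z : g) :
    killingForm ℂ g ⁅x, y⁆ z = -killingForm ℂ g y ⁅x, z⁆ := by
  rw [← lie_skew, map_neg, LinearMap.neg_apply]
  exact congrArg Neg.neg (LieModule.traceForm_apply_lie_apply ℂ g g y x z)

variable [LieAlgebra.IsKilling ℂ g]

theorem exists_killingForm_ne_zero {z : g} (hz : z ≠ 0) : ∃ w, killingForm ℂ g z w ≠ 0 := by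
  by_contra! h
  have : z ∈ LinearMap.ker (killingForm ℂ g) := LinearMap.mem_ker.mpr (LinearMap.ext h)
  rw [LieAlgebra.IsKilling.ker_killingForm_eq_bot] at this
  exact hz (by simpa using this)

variable [FiniteDimensional ℂ g]

/-- A toral element which is a sum of commutators in its own centralizer vanishes: on each eigenspace
of `ad u`, which the centralizer preserves, the trace of `ad u` is zero. -/
theorem eq_zero_of_mem_span_lie_centralizer {C : LieSubalgebra ℂ g} [C.IsCartanSubalgebra] {u : g}
    (hu : u ∈ C)
    (h : u ∈ Submodule.span ℂ {x | ∃ p q : g, ⁅u, p⁆ = 0 ∧ ⁅u, q⁆ = 0 ∧ x = ⁅p, q⁆}) : u = 0 := by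
  have hss := LieAlgebra.IsKilling.isSemisimple_ad_of_mem_isCartanSubalgebra (K := ℂ) hu
  have h0 : LieAlgebra.ad ℂ g u = 0 := by
    rw [hss.eq_zero_iff_forall_eigenvalue]
    intro μ hμ
    set E := (LieAlgebra.ad ℂ g u).eigenspace μ with hE
    have hmem : ∀ v, v ∈ E ↔ ⁅u, v⁆ = μ • v := fun v => by
      rw [hE, Module.End.mem_eigenspace_iff, LieAlgebra.ad_apply]
    have hstab : ∀ p, ⁅u, p⁆ = 0 → ∀ v ∈ E, LieAlgebra.ad ℂ g p v ∈ E := fun p hp v hv => by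
      rw [hmem] at hv ⊢
      rw [LieAlgebra.ad_apply, leibniz_lie, hp, zero_lie, zero_add, hv, lie_smul]
    have key : ∃ hx : ∀ v ∈ E, LieAlgebra.ad ℂ g u v ∈ E,
        LinearMap.trace ℂ E ((LieAlgebra.ad ℂ g u).restrict hx) = 0 := by
      have aux : ∀ x ∈ Submodule.span ℂ {x | ∃ p q : g, ⁅u, p⁆ = 0 ∧ ⁅u, q⁆ = 0 ∧ x = ⁅p, q⁆},
          ∃ hx : ∀ v ∈ E, LieAlgebra.ad ℂ g x v ∈ E,
            LinearMap.trace ℂ E ((LieAlgebra.ad ℂ g x).restrict hx) = 0 := by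
        intro x hx
        induction hx using Submodule.span_induction with
        | zero =>
          refine ⟨fun v _ => by simp, ?_⟩
          have : (LieAlgebra.ad ℂ g 0).restrict (p := E) (q := E) (fun v _ => by simp) = 0 := by
            ext v; simp
          rw [this, map_zero]
        | add a b _ _ ha hb =>
          obtain ⟨ha, ha'⟩ := ha
          obtain ⟨hb, hb'⟩ := hb
          have hab : ∀ v ∈ E, LieAlgebra.ad ℂ g (a + b) v ∈ E := fun v hv => by
            rw [map_add]; exact add_mem (ha v hv) (hb v hv)
          refine ⟨hab, ?_⟩
          have : (LieAlgebra.ad ℂ g (a + b)).restrict hab =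
              (LieAlgebra.ad ℂ g a).restrict ha + (LieAlgebra.ad ℂ g b).restrict hb := by
            ext v; simp
          rw [this, map_add, ha', hb', add_zero]
        | smul r a _ ha =>
          obtain ⟨ha, ha'⟩ := ha
          have hra : ∀ v ∈ E, LieAlgebra.ad ℂ g (r • a) v ∈ E := fun v hv => by
            rw [map_smul]; exact Submodule.smul_mem _ r (ha v hv)
          refine ⟨hra, ?_⟩
          have : (LieAlgebra.ad ℂ g (r • a)).restrict hra = r • (LieAlgebra.ad ℂ g a).restrict ha := by
            ext v; simp
          rw [this, map_smul, ha', smul_zero]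
        | mem x hx =>
          obtain ⟨p, q, hp, hq, rfl⟩ := hx
          have hpq : ∀ v ∈ E, LieAlgebra.ad ℂ g ⁅p, q⁆ v ∈ E :=
            hstab _ (by rw [leibniz_lie, hp, hq, zero_lie, lie_zero, add_zero])
          refine ⟨hpq, ?_⟩
          have : (LieAlgebra.ad ℂ g ⁅p, q⁆).restrict hpq =
              ⁅(LieAlgebra.ad ℂ g p).restrict (hstab p hp),
                (LieAlgebra.ad ℂ g q).restrict (hstab q hq)⁆ := by
            ext v; simp [LieRing.of_associative_ring_bracket]
          rw [this, LinearMap.trace_lie]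
      exact aux u h
    obtain ⟨hx, htr⟩ := key
    have hsmul : (LieAlgebra.ad ℂ g u).restrict hx = μ • LinearMap.id := by
      ext v; simpa using (hmem v).mp v.2
    have hE0 : Module.finrank ℂ E ≠ 0 := fun h0 => hμ (Submodule.finrank_eq_zero.mp h0)
    rw [hsmul, map_smul, LinearMap.trace_id, smul_eq_mul] at htr
    exact (mul_eq_zero.mp htr).resolve_right (by exact_mod_cast hE0)
  exact LieAlgebra.IsKilling.eq_zero_of_isNilpotent_ad_of_mem_isCartanSubalgebra ℂ g C hu
    (by rw [h0]; exact IsNilpotent.zero)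

end TraceArgument

namespace AffineDatum

variable {ι g : Type*} [Finite ι] [LieRing g] [LieAlgebra ℂ g] (D : AffineDatum ι g)

/-- The graded piece of degree `n` of the Cartan subalgebra of `g`. -/
noncomputable def cartanGrade (n : ℤ) : Submodule ℂ g := D.cartan.toSubmodule ⊓ D.grade n

theorem mem_grade {n : ℤ} {u : g} : u ∈ D.grade n ↔ D.aut u = D.zeta ^ n • u := by
  rw [grade, Module.End.mem_eigenspace_iff]; rfl

theorem orderOf_perm_pos : 0 < orderOf D.perm := orderOf_pos _

theorem zeta_pow_orderOf : D.zeta ^ orderOf D.perm = 1 := by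
  rw [zeta, ← Complex.exp_nat_mul, mul_div_cancel₀, Complex.exp_two_pi_mul_I]
  exact_mod_cast D.orderOf_perm_pos.ne'

theorem mem_grade_orderOf {u : g} (hu : u ∈ D.grade 0) : u ∈ D.grade (orderOf D.perm) := by
  rw [mem_grade] at hu ⊢
  rwa [zpow_natCast, zeta_pow_orderOf, ← zpow_zero D.zeta]

theorem mem_grade_neg_orderOf {u : g} (hu : u ∈ D.grade 0) : u ∈ D.grade (-orderOf D.perm) := by
  rw [mem_grade] at hu ⊢
  rwa [zpow_neg, zpow_natCast, zeta_pow_orderOf, inv_one, ← zpow_zero D.zeta]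

theorem lie_eq_zero_of_mem_cartan {u v : g} (hu : u ∈ D.cartan) (hv : v ∈ D.cartan) :
    ⁅u, v⁆ = 0 := by
  have := D.basis.isLieAbelian_cartan
  exact congrArg Subtype.val (LieModule.IsTrivial.trivial (⟨u, hu⟩ : D.cartan) (⟨v, hv⟩ : D.cartan))

theorem eq_top_of_mem_generators {C : LieSubalgebra ℂ g} (he : ∀ i, D.basis.e i ∈ C)
    (hf : ∀ i, D.basis.f i ∈ C) (x : g) : x ∈ C := by
  have : (⊤ : LieSubalgebra ℂ g) ≤ C := by
    rw [← D.basis.span_ef, LieSubalgebra.lieSpan_le]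
    rintro _ (⟨i, rfl⟩ | ⟨i, rfl⟩)
    exacts [he i, hf i]
  exact this trivial

theorem aut_pow_orderOf : (D.aut : g →ₗ[ℂ] g) ^ orderOf D.perm = 1 := by
  have hlie : ∀ (k : ℕ) (x y : g), ((D.aut : g →ₗ[ℂ] g) ^ k) ⁅x, y⁆ =
      ⁅((D.aut : g →ₗ[ℂ] g) ^ k) x, ((D.aut : g →ₗ[ℂ] g) ^ k) y⁆ := by
    intro k x y
    induction k with
    | zero => simp
    | succ k ih =>
      simp only [pow_succ', Module.End.mul_apply, ih]
      exact D.aut.map_lie _ _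
  have he : ∀ (k : ℕ) i, ((D.aut : g →ₗ[ℂ] g) ^ k) (D.basis.e i) = D.basis.e ((D.perm ^ k) i) := by
    intro k i
    induction k with
    | zero => simp
    | succ k ih =>
      simp only [pow_succ', Module.End.mul_apply, ih, Equiv.Perm.mul_apply]
      exact D.aut_e _
  have hf : ∀ (k : ℕ) i, ((D.aut : g →ₗ[ℂ] g) ^ k) (D.basis.f i) = D.basis.f ((D.perm ^ k) i) := by
    intro k i
    induction k with
    | zero => simp
    | succ k ih =>
      simp only [pow_succ', Module.End.mul_apply, ih, Equiv.Perm.mul_apply]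
      exact D.aut_f _
  let C : LieSubalgebra ℂ g :=
    { LinearMap.eqLocus ((D.aut : g →ₗ[ℂ] g) ^ orderOf D.perm) LinearMap.id with
      lie_mem' := fun {x y} hx hy => by
        have hx : ((D.aut : g →ₗ[ℂ] g) ^ orderOf D.perm) x = x := hx
        have hy : ((D.aut : g →ₗ[ℂ] g) ^ orderOf D.perm) y = y := hy
        change ((D.aut : g →ₗ[ℂ] g) ^ orderOf D.perm) ⁅x, y⁆ = ⁅x, y⁆
        rw [hlie, hx, hy] }
  ext x
  refine D.eq_top_of_mem_generators (C := C) (fun i => ?_) (fun i => ?_) x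
  · exact (he _ i).trans (by rw [pow_orderOf_eq_one]; rfl)
  · exact (hf _ i).trans (by rw [pow_orderOf_eq_one]; rfl)

theorem isSemisimple_aut : Module.End.IsSemisimple (D.aut : g →ₗ[ℂ] g) := by
  refine Module.End.isSemisimple_of_squarefree_aeval_eq_zero
    (p := Polynomial.X ^ orderOf D.perm - 1) ?_ ?_
  · exact (Polynomial.X_pow_sub_one_separable_iff.mpr
      (by exact_mod_cast D.orderOf_perm_pos.ne')).squarefree
  · rw [map_sub, map_pow, Polynomial.aeval_X, map_one, sub_eq_zero]
    exact D.aut_pow_orderOf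

theorem isCartanSubalgebra [FiniteDimensional ℂ g] : D.cartan.IsCartanSubalgebra :=
  have := Fintype.ofFinite ι
  D.basis.isCartanSubalgebra

/-- The element `ρ^∨` of the Cartan subalgebra on which all simple roots take the value `1`. -/
theorem exists_rhoCheck : ∃ h ∈ D.cartan, (∀ i, ⁅h, D.basis.e i⁆ = D.basis.e i) ∧
    ∀ i, ⁅h, D.basis.f i⁆ = -D.basis.f i := by
  classical
  have := Fintype.ofFinite ι
  let A : Matrix ι ι ℂ := D.basis.A.map (Int.cast : ℤ → ℂ)
  have hdet : IsUnit A.det := by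
    have h1 : A.det = ((D.basis.A.det : ℤ) : ℂ) := by
      exact ((Int.castRingHom ℂ).map_det D.basis.A).symm
    rw [h1, isUnit_iff_ne_zero]
    exact_mod_cast D.basis.nondegen.det_ne_zero
  let x : ι → ℂ := A⁻¹.mulVec 1
  have hx : A.mulVec x = 1 := by
    rw [Matrix.mulVec_mulVec, Matrix.mul_nonsing_inv _ hdet, Matrix.one_mulVec]
  have hx' : ∀ i, ∑ j, x j * (D.basis.A i j : ℂ) = 1 := fun i => by
    have := congrFun hx i
    simpa [Matrix.mulVec, dotProduct, A, mul_comm] using this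
  refine ⟨∑ j, x j • D.basis.h j, ?_, fun i => ?_, fun i => ?_⟩
  · exact sum_mem fun j _ => D.cartan.smul_mem _ (D.basis.h' j).2
  · rw [sum_lie]
    simp only [smul_lie, D.basis.lie_h_e, ← Int.cast_smul_eq_zsmul ℂ, smul_smul]
    rw [← Finset.sum_smul, hx', one_smul]
  · rw [sum_lie]
    simp only [smul_lie, D.basis.lie_h_f, ← Int.cast_smul_eq_zsmul ℂ, smul_smul]
    rw [← Finset.sum_smul]
    have : ∑ j, x j * ((-D.basis.A i j : ℤ) : ℂ) = -1 := by
      rw [← hx' i, ← Finset.sum_neg_distrib]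
      exact Finset.sum_congr rfl fun j _ => by push_cast; ring
    rw [this, neg_one_smul]

variable [LieAlgebra.IsKilling ℂ g]

theorem eq_zero_of_lie_generators_eq_zero {u : g} (he : ∀ i, ⁅u, D.basis.e i⁆ = 0)
    (hf : ∀ i, ⁅u, D.basis.f i⁆ = 0) : u = 0 := by
  let C : LieSubalgebra ℂ g :=
    { LinearMap.ker (LieAlgebra.ad ℂ g u) with
      lie_mem' := fun {x y} hx hy => by
        have hx : ⁅u, x⁆ = 0 := hx
        have hy : ⁅u, y⁆ = 0 := hy
        change ⁅u, ⁅x, y⁆⁆ = 0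
        rw [leibniz_lie, hx, hy, zero_lie, lie_zero, add_zero] }
  have h : ∀ x : g, ⁅u, x⁆ = 0 := D.eq_top_of_mem_generators (C := C) he hf
  by_contra hu
  obtain ⟨w, hw⟩ := exists_killingForm_ne_zero hu
  apply hw
  have : LieAlgebra.ad ℂ g u = 0 := by ext x; exact h x
  rw [LieModule.traceForm_apply_apply]
  change LinearMap.trace ℂ g (LieAlgebra.ad ℂ g u ∘ₗ _) = 0
  rw [this, LinearMap.zero_comp, map_zero]

/-- By uniqueness, `ρ^∨` is fixed by the diagram automorphism. -/
theorem exists_rhoCheck_mem_cartanGrade : ∃ h ∈ D.cartanGrade 0,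
    (∀ i, ⁅h, D.basis.e i⁆ = D.basis.e i) ∧ ∀ i, ⁅h, D.basis.f i⁆ = -D.basis.f i := by
  obtain ⟨h, hh, he, hf⟩ := D.exists_rhoCheck
  refine ⟨h, ⟨hh, ?_⟩, he, hf⟩
  change h ∈ D.grade 0
  rw [mem_grade, zpow_zero, one_smul, ← sub_eq_zero]
  refine D.eq_zero_of_lie_generators_eq_zero (fun i => ?_) (fun i => ?_)
  · have h1 : ⁅D.aut h, D.basis.e i⁆ = D.basis.e i := by
      have := congrArg D.aut (he (D.perm.symm i))
      rwa [LieEquiv.map_lie, D.aut_e, Equiv.apply_symm_apply] at this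
    rw [sub_lie, h1, he, sub_self]
  · have h1 : ⁅D.aut h, D.basis.f i⁆ = -D.basis.f i := by
      have := congrArg D.aut (hf (D.perm.symm i))
      rwa [LieEquiv.map_lie, map_neg, D.aut_f, Equiv.apply_symm_apply] at this
    rw [sub_lie, h1, hf, sub_self]

/-- The Cartan subalgebra of the fixed points contains a regular element, so that its centralizer
is the Cartan subalgebra of `g`. -/
theorem mem_cartan_of_forall_lie_eq_zero {u : g} (hu : ∀ h ∈ D.cartanGrade 0, ⁅h, u⁆ = 0) :
    u ∈ D.cartan := by
  obtain ⟨h, hh, he, hf⟩ := D.exists_rhoCheck_mem_cartanGrade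
  let T := LieAlgebra.ad ℂ g h
  -- the nilpotent part generated by eigenvectors with eigenvalue `s = ±1`
  have hpart : ∀ (s : ℂ) (X : Set g), s ≠ 0 → (∀ x ∈ X, ⁅h, x⁆ = s • x) →
      ∀ x ∈ LieSubalgebra.lieSpan ℂ g X,
        x ∈ Submodule.span ℂ {y | ∃ n : ℕ, n ≠ 0 ∧ ⁅h, y⁆ = ((n : ℂ) * s) • y} := by
    intro s X hs hX x hx
    induction hx using LieSubalgebra.lieSpan_induction with
    | mem x hx => exact Submodule.subset_span ⟨1, one_ne_zero, by simpa using hX x hx⟩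
    | zero => exact zero_mem _
    | add x y _ _ hx hy => exact add_mem hx hy
    | smul r x _ hx => exact Submodule.smul_mem _ r hx
    | lie x y hx₀ hy₀ hx hy =>
      clear hx₀ hy₀
      induction hx using Submodule.span_induction with
      | zero => simp
      | add a b _ _ ha hb => rw [add_lie]; exact add_mem ha hb
      | smul r a _ ha => rw [smul_lie]; exact Submodule.smul_mem _ r ha
      | mem a ha =>
        induction hy using Submodule.span_induction with
        | zero => simp
        | add a b _ _ ha hb => rw [lie_add]; exact add_mem ha hb
        | smul r a _ ha => rw [lie_smul]; exact Submodule.smul_mem _ r ha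
        | mem b hb =>
          obtain ⟨m, hm, ha⟩ := ha
          obtain ⟨n, hn, hb⟩ := hb
          refine Submodule.subset_span ⟨m + n, by omega, ?_⟩
          rw [leibniz_lie, ha, hb, smul_lie, lie_smul, ← add_smul]
          push_cast; ring_nf
  have hle : ∀ s : ℂ, s ≠ 0 →
      Submodule.span ℂ {y : g | ∃ n : ℕ, n ≠ 0 ∧ ⁅h, y⁆ = ((n : ℂ) * s) • y} ≤
        ⨆ μ, ⨆ (_ : μ ≠ 0), T.eigenspace μ := by
    intro s hs
    rw [Submodule.span_le]
    rintro y ⟨n, hn, hy⟩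
    have : y ∈ T.eigenspace ((n : ℂ) * s) := Module.End.mem_eigenspace_iff.mpr hy
    exact Submodule.mem_iSup_of_mem _ (Submodule.mem_iSup_of_mem
      (mul_ne_zero (by exact_mod_cast hn) hs) this)
  have htop := D.basis.iSup_cartan_borelLower_borelUpper_eq_top
  have hu' : u ∈ D.cartan.toLieSubmodule ⊔ D.basis.borelLower ⊔ D.basis.borelUpper := by
    have : iSup ![D.cartan.toLieSubmodule, D.basis.borelLower, D.basis.borelUpper] =
        D.cartan.toLieSubmodule ⊔ D.basis.borelLower ⊔ D.basis.borelUpper := by simp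
    rw [← this, htop]; trivial
  obtain ⟨x, hx, p, hp, rfl⟩ := (LieSubmodule.mem_sup _ _ _).mp hu'
  obtain ⟨z, hz, m, hm, rfl⟩ := (LieSubmodule.mem_sup _ _ _).mp hx
  have hz : z ∈ D.cartan := by simpa using hz
  have hm' := hle (-1) (by norm_num) (hpart (-1) (Set.range D.basis.f) (by norm_num)
    (by rintro _ ⟨i, rfl⟩; rw [hf, neg_one_smul]) m hm)
  have hp' := hle 1 one_ne_zero (hpart 1 (Set.range D.basis.e) one_ne_zero
    (by rintro _ ⟨i, rfl⟩; rw [he, one_smul]) p hp)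
  have hmp : m + p ∈ T.eigenspace 0 := by
    rw [Module.End.mem_eigenspace_iff, zero_smul]
    have h1 := hu h hh
    have h2 := D.lie_eq_zero_of_mem_cartan hh.1 hz
    rw [add_assoc, lie_add, h2, zero_add] at h1
    exact h1
  have h0 : m + p = 0 := by
    have := (Module.End.eigenspaces_iSupIndep T 0).le_bot ⟨hmp, add_mem hm' hp'⟩
    simpa using this
  rw [add_assoc, h0, add_zero]
  exact hz

variable [FiniteDimensional ℂ g]

/-- The Killing form pairs a joint weight space of the diagram automorphism and the Cartan subalgebra
of its fixed points with the opposite one. -/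
theorem exists_opposite_weight {n : ℤ} {z : g} (hz : z ≠ 0) (hn : z ∈ D.grade n) {χ : D.cartanGrade 0 → ℂ}
    (hχ : ∀ h : D.cartanGrade 0, ⁅(h : g), z⁆ = χ h • z) :
    ∃ w ∈ D.grade (-n), (∀ h : D.cartanGrade 0, ⁅(h : g), w⁆ = -χ h • w) ∧ killingForm ℂ g z w ≠ 0 := by
  have := D.isCartanSubalgebra
  let F : Option (D.cartanGrade 0) → Module.End ℂ g := fun o =>
    o.elim (D.aut : g →ₗ[ℂ] g) fun h => LieAlgebra.ad ℂ g (h : g)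
  have hss : ∀ o, (F o).IsSemisimple := by
    rintro (_ | h)
    · exact D.isSemisimple_aut
    · exact LieAlgebra.IsKilling.isSemisimple_ad_of_mem_isCartanSubalgebra (K := ℂ) h.2.1
  have hcomm₀ : ∀ h : D.cartanGrade 0, Commute (F none) (F (some h)) := by
    intro h
    ext x
    have h1 : D.aut h = h := by
      have := D.mem_grade.mp h.2.2
      rwa [zpow_zero, one_smul] at this
    change D.aut ⁅(h : g), x⁆ = ⁅(h : g), D.aut x⁆
    rw [LieEquiv.map_lie, h1]
  have hcomm : Pairwise fun i j => Commute (F i) (F j) := by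
    rintro (_ | h) (_ | h') _
    · exact Commute.refl _
    · exact hcomm₀ h'
    · exact (hcomm₀ h).symm
    · ext x
      change ⁅(h : g), ⁅(h' : g), x⁆⁆ = ⁅(h' : g), ⁅(h : g), x⁆⁆
      rw [leibniz_lie, D.lie_eq_zero_of_mem_cartan h.2.1 h'.2.1, zero_lie, zero_add]
  have htop := Module.End.iSup_iInf_maxGenEigenspace_eq_top_of_iSup_maxGenEigenspace_eq_top_of_commute
    F hcomm fun o => Module.End.iSup_maxGenEigenspace_eq_top (F o)
  obtain ⟨ψ, w, hw, hzw⟩ : ∃ ψ : Option (D.cartanGrade 0) → ℂ,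
      ∃ w ∈ ⨅ i, (F i).maxGenEigenspace (ψ i), killingForm ℂ g z w ≠ 0 := by
    by_contra! h
    have hle : ⨆ ψ : Option (D.cartanGrade 0) → ℂ, ⨅ i, (F i).maxGenEigenspace (ψ i) ≤
        LinearMap.ker (killingForm ℂ g z) := iSup_le fun ψ w hw => h ψ w hw
    rw [htop, top_le_iff, LinearMap.ker_eq_top] at hle
    obtain ⟨w, hw⟩ := exists_killingForm_ne_zero hz
    exact hw (by rw [hle, LinearMap.zero_apply])
  have hw' : ∀ i, F i w = ψ i • w := fun i => by
    have := (Submodule.mem_iInf _).mp hw i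
    rwa [(Module.End.isFinitelySemisimple_iff_isSemisimple.mpr
      (hss i)).maxGenEigenspace_eq_eigenspace, Module.End.mem_eigenspace_iff] at this
  refine ⟨w, ?_, fun h => ?_, hzw⟩
  · have h1 := LieAlgebra.killingForm_of_equiv_apply D.aut z w
    have h2 : D.aut w = ψ none • w := hw' none
    rw [D.mem_grade.mp hn, h2] at h1
    simp only [map_smul, LinearMap.smul_apply, smul_eq_mul] at h1
    have h3 : D.zeta ^ n * ψ none = 1 := by
      rw [← mul_assoc] at h1
      have := mul_right_cancel₀ hzw (h1.trans (one_mul _).symm)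
      rwa [mul_comm] at this
    rw [mem_grade, h2, zpow_neg, eq_inv_of_mul_eq_one_right h3]
  · have h1 : ⁅(h : g), w⁆ = ψ (some h) • w := hw' (some h)
    have h2 := killingForm_lie_left (h : g) z w
    rw [hχ h, h1] at h2
    simp only [map_smul, LinearMap.smul_apply, smul_eq_mul] at h2
    have h3 : χ h = -ψ (some h) :=
      mul_right_cancel₀ hzw (by rw [h2]; ring)
    rw [h1, h3, neg_neg]

end AffineDatum

end AffineKM

/-! ### Root spaces of the affine algebra -/

namespace AffineKM

open Aff

namespace Aff

section

variable {g : Type*} [LieRing g]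

@[simp] theorem c_loop : (c : Aff g).loop = 0 := rfl
@[simp] theorem c_central : (c : Aff g).central = 1 := rfl
@[simp] theorem c_der : (c : Aff g).der = 0 := rfl
@[simp] theorem d_loop : (d : Aff g).loop = 0 := rfl
@[simp] theorem d_central : (d : Aff g).central = 0 := rfl
@[simp] theorem d_der : (d : Aff g).der = 1 := rfl

variable [LieAlgebra ℂ g]

@[simp] theorem mono_loop (n : ℤ) (u : g) : (mono n u).loop = Finsupp.single n u := rfl
@[simp] theorem mono_central (n : ℤ) (u : g) : (mono n u).central = 0 := rfl
@[simp] theorem mono_der (n : ℤ) (u : g) : (mono n u).der = 0 := rfl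

theorem mono_injective (n : ℤ) : Function.Injective (mono n : g → Aff g) := fun _ _ h =>
  Finsupp.single_injective n (congrArg Aff.loop h)

theorem mono_ne_zero {n : ℤ} {u : g} (h : mono n u ≠ 0) : u ≠ 0 := fun h0 => h (by rw [h0, map_zero])

theorem lie_c (x : Aff g) : ⁅x, (c : Aff g)⁆ = 0 := by rw [← lie_skew, c_lie, neg_zero]

theorem mono_zero_lie_mono (n : ℤ) (u v : g) : ⁅mono 0 u, mono n v⁆ = mono n ⁅u, v⁆ := by
  rw [mono_lie_mono]; simp

theorem loopDeg_apply (x : ℤ →₀ g) (n : ℤ) : loopDeg x n = (n : ℂ) • x n := by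
  induction x using Finsupp.induction_linear with
  | zero => simp
  | add a b ha hb => simp [ha, hb]
  | single m u =>
    rw [loopDeg_single]
    by_cases h : m = n
    · subst h; simp
    · simp [Finsupp.single_eq_of_ne (Ne.symm h)]

theorem loopCocycle_single_zero_left (u : g) (x : ℤ →₀ g) :
    loopCocycle (Finsupp.single 0 u) x = 0 := by
  induction x using Finsupp.induction_linear with
  | zero => simp
  | add a b ha hb => simp [ha, hb]
  | single m v => rw [loopCocycle_single]; simp

theorem form_mono_mono (m n : ℤ) (u v : g) :
    form (mono m u) (mono n v) = if m + n = 0 then killingForm ℂ g u v else 0 := by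
  simp [form, loopForm_single]

/-- Every element is the sum of its homogeneous components. -/
theorem eq_sum_mono (x : Aff g) :
    x = (∑ n ∈ x.loop.support, mono n (x.loop n)) + x.central • c + x.der • d := by
  have h : ∀ f : ℤ →₀ g, (⟨f, 0, 0⟩ : Aff g) = ∑ n ∈ f.support, mono n (f n) := by
    intro f
    let φ : (ℤ →₀ g) →+ Aff g :=
      { toFun := fun f => ⟨f, 0, 0⟩, map_zero' := rfl, map_add' := fun a b => by ext1 <;> simp }
    change φ f = _
    conv_lhs => rw [← f.sum_single, Finsupp.sum, map_sum]
    rfl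
  rw [← h]
  ext1 <;> simp

end

end Aff

namespace AffineDatum

variable {ι g : Type*} [Finite ι] [LieRing g] [LieAlgebra ℂ g] (D : AffineDatum ι g)

theorem c_mem_H : (c : Aff g) ∈ D.H :=
  Submodule.mem_sup_right (Submodule.subset_span (Or.inl rfl))

theorem d_mem_H : (d : Aff g) ∈ D.H :=
  Submodule.mem_sup_right (Submodule.subset_span (Or.inr rfl))

theorem mono_mem_H {u : g} (hu : u ∈ D.cartanGrade 0) : mono 0 u ∈ D.H :=
  Submodule.mem_sup_left ⟨u, hu, rfl⟩

theorem mem_H_iff {x : Aff g} :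
    x ∈ D.H ↔ ∃ u ∈ D.cartanGrade 0, ∃ a b : ℂ, x = mono 0 u + a • c + b • d := by
  constructor
  · intro hx
    obtain ⟨_, ⟨u, hu, rfl⟩, y, hy, rfl⟩ := Submodule.mem_sup.mp hx
    obtain ⟨a, b, rfl⟩ := Submodule.mem_span_pair.mp hy
    exact ⟨u, hu, a, b, (add_assoc _ _ _).symm⟩
  · rintro ⟨u, hu, a, b, rfl⟩
    exact add_mem (add_mem (D.mono_mem_H hu) (Submodule.smul_mem _ a D.c_mem_H))
      (Submodule.smul_mem _ b D.d_mem_H)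

theorem mono_mem_ghat {n : ℤ} {u : g} (hu : u ∈ D.grade n) : mono n u ∈ D.ghat :=
  Submodule.subset_span (Or.inl ⟨n, u, hu, rfl⟩)

theorem c_mem_ghat : (c : Aff g) ∈ D.ghat := Submodule.subset_span (Or.inr (Or.inl rfl))

theorem d_mem_ghat : (d : Aff g) ∈ D.ghat := Submodule.subset_span (Or.inr (Or.inr rfl))

theorem loop_mem_grade {x : Aff g} (hx : x ∈ D.ghat) (n : ℤ) : x.loop n ∈ D.grade n := by
  change x ∈ Submodule.span ℂ D.spanningSet at hx
  induction hx using Submodule.span_induction with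
  | zero => simp
  | add a b _ _ ha hb => simpa using add_mem ha hb
  | smul r a _ ha => simpa using Submodule.smul_mem _ r ha
  | mem a ha =>
    rcases ha with ⟨m, u, hu, rfl⟩ | rfl | rfl
    · rw [mono_loop]
      by_cases h : m = n
      · subst h; simpa using hu
      · rw [Finsupp.single_eq_of_ne (Ne.symm h)]; exact zero_mem _
    · simp
    · simp

theorem H_le_ghat : D.H ≤ D.ghat.toSubmodule := by
  intro x hx
  obtain ⟨u, hu, a, b, rfl⟩ := D.mem_H_iff.mp hx
  exact add_mem (add_mem (D.mono_mem_ghat hu.2) (Submodule.smul_mem _ a D.c_mem_ghat))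
      (Submodule.smul_mem _ b D.d_mem_ghat)

theorem lie_eq_zero_of_mem_H {x y : Aff g} (hx : x ∈ D.H) (hy : y ∈ D.H) : ⁅x, y⁆ = 0 := by
  obtain ⟨u, hu, a, b, rfl⟩ := D.mem_H_iff.mp hx
  obtain ⟨v, hv, a', b', rfl⟩ := D.mem_H_iff.mp hy
  simp only [add_lie, lie_add, smul_lie, lie_smul, c_lie, lie_c, mono_zero_lie_mono, d_lie_mono,
    D.lie_eq_zero_of_mem_cartan hu.1 hv.1, lie_self, ← lie_skew (mono 0 u) (d : Aff g)]
  simp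

/-- The inclusion of `𝔥`, viewed inside `g`, into `H`. -/
noncomputable def toH : D.cartanGrade 0 →ₗ[ℂ] D.H :=
  ((mono 0).comp (D.cartanGrade 0).subtype).codRestrict D.H fun u => D.mono_mem_H u.2

@[simp] theorem coe_toH (u : D.cartanGrade 0) : (D.toH u : Aff g) = mono 0 (u : g) := rfl

theorem functional_ext {α β : Module.Dual ℂ D.H} (h₁ : ∀ u, α (D.toH u) = β (D.toH u))
    (h₂ : α ⟨c, D.c_mem_H⟩ = β ⟨c, D.c_mem_H⟩) (h₃ : α ⟨d, D.d_mem_H⟩ = β ⟨d, D.d_mem_H⟩) :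
    α = β := by
  ext ⟨x, hx⟩
  obtain ⟨u, hu, a, b, rfl⟩ := D.mem_H_iff.mp hx
  have : (⟨mono 0 u + a • c + b • d, hx⟩ : D.H) =
      D.toH ⟨u, hu⟩ + a • ⟨c, D.c_mem_H⟩ + b • ⟨d, D.d_mem_H⟩ := rfl
  rw [this]
  simp only [map_add, map_smul, h₁, h₂, h₃]

@[simp] theorem delta_toH (u : D.cartanGrade 0) : D.delta (D.toH u) = 0 := rfl
@[simp] theorem delta_c : D.delta ⟨c, D.c_mem_H⟩ = 0 := rfl
@[simp] theorem delta_d : D.delta ⟨d, D.d_mem_H⟩ = 1 := rfl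

theorem zsmul_delta_injective : Function.Injective fun k : ℤ => k • D.delta := fun k l h => by
  have := LinearMap.congr_fun h ⟨d, D.d_mem_H⟩
  simpa using this

theorem zsmul_delta_ne_zero {k : ℤ} (hk : k ≠ 0) : k • D.delta ≠ 0 := fun h =>
  hk (D.zsmul_delta_injective (h.trans (zero_smul ℤ _).symm))

theorem mono_mem_rootSpace {α : Module.Dual ℂ D.H} {n : ℤ} {u : g} (hu : u ∈ D.grade n)
    (h₁ : ∀ h : D.cartanGrade 0, ⁅(h : g), u⁆ = α (D.toH h) • u) (h₂ : α ⟨c, D.c_mem_H⟩ = 0)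
    (h₃ : α ⟨d, D.d_mem_H⟩ = n) : mono n u ∈ D.rootSpace α := by
  refine ⟨D.mono_mem_ghat hu, ?_⟩
  rintro ⟨x, hx⟩
  obtain ⟨v, hv, a, b, rfl⟩ := D.mem_H_iff.mp hx
  have : (⟨mono 0 v + a • c + b • d, hx⟩ : D.H) =
      D.toH ⟨v, hv⟩ + a • ⟨c, D.c_mem_H⟩ + b • ⟨d, D.d_mem_H⟩ := rfl
  change ⁅mono 0 v + a • c + b • d, mono n u⁆ = _
  rw [this]
  have h4 : ⁅v, u⁆ = α (D.toH ⟨v, hv⟩) • u := h₁ ⟨v, hv⟩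
  simp only [map_add, map_smul, h₂, h₃, add_lie, smul_lie, c_lie, mono_zero_lie_mono, d_lie_mono,
    h4, smul_zero, smul_eq_mul, mul_zero, add_zero, add_smul, mul_smul]

/-- A nonzero element of a root space is of the form `u tⁿ`, where `n` is the value of the root on
`d` and `u` is a weight vector. -/
theorem exists_eq_mono_of_mem_rootSpace {α : Module.Dual ℂ D.H} (hα : α ≠ 0) {x : Aff g}
    (hx : x ∈ D.rootSpace α) (hx0 : x ≠ 0) : ∃ n : ℤ, ∃ u ∈ D.grade n, u ≠ 0 ∧ x = mono n u ∧
      α ⟨d, D.d_mem_H⟩ = n ∧ α ⟨c, D.c_mem_H⟩ = 0 ∧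
      ∀ h : D.cartanGrade 0, ⁅(h : g), u⁆ = α (D.toH h) • u := by
  obtain ⟨h, hh⟩ : ∃ h, α h ≠ 0 := by
    by_contra! h0; exact hα (LinearMap.ext h0)
  have hder : x.der = 0 := by
    have := congrArg Aff.der (hx.2 h)
    simpa [hh] using this.symm
  have hcen : x.central = 0 := by
    have h1 := congrArg Aff.central (hx.2 h)
    obtain ⟨v, hv, a, b, hvab⟩ := D.mem_H_iff.mp h.2
    have h2 : (h : Aff g).loop = Finsupp.single 0 v := by rw [hvab]; simp
    rw [lie_central, h2, loopCocycle_single_zero_left, smul_central] at h1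
    exact (mul_eq_zero.mp h1.symm).resolve_left hh
  have hdeg : ∀ k : ℤ, (k : ℂ) • x.loop k = α ⟨d, D.d_mem_H⟩ • x.loop k := fun k => by
    have h1 := congrArg Aff.loop (hx.2 ⟨d, D.d_mem_H⟩)
    have h2 := DFunLike.congr_fun h1 k
    simpa [hder, loopDeg_apply] using h2
  have hloop : x.loop ≠ 0 := fun h0 => hx0 (by ext1 <;> simp [h0, hder, hcen])
  obtain ⟨n, hn⟩ := Finsupp.ne_iff.mp hloop
  rw [Finsupp.zero_apply] at hn
  have hdn : α ⟨d, D.d_mem_H⟩ = n := (smul_left_injective ℂ hn (hdeg n)).symm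
  have hxn : x = mono n (x.loop n) := by
    ext1
    · ext k
      rw [mono_loop]
      by_cases hk : k = n
      · subst hk; simp
      · rw [Finsupp.single_eq_of_ne hk]
        by_contra h0
        have := smul_left_injective ℂ h0 (hdeg k)
        rw [hdn] at this
        exact hk (by exact_mod_cast this)
    · exact hcen
    · exact hder
  refine ⟨n, x.loop n, D.loop_mem_grade hx.1 n, hn, hxn, hdn, ?_, fun h => ?_⟩
  · have := hx.2 ⟨c, D.c_mem_H⟩
    rw [c_lie] at this
    exact (smul_eq_zero.mp this.symm).resolve_right hx0
  · have := hx.2 (D.toH h)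
    rw [coe_toH, hxn, mono_zero_lie_mono, ← map_smul] at this
    exact mono_injective n this

theorem lie_mem_rootSpace {α β : Module.Dual ℂ D.H} {x y : Aff g} (hx : x ∈ D.rootSpace α)
    (hy : y ∈ D.rootSpace β) : ⁅x, y⁆ ∈ D.rootSpace (α + β) :=
  ⟨D.ghat.lie_mem hx.1 hy.1, fun h => by
    rw [leibniz_lie, hx.2 h, hy.2 h, smul_lie, lie_smul, ← add_smul, LinearMap.add_apply]⟩

theorem H_le_rootSpace_zero : D.H ≤ D.rootSpace 0 := fun x hx =>
  ⟨D.H_le_ghat hx, fun h => by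
    rw [D.lie_eq_zero_of_mem_H h.2 hx, LinearMap.zero_apply, zero_smul]⟩

theorem exists_apply_toH_ne_zero {α : Module.Dual ℂ D.H} (h : α ∈ D.realRoots) :
    ∃ u, α (D.toH u) ≠ 0 := by
  by_contra! h0
  obtain ⟨x, hx, hx0⟩ := (Submodule.ne_bot_iff _).mp h.1.2
  obtain ⟨n, u, -, -, -, hd, hc, -⟩ := D.exists_eq_mono_of_mem_rootSpace h.1.1 hx hx0
  have hα : α = n • D.delta := D.functional_ext (fun u => by simp [h0]) (by simp [hc]) (by simp [hd])
  by_cases hn : n = 0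
  · subst hn; exact h.1.1 (by rw [hα, zero_smul])
  · exact h.2 n hn hα

/-- A real root plus a multiple of `δ` is again real, if it is a root. -/
theorem add_zsmul_delta_mem_realRoots {α : Module.Dual ℂ D.H} (h : α ∈ D.realRoots) {k : ℤ}
    (hk : D.rootSpace (α + k • D.delta) ≠ ⊥) : α + k • D.delta ∈ D.realRoots := by
  have aux : ∀ l : ℤ, α + k • D.delta ≠ l • D.delta := fun l hl => by
    obtain ⟨u, hu⟩ := D.exists_apply_toH_ne_zero h
    apply hu
    have := LinearMap.congr_fun hl (D.toH u)
    simpa using this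
  exact ⟨⟨fun h0 => aux 0 (by rw [h0, zero_smul]), hk⟩, fun l _ => aux l⟩

theorem mono_mem_rootSpace_zsmul_delta {n : ℤ} {u : g} (hu : u ∈ D.cartanGrade n) :
    mono n u ∈ D.rootSpace (n • D.delta) :=
  D.mono_mem_rootSpace hu.2
    (fun h => by rw [D.lie_eq_zero_of_mem_cartan h.2.1 hu.1]; simp) (by simp) (by simp)

variable [LieAlgebra.IsKilling ℂ g]

theorem exists_eq_mono_of_mem_rootSpace_zsmul_delta {k : ℤ} (hk : k ≠ 0) {x : Aff g}
    (hx : x ∈ D.rootSpace (k • D.delta)) : ∃ u ∈ D.cartanGrade k, x = mono k u := by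
  by_cases hx0 : x = 0
  · exact ⟨0, zero_mem _, by rw [hx0, map_zero]⟩
  obtain ⟨n, u, hu, -, rfl, hd, -, hw⟩ :=
    D.exists_eq_mono_of_mem_rootSpace (D.zsmul_delta_ne_zero hk) hx hx0
  obtain rfl : k = n := by
    have : ((k : ℤ) : ℂ) = n := by simpa using hd
    exact_mod_cast this
  exact ⟨u, ⟨D.mem_cartan_of_forall_lie_eq_zero fun h hh => by simpa using hw ⟨h, hh⟩, hu⟩, rfl⟩

variable [FiniteDimensional ℂ g]

/-- The invariant form pairs the root spaces of `α` and `-α`. -/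
theorem exists_opposite_rootSpace {α : Module.Dual ℂ D.H} {n : ℤ} {u : g} (hα : α ≠ 0)
    (hx : mono n u ∈ D.rootSpace α) (hx0 : mono n u ≠ 0) :
    ∃ v ∈ D.grade (-n), mono (-n) v ∈ D.rootSpace (-α) ∧ killingForm ℂ g u v ≠ 0 := by
  have hu0 : u ≠ 0 := mono_ne_zero hx0
  obtain ⟨m, u', hu', -, he, hd, hc, hw⟩ := D.exists_eq_mono_of_mem_rootSpace hα hx hx0
  have h1 := congrArg Aff.loop he
  rw [mono_loop, mono_loop, Finsupp.single_eq_single_iff] at h1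
  obtain ⟨rfl, rfl⟩ := h1.resolve_right fun h => hu0 h.1
  obtain ⟨v, hv, hwv, hκ⟩ := D.exists_opposite_weight hu0 hu' hw
  refine ⟨v, hv, D.mono_mem_rootSpace hv (fun h => ?_) (by simp [hc]) (by simp [hd]), hκ⟩
  rw [hwv, LinearMap.neg_apply]

theorem neg_mem_roots {α : Module.Dual ℂ D.H} (h : α ∈ D.roots) : -α ∈ D.roots := by
  obtain ⟨x, hx, hx0⟩ := (Submodule.ne_bot_iff _).mp h.2
  obtain ⟨n, u, -, -, rfl, -⟩ := D.exists_eq_mono_of_mem_rootSpace h.1 hx hx0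
  obtain ⟨v, -, hv, hκ⟩ := D.exists_opposite_rootSpace h.1 hx hx0
  refine ⟨neg_ne_zero.mpr h.1, (Submodule.ne_bot_iff _).mpr ⟨_, hv, fun h0 => hκ ?_⟩⟩
  rw [mono_injective (-n) (h0.trans (map_zero _).symm), map_zero]

omit [LieAlgebra.IsKilling ℂ g] [FiniteDimensional ℂ g] in
theorem iSupIndep_rootSpace : iSupIndep D.rootSpace := by
  have h := Module.End.independent_iInf_maxGenEigenspace_of_forall_mapsTo
    (fun h : D.H => LieAlgebra.ad ℂ (Aff g) (h : Aff g)) fun i j φ =>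
      Module.End.mapsTo_maxGenEigenspace_of_comm (by
        ext1 x
        change ⁅(j : Aff g), ⁅(i : Aff g), x⁆⁆ = ⁅(i : Aff g), ⁅(j : Aff g), x⁆⁆
        rw [leibniz_lie, D.lie_eq_zero_of_mem_H j.2 i.2, zero_lie, zero_add]) φ
  refine (h.comp (DFunLike.coe_injective (F := Module.Dual ℂ D.H))).mono fun α x hx => ?_
  refine (Submodule.mem_iInf _).mpr fun i => ?_
  exact (Module.End.genEigenspace _ _).mono le_top (Module.End.mem_eigenspace_iff.mpr (hx.2 i))

variable {P : Set (Module.Dual ℂ D.H)}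

/-- The roots of the Levi factor are those of `P ∩ -P`. -/
theorem IsParabolicSubset.mem_of_mem_levi {D : AffineDatum ι g} {P : Set (Module.Dual ℂ D.H)}
    (hP : D.IsParabolicSubset P) {α : Module.Dual ℂ D.H}
    (hα : α ≠ 0) {x : Aff g} (hx : x ∈ D.levi P) (hxα : x ∈ D.rootSpace α) (hx0 : x ≠ 0) :
    α ∈ P ∧ -α ∈ P := by
  let Q : Set (Module.Dual ℂ D.H) := {β | β = 0 ∨ (β ∈ P ∧ -β ∈ P)}
  have hQ : ∀ β ∈ Q, ∀ γ ∈ Q, D.rootSpace (β + γ) ≠ ⊥ → β + γ ∈ Q := by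
    rintro β (rfl | hβ) γ (rfl | hγ) hne
    · left; simp
    · right; simpa using hγ
    · right; simpa using hβ
    · by_cases h0 : β + γ = 0
      · exact Or.inl h0
      · have hr : β + γ ∈ D.roots := ⟨h0, hne⟩
        have hr' := D.neg_mem_roots hr
        refine Or.inr ⟨hP.add_mem _ hβ.1 _ hγ.1 hr, ?_⟩
        rw [neg_add] at hr' ⊢
        exact hP.add_mem _ hβ.2 _ hγ.2 hr'
  let R : LieSubalgebra ℂ (Aff g) :=
    { (⨆ β ∈ Q, D.rootSpace β) with
      lie_mem' := fun {y z} hy hz => by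
        change y ∈ ⨆ β ∈ Q, D.rootSpace β at hy
        change z ∈ ⨆ β ∈ Q, D.rootSpace β at hz
        change ⁅y, z⁆ ∈ ⨆ β ∈ Q, D.rootSpace β
        rw [iSup_subtype'] at hy hz
        induction hy using Submodule.iSup_induction' with
        | zero => simp
        | add a b _ _ ha hb => rw [add_lie]; exact Submodule.add_mem _ ha hb
        | mem β y hy =>
          induction hz using Submodule.iSup_induction' with
          | zero => simp
          | add a b _ _ ha hb => rw [lie_add]; exact Submodule.add_mem _ ha hb
          | mem γ z hz =>
            have h1 := D.lie_mem_rootSpace hy hz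
            by_cases h0 : ⁅y, z⁆ = 0
            · rw [h0]; exact zero_mem _
            · exact Submodule.mem_iSup_of_mem _ (Submodule.mem_iSup_of_mem
                (hQ _ β.2 _ γ.2 ((Submodule.ne_bot_iff _).mpr ⟨_, h1, h0⟩)) h1) }
  have hle : D.levi P ≤ R := by
    rw [levi, LieSubalgebra.lieSpan_le]
    rintro y (hy | ⟨β, hβ, hβ', hy⟩)
    · exact Submodule.mem_iSup_of_mem 0 (Submodule.mem_iSup_of_mem (Or.inl rfl)
        (D.H_le_rootSpace_zero hy))
    · exact Submodule.mem_iSup_of_mem β (Submodule.mem_iSup_of_mem (Or.inr ⟨hβ, hβ'⟩) hy)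
  have hxR : x ∈ ⨆ β ∈ Q, D.rootSpace β := hle hx
  by_contra hn
  have hαQ : α ∉ Q := by rintro (h | h); exacts [hα h, hn h]
  exact hx0 (by simpa using (D.iSupIndep_rootSpace.disjoint_biSup hαQ).le_bot ⟨hxα, hxR⟩)

end AffineDatum

end AffineKM

/-! ### The imaginary part of `l̂₀` and its orthogonal complement -/

namespace AffineKM

open Aff

section LoopSubalgebra

variable {g : Type*} [LieRing g] [LieAlgebra ℂ g]

theorem loopLie_apply_mem {C : ℤ → Submodule ℂ g}
    (hC : ∀ m n u v, u ∈ C m → v ∈ C n → ⁅u, v⁆ ∈ C (m + n)) {x y : ℤ →₀ g}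
    (hx : ∀ n, x n ∈ C n) (hy : ∀ n, y n ∈ C n) (k : ℤ) : loopLie x y k ∈ C k := by
  rw [← x.sum_single, ← y.sum_single]
  simp only [Finsupp.sum, map_sum, LinearMap.sum_apply, Finsupp.finsetSum_apply]
  refine sum_mem fun m _ => sum_mem fun n _ => ?_
  rw [loopLie_single]
  by_cases h : n + m = k
  · subst h
    rw [Finsupp.single_eq_same]
    exact hC _ _ _ _ (hx _) (hy _)
  · rw [Finsupp.single_eq_of_ne (Ne.symm h)]
    exact zero_mem _

/-- The elements without `d`-component whose coefficient of `tⁿ` lies in `C n`, for a family of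
subspaces such that `[C m, C n] ⊆ C (m + n)`. -/
def loopSubalgebra (C : ℤ → Submodule ℂ g)
    (hC : ∀ m n u v, u ∈ C m → v ∈ C n → ⁅u, v⁆ ∈ C (m + n)) : LieSubalgebra ℂ (Aff g) where
  carrier := {x | x.der = 0 ∧ ∀ n, x.loop n ∈ C n}
  zero_mem' := ⟨rfl, fun n => by simp⟩
  add_mem' := fun {x y} hx hy => ⟨by rw [add_der, hx.1, hy.1, add_zero], fun n => by
    rw [add_loop, Finsupp.add_apply]; exact add_mem (hx.2 n) (hy.2 n)⟩
  smul_mem' := fun r x hx => ⟨by rw [smul_der, hx.1, mul_zero], fun n => by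
    rw [smul_loop, Finsupp.smul_apply]; exact Submodule.smul_mem _ r (hx.2 n)⟩
  lie_mem' := fun {x y} hx hy => ⟨rfl, fun n => by
    have h1 : x.der = 0 := hx.1
    have h2 : y.der = 0 := hy.1
    rw [lie_loop, h1, h2, zero_smul, zero_smul, add_zero, sub_zero]
    exact loopLie_apply_mem hC hx.2 hy.2 n⟩

theorem mem_loopSubalgebra {C : ℤ → Submodule ℂ g}
    {hC : ∀ m n u v, u ∈ C m → v ∈ C n → ⁅u, v⁆ ∈ C (m + n)} {x : Aff g} :
    x ∈ loopSubalgebra C hC ↔ x.der = 0 ∧ ∀ n, x.loop n ∈ C n := Iff.rfl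

theorem mono_mem_loopSubalgebra {C : ℤ → Submodule ℂ g}
    {hC : ∀ m n u v, u ∈ C m → v ∈ C n → ⁅u, v⁆ ∈ C (m + n)} {n : ℤ} {u : g} (hu : u ∈ C n) :
    mono n u ∈ loopSubalgebra C hC := by
  refine ⟨rfl, fun m => ?_⟩
  rw [mono_loop]
  by_cases h : m = n
  · subst h; simpa using hu
  · rw [Finsupp.single_eq_of_ne h]; exact zero_mem _

theorem form_mono_right (x : Aff g) (n : ℤ) (v : g) :
    form x (mono (-n) v) = killingForm ℂ g (x.loop n) v := by
  have h : ∀ f : ℤ →₀ g, loopForm f (Finsupp.single (-n) v) = killingForm ℂ g (f n) v := by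
    intro f
    induction f using Finsupp.induction_linear with
    | zero => simp
    | add a b ha hb => simp [ha, hb]
    | single m u =>
      rw [loopForm_single]
      by_cases hm : m = n
      · subst hm; simp
      · rw [Finsupp.single_eq_of_ne (Ne.symm hm), if_neg (by omega)]; simp
  simp [form, h]

theorem form_mono_left (x : Aff g) (n : ℤ) (u : g) :
    form (mono n u) x = killingForm ℂ g u (x.loop (-n)) := by
  have h : ∀ f : ℤ →₀ g, loopForm (Finsupp.single n u) f = killingForm ℂ g u (f (-n)) := by
    intro f
    induction f using Finsupp.induction_linear with
    | zero => simp
    | add a b ha hb => simp [ha, hb]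
    | single m v =>
      rw [loopForm_single]
      by_cases hm : m = -n
      · subst hm; simp
      · rw [Finsupp.single_eq_of_ne (Ne.symm hm), if_neg (by omega)]; simp
  simp [form, h]

end LoopSubalgebra

section Sup

variable {A : Type*} [LieRing A] [LieAlgebra ℂ A]

/-- The join of a subalgebra with a subalgebra normalizing it is their sum. -/
theorem exists_add_eq_of_mem_sup {S T : LieSubalgebra ℂ A}
    (h : ∀ t ∈ T, ∀ s ∈ S, ⁅t, s⁆ ∈ S) {x : A} (hx : x ∈ S ⊔ T) :
    ∃ s ∈ S, ∃ t ∈ T, s + t = x := by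
  let C : LieSubalgebra ℂ A :=
    { S.toSubmodule ⊔ T.toSubmodule with
      lie_mem' := fun {y z} hy hz => by
        obtain ⟨s, hs, t, ht, rfl⟩ := Submodule.mem_sup.mp hy
        obtain ⟨s', hs', t', ht', rfl⟩ := Submodule.mem_sup.mp hz
        refine Submodule.mem_sup.mpr
          ⟨⁅s, s'⁆ + ⁅s, t'⁆ + ⁅t, s'⁆, ?_, ⁅t, t'⁆, T.lie_mem ht ht', ?_⟩
        · refine add_mem (add_mem (S.lie_mem hs hs') ?_) (h t ht s' hs')
          rw [← lie_skew]
          exact neg_mem (h t' ht' s hs)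
        · simp only [add_lie, lie_add]; abel }
  have hle : S ⊔ T ≤ C := sup_le (fun y hy => Submodule.mem_sup_left hy)
    fun y hy => Submodule.mem_sup_right hy
  exact Submodule.mem_sup.mp (hle hx)

/-- To normalize a generated subalgebra it is enough to map its generators into it. -/
theorem lie_mem_lieSpan_of_forall {X : Set A} {t : A}
    (h : ∀ x ∈ X, ⁅t, x⁆ ∈ LieSubalgebra.lieSpan ℂ A X) {x : A}
    (hx : x ∈ LieSubalgebra.lieSpan ℂ A X) : ⁅t, x⁆ ∈ LieSubalgebra.lieSpan ℂ A X := by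
  induction hx using LieSubalgebra.lieSpan_induction with
  | mem x hx => exact h x hx
  | zero => simp
  | add x y _ _ hx hy => rw [lie_add]; exact add_mem hx hy
  | smul r x _ hx => rw [lie_smul]; exact LieSubalgebra.smul_mem _ r hx
  | lie x y hx' hy' hx hy =>
    rw [leibniz_lie]
    exact add_mem (LieSubalgebra.lie_mem _ hx hy') (LieSubalgebra.lie_mem _ hx' hy)

theorem lie_mem_of_mem_lieSpan {X : Set A} {S : LieSubalgebra ℂ A}
    (h : ∀ t ∈ X, ∀ s ∈ S, ⁅t, s⁆ ∈ S) {t : A} (ht : t ∈ LieSubalgebra.lieSpan ℂ A X) :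
    ∀ s ∈ S, ⁅t, s⁆ ∈ S := by
  induction ht using LieSubalgebra.lieSpan_induction with
  | mem x hx => exact h x hx
  | zero => intro s _; simp
  | add x y _ _ hx hy => intro s hs; rw [add_lie]; exact add_mem (hx s hs) (hy s hs)
  | smul r x _ hx => intro s hs; rw [smul_lie]; exact LieSubalgebra.smul_mem _ r (hx s hs)
  | lie x y _ _ hx hy =>
    intro s hs
    rw [lie_lie]
    exact sub_mem (hx _ (hy s hs)) (hy _ (hx s hs))

theorem lie_eq_zero_of_mem_lieSpan {X : Set A} {t : A} (h : ∀ x ∈ X, ⁅t, x⁆ = 0) {x : A}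
    (hx : x ∈ LieSubalgebra.lieSpan ℂ A X) : ⁅t, x⁆ = 0 := by
  induction hx using LieSubalgebra.lieSpan_induction with
  | mem x hx => exact h x hx
  | zero => simp
  | add x y _ _ hx hy => rw [lie_add, hx, hy, add_zero]
  | smul r x _ hx => rw [lie_smul, hx, smul_zero]
  | lie x y _ _ hx hy => rw [leibniz_lie, hx, hy, zero_lie, lie_zero, add_zero]

theorem mem_lieSpan_singleton {t x : A} (hx : x ∈ LieSubalgebra.lieSpan ℂ A {t}) :
    ∃ r : ℂ, x = r • t := by
  have h := LieSubalgebra.coe_lieSpan_eq_span_of_forall_lie_eq_zero (R := ℂ) (s := {t})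
    (by simp)
  have hx' : x ∈ Submodule.span ℂ {t} := h ▸ hx
  obtain ⟨r, rfl⟩ := Submodule.mem_span_singleton.mp hx'
  exact ⟨r, rfl⟩

theorem mem_of_mem_lieSpan_abelian {B : Submodule ℂ A} (hB : ∀ x ∈ B, ∀ y ∈ B, ⁅x, y⁆ = 0) {x : A}
    (hx : x ∈ LieSubalgebra.lieSpan ℂ A (B : Set A)) : x ∈ B := by
  have h := LieSubalgebra.coe_lieSpan_eq_span_of_forall_lie_eq_zero (R := ℂ) (s := (B : Set A)) hB
  have hx' : x ∈ Submodule.span ℂ (B : Set A) := h ▸ hx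
  rwa [Submodule.span_eq] at hx'

end Sup

namespace AffineDatum

variable {ι g : Type*} [Finite ι] [LieRing g] [LieAlgebra ℂ g] (D : AffineDatum ι g)

theorem neg_mem_realRoots [FiniteDimensional ℂ g] [LieAlgebra.IsKilling ℂ g]
    {α : Module.Dual ℂ D.H} (h : α ∈ D.realRoots) : -α ∈ D.realRoots :=
  ⟨D.neg_mem_roots h.1, fun k hk he =>
    h.2 (-k) (neg_ne_zero.mpr hk) (by rw [neg_smul, ← he, neg_neg])⟩

variable (P : Set (Module.Dual ℂ D.H))

theorem rootSpace_le_levi {α : Module.Dual ℂ D.H} (hα : α ∈ P) (hα' : -α ∈ P) {x : Aff g}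
    (hx : x ∈ D.rootSpace α) : x ∈ D.levi P :=
  LieSubalgebra.subset_lieSpan (Or.inr ⟨α, hα, hα', hx⟩)

theorem rootSpace_le_leviReal {α : Module.Dual ℂ D.H} (hr : α ∈ D.realRoots) (hα : α ∈ P)
    (hα' : -α ∈ P) {x : Aff g} (hx : x ∈ D.rootSpace α) : x ∈ D.leviReal P :=
  LieSubalgebra.subset_lieSpan ⟨D.rootSpace_le_levi P hα hα' hx, α, hr, hx⟩

/-- `l̂₀ + ℂ c`. -/
noncomputable def leviRealC : Submodule ℂ (Aff g) := (D.leviReal P).toSubmodule ⊔ Submodule.span ℂ {c}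

theorem leviReal_le_leviRealC : (D.leviReal P).toSubmodule ≤ D.leviRealC P := le_sup_left

theorem c_mem_leviRealC : (c : Aff g) ∈ D.leviRealC P :=
  Submodule.mem_sup_right (Submodule.mem_span_singleton_self c)

theorem mem_leviRealC {x : Aff g} : x ∈ D.leviRealC P ↔ ∃ r : ℂ, x + r • c ∈ D.leviReal P := by
  rw [leviRealC, Submodule.mem_sup]
  constructor
  · rintro ⟨y, hy, z, hz, rfl⟩
    obtain ⟨r, rfl⟩ := Submodule.mem_span_singleton.mp hz
    refine ⟨-r, ?_⟩
    rwa [neg_smul, add_neg_cancel_right]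
  · rintro ⟨r, hr⟩
    exact ⟨_, hr, -r • c, Submodule.mem_span_singleton.mpr ⟨-r, rfl⟩, by
      rw [neg_smul, add_neg_cancel_right]⟩

theorem lie_mem_leviReal_of_mem_leviRealC {x y : Aff g} (hx : x ∈ D.leviRealC P)
    (hy : y ∈ D.leviRealC P) : ⁅x, y⁆ ∈ D.leviReal P := by
  obtain ⟨r, hr⟩ := (D.mem_leviRealC P).mp hx
  obtain ⟨s, hs⟩ := (D.mem_leviRealC P).mp hy
  have := (D.leviReal P).lie_mem hr hs
  simpa only [add_lie, lie_add, smul_lie, lie_smul, c_lie, lie_c, smul_zero, add_zero] using this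

/-- The elements of degree `n` of the Cartan subalgebra of `g` which occur in `l̂₀` (up to central
elements): the space `G(l̂) ∩ ĝ_{nδ}` for `n ≠ 0`, and `𝔥_l` for `n = 0`. -/
noncomputable def innerPart (n : ℤ) : Submodule ℂ g :=
  D.cartanGrade n ⊓ (D.leviRealC P).comap (mono n)

/-- The orthogonal complement of `D.innerPart P (-n)` in degree `n`: the space
`G(l̂)^⊥ ∩ ĝ_{nδ}` for `n ≠ 0`, and `𝔥_l^⊥` for `n = 0`. -/
noncomputable def outerPart (n : ℤ) : Submodule ℂ g where
  carrier := {u | u ∈ D.cartanGrade n ∧ ∀ v ∈ D.innerPart P (-n), killingForm ℂ g u v = 0}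
  zero_mem' := ⟨zero_mem _, fun v _ => by simp⟩
  add_mem' := fun {u u'} hu hu' => ⟨add_mem hu.1 hu'.1, fun v hv => by
    rw [map_add, LinearMap.add_apply, hu.2 v hv, hu'.2 v hv, add_zero]⟩
  smul_mem' := fun r u hu => ⟨Submodule.smul_mem _ r hu.1, fun v hv => by
    rw [map_smul, LinearMap.smul_apply, hu.2 v hv, smul_zero]⟩

theorem d_lie_mem_leviReal {x : Aff g} (hx : x ∈ D.leviReal P) : ⁅(d : Aff g), x⁆ ∈ D.leviReal P := by
  refine lie_mem_lieSpan_of_forall (fun y hy => ?_) hx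
  obtain ⟨-, α, -, hyα⟩ := id hy
  rw [hyα.2 ⟨d, D.d_mem_H⟩]
  exact LieSubalgebra.smul_mem _ _ (LieSubalgebra.subset_lieSpan hy)

theorem mono_mem_leviReal_of_mem_innerPart {n : ℤ} (hn : n ≠ 0) {u : g}
    (hu : u ∈ D.innerPart P n) : mono n u ∈ D.leviReal P := by
  obtain ⟨r, hr⟩ := (D.mem_leviRealC P).mp hu.2
  have h := D.d_lie_mem_leviReal P hr
  rw [lie_add, lie_smul, lie_c, smul_zero, add_zero, d_lie_mono, map_smul] at h
  have := (D.leviReal P).smul_mem ((n : ℂ)⁻¹) h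
  rwa [inv_smul_smul₀ (by exact_mod_cast hn)] at this

theorem mono_mem_heisenberg {n : ℤ} (hn : n ≠ 0) {u : g} (hu : u ∈ D.cartanGrade n) :
    mono n u ∈ D.heisenberg :=
  LieSubalgebra.subset_lieSpan (Or.inl ⟨n, hn, D.mono_mem_rootSpace_zsmul_delta hu⟩)

theorem c_mem_heisenberg : (c : Aff g) ∈ D.heisenberg :=
  LieSubalgebra.subset_lieSpan (Or.inr rfl)

/-- The coefficients of the elements of `l̂₀`, homogeneous component by homogeneous component. -/
theorem mono_loop_mem_leviRealC {x : Aff g} (hx : x ∈ D.leviReal P) :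
    x.der = 0 ∧ ∀ n, mono n (x.loop n) ∈ D.leviRealC P := by
  have hle : D.leviReal P ≤ loopSubalgebra (fun n => (D.leviRealC P).comap (mono n))
      (fun m n u v hu hv => by
        have h := D.leviReal_le_leviRealC P (D.lie_mem_leviReal_of_mem_leviRealC P hu hv)
        rw [mono_lie_mono] at h
        exact (Submodule.add_mem_iff_left _ (Submodule.smul_mem _ _ (D.c_mem_leviRealC P))).mp h) := by
    rw [leviReal, LieSubalgebra.lieSpan_le]
    intro y hy
    by_cases hy0 : y = 0
    · rw [hy0]; exact zero_mem _
    obtain ⟨-, α, hα, hyα⟩ := id hy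
    obtain ⟨n, u, -, -, rfl, -⟩ := D.exists_eq_mono_of_mem_rootSpace hα.1.1 hyα hy0
    exact mono_mem_loopSubalgebra (D.leviReal_le_leviRealC P (LieSubalgebra.subset_lieSpan hy))
  exact hle hx

variable {P}
variable [FiniteDimensional ℂ g] [LieAlgebra.IsKilling ℂ g] (hP : D.IsParabolicSubset P)
  (hG : D.heisenberg ≤ D.levi P)

include hP hG in
/-- Bracketing with an imaginary root vector preserves the set of real roots of the Levi factor. -/
theorem add_zsmul_delta_mem {α : Module.Dual ℂ D.H} (hr : α ∈ D.realRoots) (hα : α ∈ P)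
    (hα' : -α ∈ P) {n : ℤ} {u : g} (hu : u ∈ D.cartanGrade n) {x : Aff g} (hx : x ∈ D.rootSpace α)
    (h0 : ⁅mono n u, x⁆ ≠ 0) :
    α + n • D.delta ∈ D.realRoots ∧ α + n • D.delta ∈ P ∧ -(α + n • D.delta) ∈ P ∧
      ⁅mono n u, x⁆ ∈ D.rootSpace (α + n • D.delta) := by
  have hmem : ⁅mono n u, x⁆ ∈ D.rootSpace (α + n • D.delta) := by
    rw [add_comm]
    exact D.lie_mem_rootSpace (D.mono_mem_rootSpace_zsmul_delta hu) hx
  have hreal := D.add_zsmul_delta_mem_realRoots hr ((Submodule.ne_bot_iff _).mpr ⟨_, hmem, h0⟩)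
  refine ⟨hreal, ?_, ?_, hmem⟩ <;> by_cases hn : n = 0
  · simpa [hn] using hα
  · have h1 : mono n u ≠ 0 := fun h => h0 (by rw [h, zero_lie])
    exact hP.add_mem _ hα _ (hP.mem_of_mem_levi (D.zsmul_delta_ne_zero hn)
      (hG (D.mono_mem_heisenberg hn hu)) (D.mono_mem_rootSpace_zsmul_delta hu) h1).1 hreal.1
  · simpa [hn] using hα'
  · have h1 : mono n u ≠ 0 := fun h => h0 (by rw [h, zero_lie])
    have h2 := D.neg_mem_roots hreal.1
    rw [neg_add] at h2 ⊢
    exact hP.add_mem _ hα' _ (hP.mem_of_mem_levi (D.zsmul_delta_ne_zero hn)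
      (hG (D.mono_mem_heisenberg hn hu)) (D.mono_mem_rootSpace_zsmul_delta hu) h1).2 h2

include hP in
theorem forall_leviReal_generator {p : Aff g → Prop} (h0 : p 0)
    (h : ∀ α ∈ D.realRoots, α ∈ P → -α ∈ P → ∀ n u, u ∈ D.grade n → mono n u ∈ D.rootSpace α →
      (∀ h : D.cartanGrade 0, ⁅(h : g), u⁆ = α (D.toH h) • u) → p (mono n u)) :
    ∀ x ∈ {x | x ∈ D.levi P ∧ ∃ α ∈ D.realRoots, x ∈ D.rootSpace α}, p x := by
  rintro x ⟨hx, α, hα, hxα⟩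
  by_cases hx0 : x = 0
  · rwa [hx0]
  obtain ⟨h1, h2⟩ := hP.mem_of_mem_levi hα.1.1 hx hxα hx0
  obtain ⟨n, u, hu, -, rfl, -, -, hw⟩ := D.exists_eq_mono_of_mem_rootSpace hα.1.1 hxα hx0
  exact h α hα h1 h2 n u hu hxα hw

include hP hG in
/-- The orthogonal complement of the imaginary part of `l̂₀` commutes with `l̂₀`: a nonzero bracket
`[y, x]` with a real root vector `x` pairs nontrivially with a root vector `w` of the opposite real
root, and `([y, x], w) = (y, [x, w])` with `[x, w]` in the imaginary part of `l̂₀`. -/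
theorem mono_lie_eq_zero_of_mem_outerPart {n : ℤ} {u : g} (hu : u ∈ D.outerPart P n) {x : Aff g}
    (hx : x ∈ D.leviReal P) : ⁅mono n u, x⁆ = 0 := by
  refine lie_eq_zero_of_mem_lieSpan (D.forall_leviReal_generator hP (lie_zero _) ?_) hx
  intro α hr hα hα' m w hw hxα hww
  by_contra h0
  obtain ⟨hr₁, h₁, h₁', hmem⟩ := D.add_zsmul_delta_mem hP hG hr hα hα' hu.1 hxα h0
  obtain ⟨k, z, hz, hz0, hzeq, -⟩ := D.exists_eq_mono_of_mem_rootSpace hr₁.1.1 hmem h0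
  obtain ⟨rfl, rfl⟩ : n + m = k ∧ ⁅u, w⁆ = z := by
    have h1 := congrArg Aff.loop hzeq
    rw [mono_lie_mono, add_loop, smul_loop, c_loop, smul_zero, add_zero, mono_loop, mono_loop,
      Finsupp.single_eq_single_iff] at h1
    exact h1.resolve_right fun h => hz0 h.2
  rw [hzeq] at hmem h0
  obtain ⟨v, hv, hvα, hκ⟩ := D.exists_opposite_rootSpace hr₁.1.1 hmem h0
  have hvl : mono (-(n + m)) v ∈ D.leviReal P :=
    D.rootSpace_le_leviReal P (D.neg_mem_realRoots hr₁) h₁' (by rwa [neg_neg]) hvα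
  have hxl := D.rootSpace_le_leviReal P hr hα hα' hxα
  have hmn : m + -(n + m) = -n := by ring
  have hwv : ⁅w, v⁆ ∈ D.innerPart P (-n) := by
    refine ⟨⟨D.mem_cartan_of_forall_lie_eq_zero fun h hh => ?_, ?_⟩, ?_⟩
    · have h2 := (D.lie_mem_rootSpace hxα hvα).2 (D.toH ⟨h, hh⟩)
      have h3 : (α + -(α + n • D.delta)) (D.toH ⟨h, hh⟩) = 0 := by simp
      rw [h3, zero_smul, coe_toH, mono_lie_mono, lie_add, lie_smul, lie_c, smul_zero, add_zero,
        mono_zero_lie_mono] at h2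
      exact mono_injective _ (h2.trans (map_zero _).symm)
    · exact hmn ▸ D.lie_mem_grade hw hv
    · have h2 := D.leviReal_le_leviRealC P ((D.leviReal P).lie_mem hxl hvl)
      rw [mono_lie_mono, hmn] at h2
      exact (Submodule.add_mem_iff_left _ (Submodule.smul_mem _ _ (D.c_mem_leviRealC P))).mp h2
  apply hκ
  rw [← hu.2 _ hwv]
  exact LieModule.traceForm_apply_lie_apply ℂ g g u w v

include hP hG in
/-- Nondegeneracy of the form on the imaginary part of `l̂₀`: a coefficient `u` of an element of `l̂₀`
which commutes with `l̂₀` is a sum of commutators in its own centralizer, since every real root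
vector `w` is a multiple of a bracket `[h, w]` with `h ∈ 𝔥`. -/
theorem loop_eq_zero_of_mem_outerPart {x : Aff g} (hx : x ∈ D.leviReal P) {n : ℤ}
    (h : x.loop n ∈ D.outerPart P n) : x.loop n = 0 := by
  have := D.isCartanSubalgebra
  set u := x.loop n with hu
  let E : Submodule ℂ g := Submodule.span ℂ {y | ∃ p q : g, ⁅u, p⁆ = 0 ∧ ⁅u, q⁆ = 0 ∧ y = ⁅p, q⁆}
  have hcomm : ∀ p ∈ E, ⁅u, p⁆ = 0 := fun p hp => by
    induction hp using Submodule.span_induction with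
    | zero => simp
    | add a b _ _ ha hb => rw [lie_add, ha, hb, add_zero]
    | smul r a _ ha => rw [lie_smul, ha, smul_zero]
    | mem a ha =>
      obtain ⟨p, q, hp, hq, rfl⟩ := ha
      rw [leibniz_lie, hp, hq, zero_lie, lie_zero, add_zero]
  have hle : D.leviReal P ≤ loopSubalgebra (fun _ => E) (fun _ _ p q hp hq =>
      Submodule.subset_span ⟨p, q, hcomm p hp, hcomm q hq, rfl⟩) := by
    rw [leviReal, LieSubalgebra.lieSpan_le]
    refine D.forall_leviReal_generator hP (zero_mem _) ?_
    intro α hr hα hα' m w _ hwα hw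
    refine mono_mem_loopSubalgebra ?_
    obtain ⟨k, hk⟩ := D.exists_apply_toH_ne_zero hr
    have h1 : ⁅u, w⁆ = 0 := by
      have h2 := D.mono_lie_eq_zero_of_mem_outerPart hP hG h
        (D.rootSpace_le_leviReal P hr hα hα' hwα)
      have h3 := congrArg Aff.loop h2
      rw [mono_lie_mono, add_loop, smul_loop, c_loop, smul_zero, add_zero, mono_loop,
        zero_loop, Finsupp.single_eq_zero] at h3
      exact h3
    have h2 : ⁅(k : g), w⁆ ∈ E := Submodule.subset_span
      ⟨k, w, D.lie_eq_zero_of_mem_cartan h.1.1 k.2.1, h1, rfl⟩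
    rw [hw k] at h2
    exact (Submodule.smul_mem_iff _ hk).mp h2
  exact eq_zero_of_mem_span_lie_centralizer h.1.1 ((hle hx).2 n)

include hP hG in
theorem eq_zero_of_mem_innerPart_of_mem_outerPart {n : ℤ} {u : g} (hu : u ∈ D.innerPart P n)
    (hu' : u ∈ D.outerPart P n) : u = 0 := by
  obtain ⟨r, hr⟩ := (D.mem_leviRealC P).mp hu.2
  have h1 : (mono n u + r • (c : Aff g)).loop n = u := by simp
  have h2 := D.loop_eq_zero_of_mem_outerPart hP hG hr (n := n) (by rwa [h1])
  rwa [h1] at h2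

include hP hG in
/-- Orthogonal decomposition of the Cartan subalgebra of `g`, degree by degree. -/
theorem exists_innerPart_add_outerPart {n : ℤ} {u : g} (hu : u ∈ D.cartanGrade n) :
    ∃ a ∈ D.innerPart P n, ∃ b ∈ D.outerPart P n, u = a + b := by
  let φ (m : ℤ) : g →ₗ[ℂ] Module.Dual ℂ (D.innerPart P (-m)) :=
    (Module.Dual.transpose (R := ℂ) (D.innerPart P (-m)).subtype) ∘ₗ killingForm ℂ g
  have hφ : ∀ m a v, φ m a v = killingForm ℂ g a v := fun m a v => rfl
  have hinj : ∀ m, Function.Injective ((φ m).domRestrict (D.innerPart P m)) := by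
    intro m
    rw [← LinearMap.ker_eq_bot, LinearMap.ker_eq_bot']
    rintro ⟨a, ha⟩ h0
    refine Subtype.ext (D.eq_zero_of_mem_innerPart_of_mem_outerPart hP hG ha ⟨ha.1, fun v hv => ?_⟩)
    have := LinearMap.congr_fun h0 ⟨v, hv⟩
    rwa [LinearMap.domRestrict_apply, hφ] at this
  have hdim : Module.finrank ℂ (D.innerPart P n) =
      Module.finrank ℂ (Module.Dual ℂ (D.innerPart P (-n))) := by
    refine le_antisymm (LinearMap.finrank_le_finrank_of_injective (hinj n)) ?_
    rw [Subspace.dual_finrank_eq]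
    have := LinearMap.finrank_le_finrank_of_injective (hinj (-n))
    rwa [Subspace.dual_finrank_eq, neg_neg] at this
  obtain ⟨⟨a, ha⟩, hau⟩ :=
    (LinearMap.injective_iff_surjective_of_finrank_eq_finrank hdim).mp (hinj n) (φ n u)
  refine ⟨a, ha, u - a, ⟨sub_mem hu ha.1, fun v hv => ?_⟩, by abel⟩
  have h1 := LinearMap.congr_fun hau ⟨v, hv⟩
  rw [LinearMap.domRestrict_apply, hφ, hφ] at h1
  rw [map_sub, LinearMap.sub_apply, sub_eq_zero]
  exact h1.symm

end AffineDatum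

end AffineKM

/-! ### The structure of the Levi factor -/

namespace AffineKM

open Aff

namespace AffineDatum

variable {ι g : Type*} [Finite ι] [LieRing g] [LieAlgebra ℂ g] (D : AffineDatum ι g)

/-- The subalgebra `⨁_{n ≠ 0} F n tⁿ ⊕ ℂ c` of the Heisenberg algebra, for a family of subspaces of
the graded pieces of the Cartan subalgebra. -/
noncomputable def heisenbergOf (F : ℤ → Submodule ℂ g) (hF : ∀ n, F n ≤ D.cartanGrade n) :
    LieSubalgebra ℂ (Aff g) :=
  loopSubalgebra (fun n => if n = 0 then ⊥ else F n) fun m n u v hu hv => by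
    have h : ∀ m u, (u ∈ if m = 0 then ⊥ else F m) → u ∈ D.cartan := fun m u hu => by
      split_ifs at hu
      · rw [(Submodule.mem_bot ℂ).mp hu]; exact zero_mem _
      · exact (hF m hu).1
    rw [D.lie_eq_zero_of_mem_cartan (h m u hu) (h n v hv)]
    exact zero_mem _

section heisenbergOf

variable {D} {F : ℤ → Submodule ℂ g} {hF : ∀ n, F n ≤ D.cartanGrade n}

theorem mem_heisenbergOf {x : Aff g} :
    x ∈ D.heisenbergOf F hF ↔ x.der = 0 ∧ x.loop 0 = 0 ∧ ∀ n, x.loop n ∈ F n := by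
  rw [heisenbergOf, mem_loopSubalgebra]
  refine and_congr_right fun _ => ⟨fun h => ?_, fun h n => ?_⟩
  · have h0 : x.loop 0 = 0 := by simpa using h 0
    refine ⟨h0, fun n => ?_⟩
    by_cases hn : n = 0
    · rw [hn, h0]; exact zero_mem _
    · simpa [hn] using h n
  · split_ifs with hn
    · rw [hn, h.1]; exact zero_mem _
    · exact h.2 n

theorem mono_mem_heisenbergOf {n : ℤ} (hn : n ≠ 0) {u : g} (hu : u ∈ F n) :
    mono n u ∈ D.heisenbergOf F hF :=
  mono_mem_loopSubalgebra (by simpa [hn] using hu)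

theorem c_mem_heisenbergOf : (c : Aff g) ∈ D.heisenbergOf F hF :=
  mem_heisenbergOf.mpr ⟨rfl, rfl, fun n => by simp⟩

theorem heisenbergOf_le {C : LieSubalgebra ℂ (Aff g)} (h : ∀ n ≠ 0, ∀ u ∈ F n, mono n u ∈ C)
    (hc : c ∈ C) : D.heisenbergOf F hF ≤ C := by
  intro x hx
  obtain ⟨h1, h2, h3⟩ := mem_heisenbergOf.mp hx
  rw [eq_sum_mono x, h1, zero_smul, add_zero]
  refine add_mem (sum_mem fun n hn => h n ?_ _ (h3 n)) (C.smul_mem _ hc)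
  rintro rfl
  exact (Finsupp.mem_support_iff.mp hn) h2

theorem d_lie_mem_heisenbergOf {x : Aff g} (hx : x ∈ D.heisenbergOf F hF) :
    ⁅(d : Aff g), x⁆ ∈ D.heisenbergOf F hF := by
  obtain ⟨h1, h2, h3⟩ := mem_heisenbergOf.mp hx
  refine mem_heisenbergOf.mpr ⟨rfl, ?_, fun n => ?_⟩
  · simp [loopDeg_apply]
  · simpa [loopDeg_apply] using Submodule.smul_mem _ _ (h3 n)

theorem mono_zero_lie_eq_zero_of_mem_heisenbergOf {u : g} (hu : u ∈ D.cartan) {x : Aff g}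
    (hx : x ∈ D.heisenbergOf F hF) : ⁅mono 0 u, x⁆ = 0 := by
  obtain ⟨h1, h2, h3⟩ := mem_heisenbergOf.mp hx
  rw [eq_sum_mono x, h1, zero_smul, add_zero, lie_add, lie_sum, lie_smul, lie_c, smul_zero, add_zero]
  refine Finset.sum_eq_zero fun n _ => ?_
  rw [mono_zero_lie_mono, D.lie_eq_zero_of_mem_cartan hu (hF n (h3 n)).1, map_zero]

end heisenbergOf

variable (P : Set (Module.Dual ℂ D.H))

theorem innerPart_le (n : ℤ) : D.innerPart P n ≤ D.cartanGrade n := inf_le_left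

theorem outerPart_le (n : ℤ) : D.outerPart P n ≤ D.cartanGrade n := fun _ h => h.1

theorem mono_mem_heisenbergLevi {n : ℤ} (hn : n ≠ 0) {v : g} (hv : v ∈ D.innerPart P n) :
    mono n v ∈ D.heisenbergLevi P :=
  LieSubalgebra.subset_lieSpan ⟨D.mono_mem_leviReal_of_mem_innerPart P hn hv, n, hn,
    D.mono_mem_rootSpace_zsmul_delta hv.1⟩

variable [LieAlgebra.IsKilling ℂ g]

theorem heisenberg_le_heisenbergOf :
    D.heisenberg ≤ D.heisenbergOf D.cartanGrade fun _ => le_rfl := by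
  rw [heisenberg, LieSubalgebra.lieSpan_le]
  rintro x (⟨k, hk, hx⟩ | rfl)
  · obtain ⟨u, hu, rfl⟩ := D.exists_eq_mono_of_mem_rootSpace_zsmul_delta hk hx
    exact mono_mem_heisenbergOf hk hu
  · exact c_mem_heisenbergOf

theorem heisenbergLevi_le_heisenbergOf :
    D.heisenbergLevi P ≤ D.heisenbergOf (D.innerPart P) (D.innerPart_le P) := by
  rw [heisenbergLevi, LieSubalgebra.lieSpan_le]
  rintro x ⟨hx, k, hk, hxk⟩
  obtain ⟨u, hu, rfl⟩ := D.exists_eq_mono_of_mem_rootSpace_zsmul_delta hk hxk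
  exact mono_mem_heisenbergOf hk ⟨hu, D.leviReal_le_leviRealC P hx⟩

/-- Explicit form of `G(l̂)^⊥`. -/
theorem heisenbergPerp_eq :
    D.heisenbergPerp P = D.heisenbergOf (D.outerPart P) (D.outerPart_le P) := by
  apply le_antisymm
  · rw [heisenbergPerp, LieSubalgebra.lieSpan_le]
    rintro x ⟨hx, hperp⟩
    obtain ⟨h1, h2, h3⟩ := mem_heisenbergOf.mp (D.heisenberg_le_heisenbergOf hx)
    refine mem_heisenbergOf.mpr ⟨h1, h2, fun n => ?_⟩
    by_cases hn : n = 0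
    · rw [hn, h2]; exact zero_mem _
    · refine ⟨h3 n, fun v hv => ?_⟩
      rw [← form_mono_right]
      exact hperp _ (D.mono_mem_heisenbergLevi P (neg_ne_zero.mpr hn) hv)
  · refine heisenbergOf_le (fun n hn u hu => LieSubalgebra.subset_lieSpan
      ⟨D.mono_mem_heisenberg hn hu.1, fun y hy => ?_⟩)
      (LieSubalgebra.subset_lieSpan ⟨D.c_mem_heisenberg, fun y hy => ?_⟩)
    · rw [form_mono_left]
      exact hu.2 _ ((mem_heisenbergOf.mp (D.heisenbergLevi_le_heisenbergOf P hy)).2.2 _)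
    · have h1 := (mem_heisenbergOf.mp (D.heisenbergLevi_le_heisenbergOf P hy)).1
      simp [form, h1]

theorem c_mem_heisenbergPerp : (c : Aff g) ∈ D.heisenbergPerp P := by
  rw [heisenbergPerp_eq]; exact c_mem_heisenbergOf

theorem d_lie_mem_heisenbergPerp {y : Aff g} (hy : y ∈ D.heisenbergPerp P) :
    ⁅(d : Aff g), y⁆ ∈ D.heisenbergPerp P := by
  rw [heisenbergPerp_eq] at hy ⊢; exact d_lie_mem_heisenbergOf hy

theorem lie_hPerp_heisenbergPerp {h y : Aff g} (hh : h ∈ D.hPerp P)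
    (hy : y ∈ D.heisenbergPerp P) : ⁅h, y⁆ = 0 := by
  obtain ⟨u, hu, rfl⟩ := hh.1
  rw [heisenbergPerp_eq] at hy
  exact mono_zero_lie_eq_zero_of_mem_heisenbergOf hu.1 hy

omit [LieAlgebra.IsKilling ℂ g] in
theorem lie_hPerp_hPerp {h h' : Aff g} (hh : h ∈ D.hPerp P) (hh' : h' ∈ D.hPerp P) :
    ⁅h, h'⁆ = 0 :=
  D.lie_eq_zero_of_mem_H (Submodule.mem_sup_left hh.1) (Submodule.mem_sup_left hh'.1)

omit [LieAlgebra.IsKilling ℂ g] in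
theorem d_lie_hPerp {h : Aff g} (hh : h ∈ D.hPerp P) : ⁅(d : Aff g), h⁆ = 0 :=
  D.lie_eq_zero_of_mem_H D.d_mem_H (Submodule.mem_sup_left hh.1)

omit [LieAlgebra.IsKilling ℂ g] in
theorem exists_add_smul_d_of_mem_sup {S : LieSubalgebra ℂ (Aff g)} (hS : ∀ s ∈ S, ⁅(d : Aff g), s⁆ ∈ S)
    {x : Aff g} (hx : x ∈ S ⊔ LieSubalgebra.lieSpan ℂ (Aff g) {d}) :
    ∃ s ∈ S, ∃ r : ℂ, x = s + r • d := by
  obtain ⟨s, hs, t, ht, rfl⟩ := exists_add_eq_of_mem_sup (fun t ht s hs => by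
    obtain ⟨r, rfl⟩ := mem_lieSpan_singleton ht
    rw [smul_lie]
    exact S.smul_mem r (hS s hs)) hx
  obtain ⟨r, rfl⟩ := mem_lieSpan_singleton ht
  exact ⟨s, hs, r, rfl⟩

variable {P} [FiniteDimensional ℂ g] (hP : D.IsParabolicSubset P) (hG : D.heisenberg ≤ D.levi P)

include hP hG in
theorem lie_heisenbergPerp_leviReal {x y : Aff g} (hy : y ∈ D.heisenbergPerp P)
    (hx : x ∈ D.leviReal P) : ⁅y, x⁆ = 0 := by
  rw [heisenbergPerp_eq] at hy
  obtain ⟨h1, h2, h3⟩ := mem_heisenbergOf.mp hy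
  rw [eq_sum_mono y, h1, zero_smul, add_zero, add_lie, sum_lie, smul_lie, c_lie, smul_zero, add_zero]
  exact Finset.sum_eq_zero fun n _ => D.mono_lie_eq_zero_of_mem_outerPart hP hG (h3 n) hx

include hP hG in
theorem lie_heisenberg_mem_leviReal {y x : Aff g} (hy : y ∈ D.heisenberg)
    (hx : x ∈ D.leviReal P) : ⁅y, x⁆ ∈ D.leviReal P := by
  refine lie_mem_of_mem_lieSpan (fun t ht s hs => ?_) hy x hx
  rcases ht with ⟨k, hk, ht⟩ | rfl
  · obtain ⟨u, hu, rfl⟩ := D.exists_eq_mono_of_mem_rootSpace_zsmul_delta hk ht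
    refine lie_mem_lieSpan_of_forall (D.forall_leviReal_generator hP (by simp) ?_) hs
    intro α hr hα hα' n w _ hw _
    by_cases h0 : ⁅mono k u, mono n w⁆ = 0
    · rw [h0]; exact zero_mem _
    · obtain ⟨h1, h2, h3, h4⟩ := D.add_zsmul_delta_mem hP hG hr hα hα' hu hw h0
      exact D.rootSpace_le_leviReal P h1 h2 h3 h4
  · rw [c_lie]; exact zero_mem _

include hP hG in
theorem exists_of_mem_leviOne {x : Aff g} (hx : x ∈ D.leviOne P) :
    ∃ s ∈ D.leviReal P, ∃ y ∈ D.heisenberg, ∃ r : ℂ, x = s + (y + r • d) := by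
  have hd : ∀ s ∈ D.heisenberg, ⁅(d : Aff g), s⁆ ∈ D.heisenberg := fun s hs => by
    refine lie_mem_lieSpan_of_forall (fun y hy => ?_) hs
    rcases id hy with ⟨k, hk, hyk⟩ | rfl
    · rw [hyk.2 ⟨d, D.d_mem_H⟩]
      exact LieSubalgebra.smul_mem _ _ (LieSubalgebra.subset_lieSpan hy)
    · rw [lie_c]; exact zero_mem _
  have hle : D.leviOne P ≤
      D.leviReal P ⊔ (D.heisenberg ⊔ LieSubalgebra.lieSpan ℂ (Aff g) {d}) := by
    rw [leviOne, LieSubalgebra.lieSpan_le]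
    rintro y (⟨hy, α, hα, hyα⟩ | rfl)
    · by_cases h : ∃ k : ℤ, k ≠ 0 ∧ α = k • D.delta
      · obtain ⟨k, hk, rfl⟩ := h
        have h1 : y ∈ D.heisenberg := LieSubalgebra.subset_lieSpan (Or.inl ⟨k, hk, hyα⟩)
        exact (le_sup_left.trans le_sup_right : D.heisenberg ≤ _) h1
      · push Not at h
        have h1 : y ∈ D.leviReal P := LieSubalgebra.subset_lieSpan ⟨hy, α, ⟨hα, h⟩, hyα⟩
        exact (le_sup_left : D.leviReal P ≤ _) h1
    · exact (le_sup_right.trans le_sup_right : LieSubalgebra.lieSpan ℂ (Aff g) {d} ≤ _)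
        (LieSubalgebra.subset_lieSpan rfl)
  obtain ⟨s, hs, t, ht, rfl⟩ := exists_add_eq_of_mem_sup (fun t ht s hs => by
    obtain ⟨y, hy, r, rfl⟩ := exists_add_smul_d_of_mem_sup hd ht
    rw [add_lie, smul_lie]
    exact add_mem (D.lie_heisenberg_mem_leviReal hP hG hy hs)
      ((D.leviReal P).smul_mem r (D.d_lie_mem_leviReal P hs))) (hle hx)
  obtain ⟨y, hy, r, rfl⟩ := exists_add_smul_d_of_mem_sup hd ht
  exact ⟨s, hs, y, hy, r, rfl⟩

include hP hG in
theorem mono_mem_hPerp {u : g} (hu : u ∈ D.outerPart P 0) : mono 0 u ∈ D.hPerp P := by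
  refine ⟨⟨u, hu.1, rfl⟩, ?_⟩
  rintro _ ⟨⟨-, h1⟩, ⟨v, hv, rfl⟩⟩
  obtain ⟨s, hs, y, hy, r, hvs⟩ := D.exists_of_mem_leviOne hP hG h1
  obtain ⟨-, hy0, -⟩ := mem_heisenbergOf.mp (D.heisenberg_le_heisenbergOf hy)
  have h2 : v = s.loop 0 := by
    have := DFunLike.congr_fun (congrArg Aff.loop hvs) 0
    simpa [hy0] using this
  have h3 := (D.mono_loop_mem_leviRealC P hs).2 0
  rw [form_mono_mono, if_pos (add_zero 0)]
  refine hu.2 v ?_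
  rw [neg_zero]
  exact ⟨hv, by rw [h2]; exact h3⟩

omit [LieAlgebra.IsKilling ℂ g] [FiniteDimensional ℂ g] in
theorem mono_mem_leviOne (hG : D.heisenberg ≤ D.levi P) {n : ℤ} (hn : n ≠ 0) {u : g}
    (hu : u ∈ D.cartanGrade n) : mono n u ∈ D.leviOne P := by
  by_cases h0 : mono n u = 0
  · rw [h0]; exact zero_mem _
  have h1 := D.mono_mem_rootSpace_zsmul_delta hu
  exact LieSubalgebra.subset_lieSpan (Or.inl ⟨hG (D.mono_mem_heisenberg hn hu), n • D.delta,
    ⟨D.zsmul_delta_ne_zero hn, (Submodule.ne_bot_iff _).mpr ⟨_, h1, h0⟩⟩, h1⟩)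

include hG in
/-- The central element is a bracket of imaginary root vectors of degrees `±r`. -/
theorem c_mem_leviOne {u : g} (hu : u ∈ D.cartanGrade 0) (hu0 : u ≠ 0) :
    (c : Aff g) ∈ D.leviOne P := by
  have hr : (orderOf D.perm : ℤ) ≠ 0 := by exact_mod_cast D.orderOf_perm_pos.ne'
  obtain ⟨v, hv, hwv, hκ⟩ := D.exists_opposite_weight hu0 hu.2 (χ := 0) fun h => by
    rw [D.lie_eq_zero_of_mem_cartan h.2.1 hu.1]; simp
  rw [neg_zero] at hv
  have hv' : v ∈ D.cartan :=
    D.mem_cartan_of_forall_lie_eq_zero fun h hh => by simpa using hwv ⟨h, hh⟩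
  have h1 := D.mono_mem_leviOne hG hr ⟨hu.1, D.mem_grade_orderOf hu.2⟩
  have h2 := D.mono_mem_leviOne hG (neg_ne_zero.mpr hr) ⟨hv', D.mem_grade_neg_orderOf hv⟩
  have h3 := (D.leviOne P).lie_mem h1 h2
  rw [mono_lie_mono, D.lie_eq_zero_of_mem_cartan hu.1 hv', map_zero, zero_add,
    if_pos (add_neg_cancel _)] at h3
  refine (Submodule.smul_mem_iff (D.leviOne P).toSubmodule (mul_ne_zero ?_ hκ)).mp h3
  exact_mod_cast hr

include hG in
theorem mem_outerPart_of_mem_hPerp {u : g} (hu : u ∈ D.cartanGrade 0) (h : mono 0 u ∈ D.hPerp P) :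
    u ∈ D.outerPart P 0 := by
  refine ⟨hu, fun v hv => ?_⟩
  rw [neg_zero] at hv
  by_cases hv0 : v = 0
  · rw [hv0, map_zero]
  have hle : D.leviReal P ≤ D.leviOne P :=
    LieSubalgebra.lieSpan_mono fun x hx => Or.inl ⟨hx.1, hx.2.choose, hx.2.choose_spec.1.1,
      hx.2.choose_spec.2⟩
  have h1 : mono 0 v ∈ D.leviOne P := by
    obtain ⟨r, hr⟩ := (D.mem_leviRealC P).mp hv.2
    have := sub_mem (hle hr) ((D.leviOne P).smul_mem r (D.c_mem_leviOne hG hv.1 hv0))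
    rwa [add_sub_cancel_right] at this
  have h2 := h.2 (mono 0 v) ⟨⟨D.mono_mem_H hv.1, h1⟩, ⟨v, hv.1, rfl⟩⟩
  rwa [form_mono_mono, if_pos (add_zero 0)] at h2

include hP hG in
theorem lie_hPerp_leviReal {h x : Aff g} (hh : h ∈ D.hPerp P) (hx : x ∈ D.leviReal P) :
    ⁅h, x⁆ = 0 := by
  obtain ⟨u, hu, rfl⟩ := id hh.1
  exact D.mono_lie_eq_zero_of_mem_outerPart hP hG (D.mem_outerPart_of_mem_hPerp hG hu hh) hx

include hP hG in
/-- The Levi factor is the sum of `l̂₀`, `G(l̂)^⊥`, `𝔥_l^⊥` and `ℂ d`. -/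
theorem exists_of_mem_levi {z : Aff g} (hz : z ∈ D.levi P) :
    ∃ x ∈ D.leviReal P, ∃ y ∈ D.heisenbergPerp P, ∃ h ∈ D.hPerp P, ∃ r : ℂ,
      z = x + y + h + r • d := by
  let B := LieSubalgebra.lieSpan ℂ (Aff g) (D.hPerp P : Set (Aff g))
  have hB : ∀ s ∈ B, s ∈ D.hPerp P := fun s hs =>
    mem_of_mem_lieSpan_abelian (fun x hx y hy => D.lie_hPerp_hPerp P hx hy) hs
  let T₁ := B ⊔ LieSubalgebra.lieSpan ℂ (Aff g) {d}
  have hT₁ : ∀ t ∈ T₁, ∃ h ∈ D.hPerp P, ∃ r : ℂ, t = h + r • d := fun t ht => by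
    obtain ⟨s, hs, r, rfl⟩ := exists_add_smul_d_of_mem_sup (S := B)
      (fun s hs => by rw [D.d_lie_hPerp P (hB s hs)]; exact zero_mem _) ht
    exact ⟨s, hB s hs, r, rfl⟩
  have hT₂ : ∀ t ∈ D.heisenbergPerp P ⊔ T₁, ∃ y ∈ D.heisenbergPerp P, ∃ h ∈ D.hPerp P, ∃ r : ℂ,
      t = y + (h + r • d) := fun t ht => by
    obtain ⟨y, hy, t', ht', rfl⟩ := exists_add_eq_of_mem_sup (fun t ht s hs => by
      obtain ⟨h, hh, r, rfl⟩ := hT₁ t ht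
      rw [add_lie, smul_lie, D.lie_hPerp_heisenbergPerp P hh hs, zero_add]
      exact LieSubalgebra.smul_mem _ r (D.d_lie_mem_heisenbergPerp P hs)) ht
    obtain ⟨h, hh, r, rfl⟩ := hT₁ t' ht'
    exact ⟨y, hy, h, hh, r, rfl⟩
  have hle₀ : D.leviReal P ≤ D.leviReal P ⊔ (D.heisenbergPerp P ⊔ T₁) := le_sup_left
  have hle₁ : D.heisenbergPerp P ≤ D.leviReal P ⊔ (D.heisenbergPerp P ⊔ T₁) :=
    le_sup_left.trans le_sup_right
  have hle₂ : B ≤ D.leviReal P ⊔ (D.heisenbergPerp P ⊔ T₁) :=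
    le_sup_left.trans (le_sup_right.trans le_sup_right)
  have hle₃ : LieSubalgebra.lieSpan ℂ (Aff g) {d} ≤ D.leviReal P ⊔ (D.heisenbergPerp P ⊔ T₁) :=
    le_sup_right.trans (le_sup_right.trans le_sup_right)
  have hc := hle₁ (D.c_mem_heisenbergPerp P)
  have hinner : ∀ n, ∀ u ∈ D.innerPart P n,
      mono n u ∈ D.leviReal P ⊔ (D.heisenbergPerp P ⊔ T₁) := fun n u hu => by
    obtain ⟨r, hr⟩ := (D.mem_leviRealC P).mp hu.2
    have := sub_mem (hle₀ hr) (LieSubalgebra.smul_mem _ r hc)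
    rwa [add_sub_cancel_right] at this
  have hle : D.levi P ≤ D.leviReal P ⊔ (D.heisenbergPerp P ⊔ T₁) := by
    rw [levi, LieSubalgebra.lieSpan_le]
    rintro x (hx | ⟨α, hα, hα', hx⟩)
    · obtain ⟨u, hu, a, b, rfl⟩ := D.mem_H_iff.mp hx
      obtain ⟨u₁, hu₁, u₂, hu₂, rfl⟩ := D.exists_innerPart_add_outerPart hP hG hu
      refine add_mem (add_mem ?_ (LieSubalgebra.smul_mem _ a hc))
        (LieSubalgebra.smul_mem _ b (hle₃ (LieSubalgebra.subset_lieSpan rfl)))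
      rw [map_add]
      exact add_mem (hinner 0 u₁ hu₁)
        (hle₂ (LieSubalgebra.subset_lieSpan (D.mono_mem_hPerp hP hG hu₂)))
    · by_cases h : ∃ k : ℤ, k ≠ 0 ∧ α = k • D.delta
      · obtain ⟨k, hk, rfl⟩ := h
        obtain ⟨u, hu, rfl⟩ := D.exists_eq_mono_of_mem_rootSpace_zsmul_delta hk hx
        obtain ⟨u₁, hu₁, u₂, hu₂, rfl⟩ := D.exists_innerPart_add_outerPart hP hG hu
        rw [map_add]
        refine add_mem (hinner k u₁ hu₁) (hle₁ ?_)
        rw [heisenbergPerp_eq]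
        exact mono_mem_heisenbergOf hk hu₂
      · push Not at h
        exact hle₀ (D.rootSpace_le_leviReal P ⟨hP.subset_roots hα, h⟩ hα hα' hx)
  obtain ⟨x, hx, t, ht, rfl⟩ := exists_add_eq_of_mem_sup (fun t ht s hs => by
    obtain ⟨y, hy, h, hh, r, rfl⟩ := hT₂ t ht
    rw [add_lie, add_lie, smul_lie, D.lie_heisenbergPerp_leviReal hP hG hy hs,
      D.lie_hPerp_leviReal hP hG hh hs, zero_add, zero_add]
    exact LieSubalgebra.smul_mem _ r (D.d_lie_mem_leviReal P hs)) (hle hz)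
  obtain ⟨y, hy, h, hh, r, rfl⟩ := hT₂ t ht
  exact ⟨x, hx, y, hy, h, hh, r, by abel⟩

include hP hG in
theorem exists_of_mem_leviNoD {z : Aff g} (hz : z ∈ D.leviNoD P) :
    ∃ x ∈ D.leviReal P, ∃ y ∈ D.heisenbergPerp P, ∃ h ∈ D.hPerp P, z = x + y + h := by
  have hB : ∀ s ∈ LieSubalgebra.lieSpan ℂ (Aff g) (D.hPerp P : Set (Aff g)), s ∈ D.hPerp P :=
    fun s hs => mem_of_mem_lieSpan_abelian (fun x hx y hy => D.lie_hPerp_hPerp P hx hy) hs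
  have hS : ∀ s ∈ D.leviReal P ⊔ D.heisenbergPerp P, ∃ x ∈ D.leviReal P,
      ∃ y ∈ D.heisenbergPerp P, x + y = s := fun s hs =>
    exists_add_eq_of_mem_sup (fun t ht s hs => by
      rw [D.lie_heisenbergPerp_leviReal hP hG ht hs]; exact zero_mem _) hs
  obtain ⟨s, hs, h, hh, rfl⟩ := exists_add_eq_of_mem_sup (fun t ht s hs => by
    obtain ⟨x, hx, y, hy, rfl⟩ := hS s hs
    rw [lie_add, D.lie_hPerp_leviReal hP hG (hB t ht) hx,
      D.lie_hPerp_heisenbergPerp P (hB t ht) hy, add_zero]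
    exact zero_mem _) hz
  obtain ⟨x, hx, y, hy, rfl⟩ := hS s hs
  exact ⟨x, hx, y, hy, h, hB h hh, rfl⟩

include hP hG in
/-- The sum of `l̂₀`, `G(l̂)^⊥`, `𝔥_l^⊥` and `ℂ d` is direct modulo the central element. -/
theorem eq_zero_of_add_eq_zero {x y h : Aff g} {r : ℂ} (hx : x ∈ D.leviReal P)
    (hy : y ∈ D.heisenbergPerp P) (hh : h ∈ D.hPerp P) (h0 : x + y + h + r • d = 0) :
    r = 0 ∧ h = 0 ∧ ∃ s : ℂ, y = s • c ∧ x = -s • c := by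
  obtain ⟨u, hu, rfl⟩ := id hh.1
  have hu' := D.mem_outerPart_of_mem_hPerp hG hu hh
  rw [heisenbergPerp_eq] at hy
  obtain ⟨hy1, hy2, hy3⟩ := mem_heisenbergOf.mp hy
  have hx1 := (D.mono_loop_mem_leviRealC P hx).1
  have hr : r = 0 := by
    have := congrArg Aff.der h0
    simpa [hx1, hy1] using this
  have hloop : ∀ n, x.loop n + y.loop n + (Finsupp.single 0 u : ℤ →₀ g) n = 0 := fun n => by
    have := DFunLike.congr_fun (congrArg Aff.loop h0) n
    simpa using this
  have hx0 : ∀ n, x.loop n = 0 := fun n => by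
    refine D.loop_eq_zero_of_mem_outerPart hP hG hx ?_
    have h1 : x.loop n = -(y.loop n + (Finsupp.single 0 u : ℤ →₀ g) n) := by
      rw [eq_neg_iff_add_eq_zero, ← add_assoc, hloop]
    rw [h1]
    refine neg_mem (add_mem (hy3 n) ?_)
    by_cases hn : n = 0
    · subst hn; simpa using hu'
    · rw [Finsupp.single_eq_of_ne hn]; exact zero_mem _
  have hu0 : u = 0 := by simpa [hx0, hy2] using hloop 0
  have hy0 : y = y.central • c := by
    ext1
    · ext n
      have := hloop n
      rw [hx0, hu0, Finsupp.single_zero, Finsupp.zero_apply, zero_add, add_zero] at this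
      simpa using this
    · simp
    · simpa using hy1
  refine ⟨hr, by rw [hu0, map_zero], y.central, hy0, ?_⟩
  rw [hr, hu0, map_zero, zero_smul, add_zero, add_zero] at h0
  rw [neg_smul, ← hy0, eq_neg_iff_add_eq_zero, h0]

omit [LieAlgebra.IsKilling ℂ g] in
theorem exists_countable_span (K : LieSubalgebra ℂ (Aff g)) :
    ∃ s : Set K, s.Countable ∧ Submodule.span ℂ s = ⊤ := by
  let b := Module.finBasis ℂ g
  let t : Set (Aff g) := Set.range (fun p : ℤ × _ => mono p.1 (b p.2)) ∪ {c, d}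
  have ht : t.Countable := (Set.countable_range _).union (Set.to_countable _)
  have hspan : Submodule.span ℂ t = ⊤ := by
    rw [eq_top_iff]
    intro x _
    rw [eq_sum_mono x]
    refine add_mem (add_mem (sum_mem fun n _ => ?_)
      (Submodule.smul_mem _ _ (Submodule.subset_span (Or.inr (Or.inl rfl)))))
      (Submodule.smul_mem _ _ (Submodule.subset_span (Or.inr (Or.inr rfl))))
    rw [← b.sum_repr (x.loop n), map_sum]
    refine sum_mem fun i _ => ?_
    rw [map_smul]
    exact Submodule.smul_mem _ _ (Submodule.subset_span (Or.inl ⟨(n, i), rfl⟩))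
  have hrank : Module.rank ℂ (Aff g) ≤ Cardinal.aleph0 := by
    rw [← rank_top, ← hspan]
    exact (rank_span_le t).trans (Cardinal.le_aleph0_iff_set_countable.mpr ht)
  let B := Module.Basis.ofVectorSpace ℂ K.toSubmodule
  refine ⟨Set.range B, ?_, B.span_eq⟩
  rw [← Cardinal.le_aleph0_iff_set_countable, Cardinal.mk_range_eq _ B.injective,
    B.mk_eq_rank'']
  exact (Submodule.rank_le K.toSubmodule).trans hrank

end AffineDatum

end AffineKM

/-! ### The tensor product action -/

namespace AffineKM

open Aff

section TensorOperators

variable {M S : Type*} [AddCommGroup M] [Module ℂ M] [AddCommGroup S] [Module ℂ S]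

/-- The operator `A ⊗ 1 + 1 ⊗ B + z` on `M ⊗ S`. -/
noncomputable def tensorOp (A : Module.End ℂ M) (B : Module.End ℂ S) (z : ℂ) :
    Module.End ℂ (M ⊗[ℂ] S) :=
  A.rTensor S + B.lTensor M + z • LinearMap.id

@[simp] theorem tensorOp_tmul (A : Module.End ℂ M) (B : Module.End ℂ S) (z : ℂ) (m : M) (s : S) :
    tensorOp A B z (m ⊗ₜ[ℂ] s) = A m ⊗ₜ[ℂ] s + m ⊗ₜ[ℂ] B s + z • (m ⊗ₜ[ℂ] s) := by
  simp [tensorOp]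

theorem tensorOp_add (A A' : Module.End ℂ M) (B B' : Module.End ℂ S) (z z' : ℂ) :
    tensorOp A B z + tensorOp A' B' z' = tensorOp (A + A') (B + B') (z + z') := by
  simp only [tensorOp, LinearMap.rTensor_add, LinearMap.lTensor_add, add_smul]
  abel

theorem smul_tensorOp (r : ℂ) (A : Module.End ℂ M) (B : Module.End ℂ S) (z : ℂ) :
    r • tensorOp A B z = tensorOp (r • A) (r • B) (r * z) := by
  simp only [tensorOp, LinearMap.rTensor_smul, LinearMap.lTensor_smul, smul_add, mul_smul]

theorem tensorOp_zero : tensorOp (0 : Module.End ℂ M) (0 : Module.End ℂ S) 0 = 0 := by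
  simp [tensorOp]

theorem tensorOp_lie (A A' : Module.End ℂ M) (B B' : Module.End ℂ S) (z z' : ℂ) :
    ⁅tensorOp A B z, tensorOp A' B' z'⁆ = tensorOp ⁅A, A'⁆ ⁅B, B'⁆ 0 := by
  ext m s
  simp only [LieRing.of_associative_ring_bracket, TensorProduct.AlgebraTensorModule.curry_apply,
    TensorProduct.curry_apply, LinearMap.coe_restrictScalars, LinearMap.sub_apply,
    Module.End.mul_apply, tensorOp_tmul, map_add, map_smul, TensorProduct.sub_tmul,
    TensorProduct.tmul_sub]
  module

end TensorOperators

namespace AffineDatum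

variable {ι g : Type*} [Finite ι] [LieRing g] [LieAlgebra ℂ g] (D : AffineDatum ι g)
  {P : Set (Module.Dual ℂ D.H)} [LieAlgebra.IsKilling ℂ g] [FiniteDimensional ℂ g]
  (hP : D.IsParabolicSubset P) (hG : D.heisenberg ≤ D.levi P) (lam : Module.Dual ℂ (D.hPerp P))
  {M S : Type*} [AddCommGroup M] [Module ℂ M] [AddCommGroup S] [Module ℂ S]

include hP hG in
/-- The tensor product action, on any subalgebra `K` contained in `l̂₀ + G(l̂)^⊥ + 𝔥_l^⊥ + I d`, where
`I` is `0` or `ℂ`; the operators `DM` and `DS` give the action of `d` on the two factors. The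
operator attached to `x + y + h + r d` does not depend on the choice of this decomposition, because
the two factors have the same central charge. -/
theorem exists_tensorRep {ρM : D.leviReal P →ₗ⁅ℂ⁆ Module.End ℂ M}
    {ρS : D.heisenbergPerp P →ₗ⁅ℂ⁆ Module.End ℂ S} {a : ℂ} (hM : HasCentralCharge ρM a)
    (hS : HasCentralCharge ρS a) (I : Submodule ℂ ℂ) (DM : Module.End ℂ M) (DS : Module.End ℂ S)
    (hDM : ∀ r ∈ I, ∀ x : D.leviReal P,
      r • ⁅DM, ρM x⁆ = r • ρM ⟨⁅(d : Aff g), (x : Aff g)⁆, D.d_lie_mem_leviReal P x.2⟩)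
    (hDS : ∀ r ∈ I, ∀ y : D.heisenbergPerp P,
      r • ⁅DS, ρS y⁆ = r • ρS ⟨⁅(d : Aff g), (y : Aff g)⁆, D.d_lie_mem_heisenbergPerp P y.2⟩)
    (K : LieSubalgebra ℂ (Aff g))
    (hK : ∀ z ∈ K, ∃ x ∈ D.leviReal P, ∃ y ∈ D.heisenbergPerp P, ∃ h ∈ D.hPerp P, ∃ r ∈ I,
      z = x + y + h + r • d) :
    ∃ τ : K →ₗ⁅ℂ⁆ Module.End ℂ (M ⊗[ℂ] S),
      ∀ (x : D.leviReal P) (y : D.heisenbergPerp P) (h : D.hPerp P), ∀ r ∈ I, ∀ z : K,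
        (z : Aff g) = (x : Aff g) + (y : Aff g) + (h : Aff g) + r • d →
          τ z = tensorOp (ρM x + r • DM) (ρS y + r • DS) (lam h) := by
  -- the graph of the action
  let Γ : LieSubalgebra ℂ (Aff g × Module.End ℂ (M ⊗[ℂ] S)) :=
    { carrier := {p | ∃ (x : D.leviReal P) (y : D.heisenbergPerp P) (h : D.hPerp P), ∃ r ∈ I,
        p = ((x : Aff g) + (y : Aff g) + (h : Aff g) + r • d,
          tensorOp (ρM x + r • DM) (ρS y + r • DS) (lam h))}
      zero_mem' := ⟨0, 0, 0, 0, zero_mem _, by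
        simp only [map_zero, zero_smul, add_zero, tensorOp_zero, ZeroMemClass.coe_zero]; rfl⟩
      add_mem' := by
        rintro _ _ ⟨x, y, h, r, hr, rfl⟩ ⟨x', y', h', r', hr', rfl⟩
        refine ⟨x + x', y + y', h + h', r + r', add_mem hr hr', Prod.ext ?_ ?_⟩
        · change (x : Aff g) + (y : Aff g) + (h : Aff g) + r • d +
              ((x' : Aff g) + (y' : Aff g) + (h' : Aff g) + r' • d) =
            ((x : Aff g) + (x' : Aff g)) + ((y : Aff g) + (y' : Aff g)) +
              ((h : Aff g) + (h' : Aff g)) + (r + r') • d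
          module
        · change tensorOp _ _ _ + tensorOp _ _ _ = _
          rw [tensorOp_add]
          simp only [map_add]
          congr 1 <;> module
      smul_mem' := by
        rintro s _ ⟨x, y, h, r, hr, rfl⟩
        refine ⟨s • x, s • y, s • h, s • r, Submodule.smul_mem _ s hr, Prod.ext ?_ ?_⟩
        · change s • ((x : Aff g) + (y : Aff g) + (h : Aff g) + r • d) =
            s • (x : Aff g) + s • (y : Aff g) + s • (h : Aff g) + (s • r) • d
          module
        · change s • tensorOp _ _ _ = _
          rw [smul_tensorOp]
          simp only [map_smul, smul_eq_mul, smul_add, mul_smul]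
      lie_mem' := by
        rintro _ _ ⟨x, y, h, r, hr, rfl⟩ ⟨x', y', h', r', hr', rfl⟩
        let dx (x : D.leviReal P) : D.leviReal P :=
          ⟨⁅(d : Aff g), (x : Aff g)⁆, D.d_lie_mem_leviReal P x.2⟩
        let dy (y : D.heisenbergPerp P) : D.heisenbergPerp P :=
          ⟨⁅(d : Aff g), (y : Aff g)⁆, D.d_lie_mem_heisenbergPerp P y.2⟩
        refine ⟨⁅x, x'⁆ + r • dx x' - r' • dx x, ⁅y, y'⁆ + r • dy y' - r' • dy y, 0, 0, zero_mem _,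
          Prod.ext ?_ ?_⟩
        · change ⁅(x : Aff g) + (y : Aff g) + (h : Aff g) + r • d,
              (x' : Aff g) + (y' : Aff g) + (h' : Aff g) + r' • d⁆ =
            (⁅(x : Aff g), (x' : Aff g)⁆ + r • ⁅(d : Aff g), (x' : Aff g)⁆ -
              r' • ⁅(d : Aff g), (x : Aff g)⁆) +
            (⁅(y : Aff g), (y' : Aff g)⁆ + r • ⁅(d : Aff g), (y' : Aff g)⁆ -
              r' • ⁅(d : Aff g), (y : Aff g)⁆) + 0 + (0 : ℂ) • d
          have skew : ∀ u v : Aff g, ⁅u, v⁆ = -⁅v, u⁆ := fun u v => (lie_skew u v).symm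
          simp only [add_lie, lie_add, smul_lie, lie_smul, lie_self,
            D.lie_heisenbergPerp_leviReal hP hG y.2 x'.2, D.lie_hPerp_leviReal hP hG h.2 x'.2,
            D.lie_hPerp_heisenbergPerp P h.2 y'.2, D.lie_hPerp_hPerp P h.2 h'.2,
            D.d_lie_hPerp P h'.2, skew (x : Aff g) (y' : Aff g), skew (x : Aff g) (h' : Aff g),
            skew (y : Aff g) (h' : Aff g), skew (x : Aff g) (d : Aff g),
            skew (y : Aff g) (d : Aff g), skew (h : Aff g) (d : Aff g),
            D.lie_heisenbergPerp_leviReal hP hG y'.2 x.2, D.lie_hPerp_leviReal hP hG h'.2 x.2,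
            D.lie_hPerp_heisenbergPerp P h'.2 y.2, D.d_lie_hPerp P h.2]
          module
        · change ⁅tensorOp _ _ _, tensorOp _ _ _⁆ = _
          have h1 : ∀ x' : D.leviReal P, r • ρM (dx x') = r • ⁅DM, ρM x'⁆ := fun x' =>
            (hDM r hr x').symm
          have h2 : r' • ρM (dx x) = r' • ⁅DM, ρM x⁆ := (hDM r' hr' x).symm
          have h3 : ∀ y' : D.heisenbergPerp P, r • ρS (dy y') = r • ⁅DS, ρS y'⁆ := fun y' =>
            (hDS r hr y').symm
          have h4 : r' • ρS (dy y) = r' • ⁅DS, ρS y⁆ := (hDS r' hr' y).symm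
          rw [tensorOp_lie]
          simp only [map_sub, map_add, map_smul, LieHom.map_lie, map_zero, zero_smul, add_zero,
            h1, h2, h3, h4, add_lie, lie_add, smul_lie, lie_smul, lie_self,
            ← lie_skew (ρM x) DM, ← lie_skew (ρS y) DS]
          congr 1 <;> module }
  -- single-valuedness: in a decomposition of `0` we have `y = s c` and `x = -s c`, whose actions cancel
  obtain ⟨τ, hτ⟩ := exists_rep_of_graph K Γ (fun z hz => by
      obtain ⟨x, hx, y, hy, h, hh, r, hr, rfl⟩ := hK z hz
      exact ⟨_, ⟨x, hx⟩, ⟨y, hy⟩, ⟨h, hh⟩, r, hr, rfl⟩) (by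
    rintro T ⟨x, y, h, r, hr, he⟩
    rw [Prod.mk.injEq] at he
    obtain ⟨he, rfl⟩ := he
    obtain ⟨rfl, hh, s, hys, hxs⟩ := D.eq_zero_of_add_eq_zero hP hG x.2 y.2 h.2 he.symm
    have hh : h = 0 := Subtype.ext hh
    have hcS : (c : Aff g) ∈ D.heisenbergPerp P := D.c_mem_heisenbergPerp P
    have hy : y = s • ⟨c, hcS⟩ := Subtype.ext hys
    have hyS : ρS y = (s * a) • LinearMap.id := by
      ext v
      rw [hy, map_smul, LinearMap.smul_apply, hS hcS]
      simp [mul_smul]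
    -- `c` need not belong to `l̂₀`, in which case `s = 0`
    have hxM : ρM x = (-s * a) • LinearMap.id := by
      by_cases hs : s = 0
      · have hx : x = 0 := Subtype.ext (by rw [hxs, hs]; simp)
        rw [hx, hs]; simp
      · have hcM : (c : Aff g) ∈ D.leviReal P := by
          have := (D.leviReal P).smul_mem (-s)⁻¹ x.2
          rwa [hxs, inv_smul_smul₀ (neg_ne_zero.mpr hs)] at this
        have hx : x = -s • ⟨c, hcM⟩ := Subtype.ext hxs
        ext v
        rw [hx, map_smul, LinearMap.smul_apply, hM hcM]
        simp [mul_smul]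
    rw [hh, hyS, hxM]
    ext m v
    simp [TensorProduct.neg_tmul, TensorProduct.smul_tmul'])
  exact ⟨τ, fun x y h r hr z hz => hτ z _ ⟨x, y, h, r, hr, by rw [hz]⟩⟩

variable {D lam}

omit [FiniteDimensional ℂ g] in
/-- A representation given by the formula of `exists_tensorRep` has the same central charge as its
factors. -/
theorem hasCentralCharge_of_forall {ρM : D.leviReal P →ₗ⁅ℂ⁆ Module.End ℂ M}
    {ρS : D.heisenbergPerp P →ₗ⁅ℂ⁆ Module.End ℂ S} {a : ℂ} (hS : HasCentralCharge ρS a)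
    {K : LieSubalgebra ℂ (Aff g)} {τ : K →ₗ⁅ℂ⁆ Module.End ℂ (M ⊗[ℂ] S)}
    (hτ : IsTensorRep D P lam ρM ρS τ) : HasCentralCharge τ a := by
  intro hc t
  have hcS := D.c_mem_heisenbergPerp P
  induction t with
  | zero => simp
  | add t t' ht ht' => rw [map_add, ht, ht', smul_add]
  | tmul m s => rw [hτ.heis c hc hcS, hS hcS, TensorProduct.tmul_smul]

omit [LieAlgebra.IsKilling ℂ g] [FiniteDimensional ℂ g] in
theorem isTensorRep_of_forall {ρM : D.leviReal P →ₗ⁅ℂ⁆ Module.End ℂ M}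
    {ρS : D.heisenbergPerp P →ₗ⁅ℂ⁆ Module.End ℂ S} {I : Submodule ℂ ℂ} {DM : Module.End ℂ M}
    {DS : Module.End ℂ S} {K : LieSubalgebra ℂ (Aff g)} {τ : K →ₗ⁅ℂ⁆ Module.End ℂ (M ⊗[ℂ] S)}
    (hτ : ∀ (x : D.leviReal P) (y : D.heisenbergPerp P) (h : D.hPerp P), ∀ r ∈ I, ∀ z : K,
        (z : Aff g) = (x : Aff g) + (y : Aff g) + (h : Aff g) + r • d →
          τ z = tensorOp (ρM x + r • DM) (ρS y + r • DS) (lam h)) :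
    IsTensorRep D P lam ρM ρS τ where
  real x hK hx m s := by
    rw [hτ ⟨x, hx⟩ 0 0 0 (zero_mem _) ⟨x, hK⟩ (by simp)]; simp
  heis y hK hy m s := by
    rw [hτ 0 ⟨y, hy⟩ 0 0 (zero_mem _) ⟨y, hK⟩ (by simp)]; simp
  perp h hK hh m s := by
    rw [hτ 0 0 ⟨h, hh⟩ 0 (zero_mem _) ⟨h, hK⟩ (by simp)]; simp

end AffineDatum

end AffineKM

/-! ### Multiplicity spaces of commuting actions -/

namespace AffineKM

section MultiplicitySpace

variable {K₁ K₂ V : Type*} [LieRing K₁] [LieAlgebra ℂ K₁] [LieRing K₂] [LieAlgebra ℂ K₂]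
  [AddCommGroup V] [Module ℂ V]

/-- The multiplicity space of a subrepresentation `S` of `V`: the space of homomorphisms of
representations `S → V`. -/
def multiplicitySpace (ρ : K₂ →ₗ⁅ℂ⁆ Module.End ℂ V) (S : Submodule ℂ V)
    (hS : ∀ y, ∀ v ∈ S, ρ y v ∈ S) : Submodule ℂ (S →ₗ[ℂ] V) where
  carrier := {f | ∀ y s, f (subRep ρ S hS y s) = ρ y (f s)}
  zero_mem' := by simp
  add_mem' := fun {f f'} hf hf' y s => by simp [hf y s, hf' y s]
  smul_mem' := fun r f hf y s => by simp [hf y s]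

/-- The action, on the multiplicity space, of operators which commute with `ρ`. -/
def multiplicityRep (ρ₁ : K₁ →ₗ⁅ℂ⁆ Module.End ℂ V) (ρ₂ : K₂ →ₗ⁅ℂ⁆ Module.End ℂ V)
    (hcomm : ∀ x y v, ρ₁ x (ρ₂ y v) = ρ₂ y (ρ₁ x v)) (S : Submodule ℂ V)
    (hS : ∀ y, ∀ v ∈ S, ρ₂ y v ∈ S) :
    K₁ →ₗ⁅ℂ⁆ Module.End ℂ (multiplicitySpace ρ₂ S hS) where
  toFun x :=
    { toFun := fun f => ⟨ρ₁ x ∘ₗ f.1, fun y s => by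
        rw [LinearMap.comp_apply, f.2 y s, hcomm, LinearMap.comp_apply]⟩
      map_add' := fun f f' => by ext; simp
      map_smul' := fun r f => by ext; simp }
  map_add' x x' := by ext; simp
  map_smul' r x := by ext; simp
  map_lie' := by intro x x'; ext; simp [LieRing.of_associative_ring_bracket]

/-- Two commuting actions on `V` which together act irreducibly: if the second one has an
irreducible subrepresentation `S`, then the evaluation map from the tensor product of the
multiplicity space with `S` to `V` is bijective, and the multiplicity space is irreducible. -/
theorem exists_tensor_equiv_of_commute (ρ₁ : K₁ →ₗ⁅ℂ⁆ Module.End ℂ V)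
    (ρ₂ : K₂ →ₗ⁅ℂ⁆ Module.End ℂ V) (hcomm : ∀ x y v, ρ₁ x (ρ₂ y v) = ρ₂ y (ρ₁ x v))
    (hirr : ∀ W : Submodule ℂ V, (∀ x, ∀ w ∈ W, ρ₁ x w ∈ W) → (∀ y, ∀ w ∈ W, ρ₂ y w ∈ W) →
      W = ⊥ ∨ W = ⊤)
    (hK₂ : ∃ s : Set K₂, s.Countable ∧ Submodule.span ℂ s = ⊤)
    (S : Submodule ℂ V) (hS : ∀ y, ∀ v ∈ S, ρ₂ y v ∈ S)
    (hSirr : IsIrreducibleRep (subRep ρ₂ S hS)) :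
    IsIrreducibleRep (multiplicityRep ρ₁ ρ₂ hcomm S hS) ∧
      ∃ Φ : (multiplicitySpace ρ₂ S hS ⊗[ℂ] S) ≃ₗ[ℂ] V, ∀ m s, Φ (m ⊗ₜ[ℂ] s) = m.1 s := by
  let N := multiplicitySpace ρ₂ S hS
  let ev : (N ⊗[ℂ] S) →ₗ[ℂ] V := TensorProduct.lift N.subtype
  have hev : ∀ (m : N) (s : S), ev (m ⊗ₜ[ℂ] s) = m.1 s := fun m s => rfl
  have hschur := hSirr.exists_eq_smul_of_commute hK₂
  obtain ⟨s₀, hs₀⟩ := @exists_ne _ hSirr.nontrivial (0 : S)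
  have hev₂ : ∀ y t, ev ((subRep ρ₂ S hS y).lTensor N t) = ρ₂ y (ev t) := by
    intro y t
    induction t with
    | zero => simp
    | add t t' ht ht' => rw [map_add, map_add, map_add, map_add, ht, ht']
    | tmul m s => rw [LinearMap.lTensor_tmul, hev, hev, m.2 y s]
  have hinj : Function.Injective ev := by
    refine (LinearMap.ker_eq_bot (R := ℂ) (R₂ := ℂ) (M := N ⊗[ℂ] S) (M₂ := V) (f := ev)).mp ?_
    by_contra hne
    obtain ⟨m, hm, h⟩ := hSirr.exists_forall_tmul_mem hschur
      (fun y t ht => by rw [LinearMap.mem_ker, hev₂, LinearMap.mem_ker.mp ht, map_zero]) hne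
    exact hm (Subtype.ext (LinearMap.ext fun s => h s))
  -- the inclusion of `S` shows that the multiplicity space is nonzero
  let inc : N := ⟨S.subtype, fun y s => rfl⟩
  -- the values `m s`, for `m` in an invariant subspace of the multiplicity space
  have key : ∀ W : Submodule ℂ N, (∀ x, ∀ m ∈ W, multiplicityRep ρ₁ ρ₂ hcomm S hS x m ∈ W) →
      Submodule.span ℂ {v | ∃ m ∈ W, ∃ s, m.1 s = v} = ⊥ ∨
        Submodule.span ℂ {v | ∃ m ∈ W, ∃ s, m.1 s = v} = ⊤ := by
    intro W hW
    refine hirr _ (fun x w hw => ?_) (fun y w hw => ?_)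
    · refine Submodule.span_induction ?_ (by simp) (fun a b _ _ ha hb => ?_)
        (fun r a _ ha => ?_) hw
      · rintro _ ⟨m, hm, s, rfl⟩
        exact Submodule.subset_span ⟨_, hW x m hm, s, rfl⟩
      · rw [map_add]; exact add_mem ha hb
      · rw [map_smul]; exact Submodule.smul_mem _ r ha
    · refine Submodule.span_induction ?_ (by simp) (fun a b _ _ ha hb => ?_)
        (fun r a _ ha => ?_) hw
      · rintro _ ⟨m, hm, s, rfl⟩
        exact Submodule.subset_span ⟨m, hm, subRep ρ₂ S hS y s, m.2 y s⟩
      · rw [map_add]; exact add_mem ha hb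
      · rw [map_smul]; exact Submodule.smul_mem _ r ha
  have hsurj : Function.Surjective ev := by
    rw [← LinearMap.range_eq_top]
    have hle : Submodule.span ℂ {v | ∃ m ∈ (⊤ : Submodule ℂ N), ∃ s, m.1 s = v} ≤
        LinearMap.range ev :=
      Submodule.span_le.mpr (by rintro _ ⟨m, -, s, rfl⟩; exact ⟨m ⊗ₜ s, hev m s⟩)
    rcases key ⊤ (fun _ _ _ => Submodule.mem_top) with h | h
    · refine absurd ?_ hs₀
      have h1 : (s₀ : V) ∈ Submodule.span ℂ {v | ∃ m ∈ (⊤ : Submodule ℂ N), ∃ s, m.1 s = v} :=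
        Submodule.subset_span ⟨inc, Submodule.mem_top, s₀, rfl⟩
      rw [h, Submodule.mem_bot] at h1
      exact Subtype.ext h1
    · exact eq_top_iff.mpr (h ▸ hle)
  refine ⟨(isIrreducibleRep_iff _).mpr ⟨⟨inc, 0, fun h => hs₀ (Subtype.ext ?_)⟩, fun W hW => ?_⟩,
    LinearEquiv.ofBijective ev ⟨hinj, hsurj⟩, hev⟩
  · exact LinearMap.congr_fun (congrArg Subtype.val h) s₀
  rcases key W hW with h | h
  · left
    rw [Submodule.eq_bot_iff]
    intro m hm
    refine Subtype.ext (LinearMap.ext fun s => ?_)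
    have h1 : m.1 s ∈ Submodule.span ℂ {v | ∃ m ∈ W, ∃ s, m.1 s = v} :=
      Submodule.subset_span ⟨m, hm, s, rfl⟩
    rwa [h, Submodule.mem_bot] at h1
  · right
    -- a functional vanishing on `W` vanishes on the first factor of every tensor
    rw [eq_top_iff]
    intro m _
    by_contra hm
    obtain ⟨ψ, hψm, hψ⟩ := Submodule.exists_le_ker_of_notMem hm
    let U : Submodule ℂ V := (LinearMap.ker ((TensorProduct.lid ℂ S).toLinearMap ∘ₗ ψ.rTensor S)).map ev
    have hU : (⊤ : Submodule ℂ V) ≤ U := by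
      rw [← h, Submodule.span_le]
      rintro _ ⟨m', hm', s, rfl⟩
      refine ⟨m' ⊗ₜ s, ?_, hev m' s⟩
      have : ψ m' = 0 := hψ hm'
      simp [this]
    obtain ⟨t, ht, hte⟩ := hU (Submodule.mem_top (x := ev (m ⊗ₜ s₀)))
    rw [hinj hte] at ht
    have h2 : ψ m • s₀ = 0 := ht
    exact (smul_ne_zero hψm hs₀) h2

end MultiplicitySpace

end AffineKM

/-! ### The modules over the Levi factor -/

namespace AffineKM

open Aff

namespace AffineDatum

variable {ι g : Type*} [Finite ι] [LieRing g] [LieAlgebra ℂ g] (D : AffineDatum ι g)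
  {P : Set (Module.Dual ℂ D.H)} [LieAlgebra.IsKilling ℂ g] [FiniteDimensional ℂ g]
  (hP : D.IsParabolicSubset P) (hG : D.heisenberg ≤ D.levi P) (lam : Module.Dual ℂ (D.hPerp P))

section

variable {M S : Type*} [AddCommGroup M] [Module ℂ M] [AddCommGroup S] [Module ℂ S]

include hP hG in
theorem exists_irreducible_tensorRep_leviNoD {ρM : D.leviReal P →ₗ⁅ℂ⁆ Module.End ℂ M}
    {ρS : D.heisenbergPerp P →ₗ⁅ℂ⁆ Module.End ℂ S} {a : ℂ} (hM : IsIrreducibleRep ρM)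
    (hS : IsIrreducibleRep ρS) (hMa : HasCentralCharge ρM a) (hSa : HasCentralCharge ρS a) :
    ∃ τ : D.leviNoD P →ₗ⁅ℂ⁆ Module.End ℂ (M ⊗[ℂ] S),
      IsTensorRep D P lam ρM ρS τ ∧ HasCentralCharge τ a ∧ IsIrreducibleRep τ := by
  obtain ⟨τ, hτ⟩ := D.exists_tensorRep hP hG lam hMa hSa ⊥ 0 0
    (fun r hr x => by simp [(Submodule.mem_bot ℂ).mp hr])
    (fun r hr x => by simp [(Submodule.mem_bot ℂ).mp hr]) (D.leviNoD P) fun z hz => by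
      obtain ⟨x, hx, y, hy, h, hh, rfl⟩ := D.exists_of_mem_leviNoD hP hG hz
      exact ⟨x, hx, y, hy, h, hh, 0, zero_mem _, by simp⟩
  have hT := isTensorRep_of_forall hτ
  have := hM.nontrivial
  have := hS.nontrivial
  refine ⟨τ, hT, hasCentralCharge_of_forall hSa hT, (isIrreducibleRep_iff τ).mpr
    ⟨inferInstance, fun W hW => hM.tensor_eq_bot_or_eq_top hS (exists_countable_span _) W
      (fun x w hw => ?_) (fun y => ⟨0, fun w hw => ?_⟩)⟩⟩
  · have h := hW ⟨x, D.leviReal_le_leviNoD P x.2⟩ w hw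
    rw [hτ x 0 0 0 (zero_mem _) ⟨x, D.leviReal_le_leviNoD P x.2⟩ (by simp)] at h
    simpa [tensorOp] using h
  · have h := hW ⟨y, D.heisenbergPerp_le_leviNoD P y.2⟩ w hw
    rw [hτ 0 y 0 0 (zero_mem _) ⟨y, D.heisenbergPerp_le_leviNoD P y.2⟩ (by simp)] at h
    simpa [tensorOp] using h

include hP hG in
/-- A subspace stable under `l̂₀` and `d ⊗ 1 + 1 ⊗ d` is stable under `1 ⊗ d` up to operators acting
on the first factor, so irreducibility of the second factor over `G(l̂)^⊥ + ℂ d` suffices. -/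
theorem exists_irreducible_tensorRep_levi {ρM : D.leviRealD P →ₗ⁅ℂ⁆ Module.End ℂ M}
    {ρS : D.heisenbergPerpD P →ₗ⁅ℂ⁆ Module.End ℂ S} {a : ℂ}
    (hM : IsIrreducibleRep (resRep (D.leviReal_le_leviRealD P) ρM))
    (hS : IsIrreducibleRep ρS) (hMa : HasCentralCharge ρM a) (hSa : HasCentralCharge ρS a) :
    ∃ τ : D.levi P →ₗ⁅ℂ⁆ Module.End ℂ (M ⊗[ℂ] S),
      IsTensorRep D P lam (resRep (D.leviReal_le_leviRealD P) ρM)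
        (resRep (D.heisenbergPerp_le_heisenbergPerpD P) ρS) τ ∧
      (∀ (hd : d ∈ D.levi P) (hd₁ : d ∈ D.leviRealD P) (hd₂ : d ∈ D.heisenbergPerpD P)
        (m : M) (s : S),
        τ ⟨d, hd⟩ (m ⊗ₜ[ℂ] s) = (ρM ⟨d, hd₁⟩ m) ⊗ₜ[ℂ] s + m ⊗ₜ[ℂ] (ρS ⟨d, hd₂⟩ s)) ∧
      HasCentralCharge τ a ∧ IsIrreducibleRep τ := by
  have hd₁ : (d : Aff g) ∈ D.leviRealD P :=
    (le_sup_right : LieSubalgebra.lieSpan ℂ (Aff g) {d} ≤ _) (LieSubalgebra.subset_lieSpan rfl)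
  have hd₂ : (d : Aff g) ∈ D.heisenbergPerpD P :=
    (le_sup_right : LieSubalgebra.lieSpan ℂ (Aff g) {d} ≤ _) (LieSubalgebra.subset_lieSpan rfl)
  have hd : (d : Aff g) ∈ D.levi P := LieSubalgebra.subset_lieSpan (Or.inl D.d_mem_H)
  have hle₁ : D.leviReal P ≤ D.levi P := LieSubalgebra.lieSpan_le.mpr fun x hx => hx.1
  have hle₂ : D.heisenbergPerp P ≤ D.levi P :=
    (LieSubalgebra.lieSpan_le.mpr fun x hx => hx.1 : _ ≤ D.heisenberg).trans hG
  have hMa' : HasCentralCharge (resRep (D.leviReal_le_leviRealD P) ρM) a := fun hc m =>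
    hMa (D.leviReal_le_leviRealD P hc) m
  have hSa' : HasCentralCharge (resRep (D.heisenbergPerp_le_heisenbergPerpD P) ρS) a :=
    fun hc s => hSa (D.heisenbergPerp_le_heisenbergPerpD P hc) s
  obtain ⟨τ, hτ⟩ := D.exists_tensorRep hP hG lam hMa' hSa' ⊤ (ρM ⟨d, hd₁⟩) (ρS ⟨d, hd₂⟩)
    (fun r _ x => congrArg (r • ·)
      (ρM.map_lie ⟨d, hd₁⟩ ⟨x, D.leviReal_le_leviRealD P x.2⟩).symm)
    (fun r _ y => congrArg (r • ·)
      (ρS.map_lie ⟨d, hd₂⟩ ⟨y, D.heisenbergPerp_le_heisenbergPerpD P y.2⟩).symm)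
    (D.levi P) fun z hz => by
      obtain ⟨x, hx, y, hy, h, hh, r, rfl⟩ := D.exists_of_mem_levi hP hG hz
      exact ⟨x, hx, y, hy, h, hh, r, Submodule.mem_top, rfl⟩
  have hT := isTensorRep_of_forall hτ
  have := hM.nontrivial
  have := hS.nontrivial
  refine ⟨τ, hT, fun _ _ _ m s => ?_, hasCentralCharge_of_forall hSa' hT,
    (isIrreducibleRep_iff τ).mpr ⟨inferInstance, fun W hW =>
      hM.tensor_eq_bot_or_eq_top hS (exists_countable_span _) W (fun x w hw => ?_) fun y => ?_⟩⟩
  · rw [hτ 0 0 0 1 Submodule.mem_top ⟨d, hd⟩ (by simp)]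
    simp
  · have h := hW ⟨x, hle₁ x.2⟩ w hw
    rw [hτ x 0 0 0 Submodule.mem_top ⟨x, hle₁ x.2⟩ (by simp)] at h
    simpa [tensorOp] using h
  · obtain ⟨y, hy⟩ := y
    obtain ⟨y', hy', r, rfl⟩ := exists_add_smul_d_of_mem_sup
      (fun s hs => D.d_lie_mem_heisenbergPerp P hs) hy
    -- the action of `z = y + r d` on `M ⊗ S` differs from `1 ⊗ ρS z` by `r d ⊗ 1`
    refine ⟨r • ρM ⟨d, hd₁⟩, fun w hw => ?_⟩
    have hz : y' + r • d ∈ D.levi P := add_mem (hle₂ hy') ((D.levi P).smul_mem r hd)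
    have h := hW ⟨_, hz⟩ w hw
    rw [hτ 0 ⟨y', hy'⟩ 0 r Submodule.mem_top ⟨_, hz⟩ (by simp)] at h
    have hρ : ∀ u v : D.heisenbergPerpD P, ρS (u + r • v) = ρS u + r • ρS v := fun u v => by
      rw [map_add, map_smul]
    change _ + (ρS (⟨y', D.heisenbergPerp_le_heisenbergPerpD P hy'⟩ + r • ⟨d, hd₂⟩)).lTensor M w ∈ W
    rw [hρ]
    rw [map_zero, zero_add] at h
    simpa [tensorOp, resRep, LieSubalgebra.inclusion_apply] using h

end

include hP hG in
/-- An irreducible module with an irreducible `G(l̂)^⊥`-submodule `S` is the tensor product of the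
multiplicity space of `S` with `S`. -/
theorem exists_tensor_decomposition {V : Type v} [AddCommGroup V] [Module ℂ V]
    {ρ : D.leviNoD P →ₗ⁅ℂ⁆ Module.End ℂ V} {a : ℂ} (hρ : IsIrreducibleRep ρ)
    (ha : HasCentralCharge ρ a)
    (hlam : ∀ (h : Aff g) (hK : h ∈ D.leviNoD P) (hh : h ∈ D.hPerp P) (v : V),
      ρ ⟨h, hK⟩ v = lam ⟨h, hh⟩ • v) (S : Submodule ℂ V)
    (hS : ∀ y, ∀ v ∈ S, resRep (D.heisenbergPerp_le_leviNoD P) ρ y v ∈ S)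
    (hSirr : IsIrreducibleRep (subRep (resRep (D.heisenbergPerp_le_leviNoD P) ρ) S hS)) :
    ∃ (M : Type v) (_ : AddCommGroup M) (_ : Module ℂ M)
      (ρM : D.leviReal P →ₗ⁅ℂ⁆ Module.End ℂ M)
      (τ : D.leviNoD P →ₗ⁅ℂ⁆ Module.End ℂ (M ⊗[ℂ] S)),
      IsIrreducibleRep ρM ∧ HasCentralCharge ρM a ∧
      IsTensorRep D P lam ρM (subRep (resRep (D.heisenbergPerp_le_leviNoD P) ρ) S hS) τ ∧
      ∃ Φ : (M ⊗[ℂ] S) ≃ₗ[ℂ] V, ∀ x t, Φ (τ x t) = ρ x (Φ t) := by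
  have hcomm : ∀ (x : D.leviReal P) (y : D.heisenbergPerp P) (v : V),
      resRep (D.leviReal_le_leviNoD P) ρ x (resRep (D.heisenbergPerp_le_leviNoD P) ρ y v) =
        resRep (D.heisenbergPerp_le_leviNoD P) ρ y (resRep (D.leviReal_le_leviNoD P) ρ x v) := by
    intro x y v
    have h : ⁅(⟨y, D.heisenbergPerp_le_leviNoD P y.2⟩ : D.leviNoD P),
        (⟨x, D.leviReal_le_leviNoD P x.2⟩ : D.leviNoD P)⁆ = 0 :=
      Subtype.ext (D.lie_heisenbergPerp_leviReal hP hG y.2 x.2)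
    have h' := LinearMap.congr_fun (congrArg ρ h) v
    rw [LieHom.map_lie, map_zero, LieRing.of_associative_ring_bracket] at h'
    exact (sub_eq_zero.mp h').symm
  obtain ⟨hMirr, Φ, hΦ⟩ := exists_tensor_equiv_of_commute _ _ hcomm (fun W h₁ h₂ => by
    refine ((isIrreducibleRep_iff ρ).mp hρ).2 W fun z w hw => ?_
    obtain ⟨z, hz⟩ := z
    obtain ⟨x, hx, y, hy, h, hh, rfl⟩ := D.exists_of_mem_leviNoD hP hG hz
    have hx' := D.leviReal_le_leviNoD P hx
    have hy' := D.heisenbergPerp_le_leviNoD P hy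
    have hh' : h ∈ D.leviNoD P := by
      simpa [add_sub_cancel_left] using sub_mem hz (add_mem hx' hy')
    have he : (⟨x + y + h, hz⟩ : D.leviNoD P) = ⟨x, hx'⟩ + ⟨y, hy'⟩ + ⟨h, hh'⟩ := rfl
    rw [he, map_add, map_add, LinearMap.add_apply, LinearMap.add_apply, hlam h hh' hh]
    exact add_mem (add_mem (h₁ ⟨x, hx⟩ w hw) (h₂ ⟨y, hy⟩ w hw)) (W.smul_mem _ hw))
    (exists_countable_span _) S hS hSirr
  refine ⟨_, inferInstance, inferInstance, _,
    Φ.symm.lieConj.toLieHom.comp ρ, hMirr, fun hc m => ?_, ?_,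
    Φ, fun x t => ?_⟩
  · exact Subtype.ext (LinearMap.ext fun s => ha (D.leviReal_le_leviNoD P hc) (m.1 s))
  · refine ⟨fun x hK hx m s => ?_, fun y hK hy m s => ?_, fun h hK hh m s => ?_⟩
    · change Φ.symm (ρ ⟨x, hK⟩ (Φ (m ⊗ₜ s))) = _
      rw [LinearEquiv.symm_apply_eq, hΦ, hΦ]
      rfl
    · change Φ.symm (ρ ⟨y, hK⟩ (Φ (m ⊗ₜ s))) = _
      rw [LinearEquiv.symm_apply_eq, hΦ, hΦ, m.2 ⟨y, hy⟩ s]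
      rfl
    · change Φ.symm (ρ ⟨h, hK⟩ (Φ (m ⊗ₜ s))) = _
      rw [LinearEquiv.symm_apply_eq, map_smul]
      exact hlam h hK hh _
  · change Φ (Φ.symm (ρ x (Φ t))) = _
    rw [LinearEquiv.apply_symm_apply]

end AffineDatum

end AffineKM

theorem mainTheorem6 {ι : Type u₁} {g : Type u₂} [Finite ι] [LieRing g] [LieAlgebra ℂ g]
    [FiniteDimensional ℂ g] [LieAlgebra.IsSimple ℂ g] (D : AffineDatum ι g)
    (P : Set (Module.Dual ℂ D.H)) (hP : D.IsParabolicSubset P)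
    (hG : D.heisenberg ≤ D.levi P) (lam : Module.Dual ℂ (D.hPerp P)) :
    -- tensor products of irreducible modules with the same central charge are irreducible
    (∀ (M : Type v) (S : Type w) [AddCommGroup M] [Module ℂ M] [AddCommGroup S] [Module ℂ S]
      (ρM : D.leviReal P →ₗ⁅ℂ⁆ Module.End ℂ M) (ρS : D.heisenbergPerp P →ₗ⁅ℂ⁆ Module.End ℂ S)
      (a : ℂ),
      IsIrreducibleRep ρM → IsIrreducibleRep ρS →
      HasCentralCharge ρM a → HasCentralCharge ρS a →
      ∃ τ : D.leviNoD P →ₗ⁅ℂ⁆ Module.End ℂ (M ⊗[ℂ] S),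
        IsTensorRep D P lam ρM ρS τ ∧ HasCentralCharge τ a ∧ IsIrreducibleRep τ) ∧
    -- an irreducible module with an irreducible `G(l̂)^⊥`-submodule `S` is of the form `M ⊗ S`
    (∀ (V : Type v) [AddCommGroup V] [Module ℂ V] (ρ : D.leviNoD P →ₗ⁅ℂ⁆ Module.End ℂ V) (a : ℂ),
      IsIrreducibleRep ρ → HasCentralCharge ρ a →
      (∀ (h : Aff g) (hK : h ∈ D.leviNoD P) (hh : h ∈ D.hPerp P) (v : V),
        ρ ⟨h, hK⟩ v = lam ⟨h, hh⟩ • v) →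
      ∀ (S : Submodule ℂ V)
        (hS : ∀ y, ∀ v ∈ S, resRep (D.heisenbergPerp_le_leviNoD P) ρ y v ∈ S),
        IsIrreducibleRep (subRep (resRep (D.heisenbergPerp_le_leviNoD P) ρ) S hS) →
        ∃ (M : Type v) (_ : AddCommGroup M) (_ : Module ℂ M)
          (ρM : D.leviReal P →ₗ⁅ℂ⁆ Module.End ℂ M)
          (τ : D.leviNoD P →ₗ⁅ℂ⁆ Module.End ℂ (M ⊗[ℂ] S)),
          IsIrreducibleRep ρM ∧ HasCentralCharge ρM a ∧
          IsTensorRep D P lam ρM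
            (subRep (resRep (D.heisenbergPerp_le_leviNoD P) ρ) S hS) τ ∧
          ∃ Φ : (M ⊗[ℂ] S) ≃ₗ[ℂ] V, ∀ x t, Φ (τ x t) = ρ x (Φ t)) ∧
    -- mixed tensor modules over the whole Levi factor
    (∀ (M : Type v) (S : Type w) [AddCommGroup M] [Module ℂ M] [AddCommGroup S] [Module ℂ S]
      (ρM : D.leviRealD P →ₗ⁅ℂ⁆ Module.End ℂ M)
      (ρS : D.heisenbergPerpD P →ₗ⁅ℂ⁆ Module.End ℂ S)
      (η : UniversalEnvelopingAlgebra ℂ (D.heisenbergPerpPos P) →ₐ[ℂ] ℂ) (a : ℂ),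
      a ≠ 0 → IsWeightRep D ρM →
      IsIrreducibleRep (resRep (D.leviReal_le_leviRealD P) ρM) → HasCentralCharge ρM a →
      IsIrreducibleRep ρS → IsWhittakerRep D P η ρS → HasCentralCharge ρS a →
      {n : ℕ | 0 < n ∧ ∃ x : D.heisenbergPerpPos P,
        (x : Aff g) ∈ D.rootSpace ((n : ℤ) • D.delta) ∧
          η (UniversalEnvelopingAlgebra.ι ℂ x) ≠ 0}.Infinite →
      ∃ τ : D.levi P →ₗ⁅ℂ⁆ Module.End ℂ (M ⊗[ℂ] S),
        IsTensorRep D P lam (resRep (D.leviReal_le_leviRealD P) ρM)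
          (resRep (D.heisenbergPerp_le_heisenbergPerpD P) ρS) τ ∧
        (∀ (hd : Aff.d ∈ D.levi P) (hd₁ : Aff.d ∈ D.leviRealD P)
          (hd₂ : Aff.d ∈ D.heisenbergPerpD P) (m : M) (s : S),
          τ ⟨Aff.d, hd⟩ (m ⊗ₜ[ℂ] s)
            = (ρM ⟨Aff.d, hd₁⟩ m) ⊗ₜ[ℂ] s + m ⊗ₜ[ℂ] (ρS ⟨Aff.d, hd₂⟩ s)) ∧
        HasCentralCharge τ a ∧ IsIrreducibleRep τ) := by
  have : LieAlgebra.IsKilling ℂ g := inferInstance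
  refine ⟨?_, ?_, ?_⟩
  · intro M S _ _ _ _ ρM ρS a hM hS hMa hSa
    exact D.exists_irreducible_tensorRep_leviNoD hP hG lam hM hS hMa hSa
  · intro V _ _ ρ a hρ ha hlam S hS hSirr
    exact D.exists_tensor_decomposition hP hG lam hρ ha hlam S hS hSirr
  · intro M S _ _ _ _ ρM ρS η a _ _ hM hMa hS _ hSa _
    exact D.exists_irreducible_tensorRep_levi hP hG lam hM hS hMa hSa
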